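/- Let $(M,\pi)$ be a connected (Hausdorff, second countable, finite-dimensional, smooth) Poisson manifold, with $\{f,g\}=\pi(df,dg)$, $\pi(\alpha,\beta)=\alpha(\pi^\sharp\beta)$ and Hamiltonian vector fields $X_h=\pi^\sharp(dh)$, i.e. $X_hf=\{f,h\}$. Its symplectic leaves are the classes of points that can be joined by finite chains of integral curves of Hamiltonian vector fields; the leaf through $x$ has tangent space $\operatorname{im}\pi^\sharp_x$ and symplectic form $\pi^{-1}(\pi^\sharp\alpha,\pi^\sharp\beta)=\pi(\alpha,\beta)$. Let $\mathfrak g$ be a finite-dimensional real abelian Lie algebra and let $\rho\colon\mathfrak g\to C^\infty(M)$, $u\mapsto H_u$, be a complete weakly Hamiltonian action: $\rho$ is linear, and the vector fields $X_u:=X_{H_u}$ are complete and commute. Let $c(u,v)=\{H_u,H_v\}$ be its cocycle, write $c(x)$ for the bilinear form $(u,v)\mapsto\{H_u,H_v\}(x)$ on $\mathfrak g$, and let $\phi^s_v$ be the flow of $X_v$. Let $F\subset\mathfrak g\times M$ be a smooth vector sub-bundle over the leaf space, i.e. $F_x=F_y$ whenever $x,y$ lie in the same symplectic leaf, and suppose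 that $F$ is symplectic relative to $c$, i.e. $c(x)$ restricts to a symplectic form on $F_x$ for every $x\in M$. Then $F$ has even rank $2d$, and it determines 1. a Poisson–Dirac submanifold $N=\{x\in M : H_u(x)=0 \text{ for all } u\in F_x\}$ of $(M,\pi)$; 2. a diffeomorphism $\Phi\colon M\to F|_N\subset\mathfrak g\times M$, of the form $\Phi(y)=(v,\phi^1_v(y))$ with $\phi^1_v(y)\in N$ and $v\in F_{\phi^1_v(y)}=F_y$, such that for every $x\in N$ the inverse image $L_x=\Phi^{-1}(F_x)$ of the fibre over $x$ is a symplectic submanifold of the leaf through $x$ (embedded in $M$, contained in the leaf), and $\Phi\colon(L_x,\pi^{-1}|_{L_x})\to(F_x,c(x))$ is a symplectomorphism. Moreover, suppose that $F$ has a framing over the leaf space, i.e. a smooth global trivialization given by linear isomorphisms $\mathfrak b_x\colon F_x\to\mathbb R^{2d}$ that is constant over the symplectic leaves. Then the composite of $\Phi$ with the trivialization, $y\mapsto(\mathfrak b_x(v),x)$ where $\Phi(y)=(v,x)$, is a diffeomorphism $M\to\mathbb R^{2d}\times N$, and for every $u\in\mathbb R^{2d}$ the inverse image of $\{u\}\times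 N$ is a Poisson–Dirac submanifold of $(M,\pi)$. Here a Poisson–Dirac submanifold is an embedded submanifold $S\subset M$ with $T_xS\cap\pi^\sharp((T_xS)^\circ)=0$ for all $x\in S$ whose induced bivector field $\pi_S$ is smooth, where $\pi_S(\xi,\eta)=\pi(\alpha,\beta)$ for any extensions $\alpha,\beta\in T_x^*M$ of $\xi,\eta\in T_x^*S$ with $\pi^\sharp\alpha,\pi^\sharp\beta\in T_xS$. -/

import Mathlib

open scoped Manifold ContDiff Topology

noncomputable section

namespace PoissonSplitting

section Submanifolds

variable {E : Type*} [NormedAddCommGroup E] [NormedSpace ℝ E]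
  {H : Type*} [TopologicalSpace H] (I : ModelWithCorners ℝ E H)
  {M : Type*} [TopologicalSpace M] [ChartedSpace H M]
  {E' : Type*} [NormedAddCommGroup E'] [NormedSpace ℝ E']
  {H' : Type*} [TopologicalSpace H'] (J : ModelWithCorners ℝ E' H')
  {X : Type*} [TopologicalSpace X] [ChartedSpace H' X]

/-- `S ⊆ M` is a smooth embedded submanifold of codimension `q`: near each of its points, `S` is
the zero set of a smooth map to `ℝ^q` whose derivative is surjective along `S`. -/
def IsEmbeddedSubmanifold (q : ℕ) (S : Set M) : Prop :=
  ∀ x ∈ S, ∃ (U : Set M) (ψ : M → (Fin q → ℝ)), IsOpen U ∧ x ∈ U ∧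
    ContMDiffOn I 𝓘(ℝ, Fin q → ℝ) ∞ ψ U ∧
    (∀ y ∈ U, y ∈ S ↔ ψ y = 0) ∧
    ∀ y ∈ U ∩ S, Function.Surjective (mfderiv I 𝓘(ℝ, Fin q → ℝ) ψ y)

/-- The tangent space `T_x S ⊆ T_x M` of a submanifold `S` at a point `x ∈ S`: the vectors that are
killed by the differentials at `x` of all smooth functions vanishing on `S` near `x`. -/
def tangentSubspace (S : Set M) (x : M) : Submodule ℝ (TangentSpace I x) where
  carrier := {v | ∀ f : M → ℝ, ContMDiffAt I 𝓘(ℝ, ℝ) ∞ f x → (∀ᶠ y in 𝓝[S] x, f y = 0) →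
    (mfderiv I 𝓘(ℝ, ℝ) f x v : ℝ) = 0}
  add_mem' := by
    intro v w hv hw f hf hS
    have h := map_add (mfderiv I 𝓘(ℝ, ℝ) f x) v w
    have hv' := hv f hf hS
    have hw' := hw f hf hS
    rw [h]
    exact (congrArg₂ (fun a b : ℝ => a + b) hv' hw').trans (add_zero 0)
  zero_mem' := by
    intro f _ _
    exact map_zero (mfderiv I 𝓘(ℝ, ℝ) f x)
  smul_mem' := by
    intro c v hv f hf hS
    have h := map_smul (mfderiv I 𝓘(ℝ, ℝ) f x) c v
    rw [h]
    exact (congrArg (fun a : ℝ => c * a) (hv f hf hS)).trans (mul_zero c)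

/-- `Φ` restricts to a diffeomorphism from the submanifold `S` of `M` onto the submanifold `T` of
`X`: a smooth bijection `S → T` with a smooth inverse. -/
def IsDiffeomorphismBetween (Φ : M → X) (S : Set M) (T : Set X) : Prop :=
  ContMDiffOn I J ∞ Φ S ∧ Set.BijOn Φ S T ∧
    ∃ Ψ : X → M, ContMDiffOn J I ∞ Ψ T ∧ ∀ x ∈ S, Ψ (Φ x) = x

end Submanifolds

section Poisson

variable {E : Type*} [NormedAddCommGroup E] [NormedSpace ℝ E]
  {H : Type*} [TopologicalSpace H] (I : ModelWithCorners ℝ E H)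
  (M : Type*) [TopologicalSpace M] [ChartedSpace H M]

/-- The cotangent space `T_x^* M`. -/
abbrev Cotangent {M : Type*} [TopologicalSpace M] [ChartedSpace H M] (x : M) : Type _ :=
  TangentSpace I x →L[ℝ] ℝ

variable {M} in
/-- The differential `d_x f ∈ T_x^* M`. -/
def differential (f : M → ℝ) (x : M) : Cotangent I x :=
  mfderiv I 𝓘(ℝ, ℝ) f x

/-- A smooth bivector field `π` on `M`, given by its contraction `π^♯ : T^*M → TM`, so that
`π(α, β) = α (π^♯ β)`. Smoothness: `π(df, dg)` is smooth for all smooth functions `f`, `g`. -/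
structure BivectorField where
  sharp : ∀ x : M, Cotangent I x →ₗ[ℝ] TangentSpace I x
  skew : ∀ (x : M) (α β : Cotangent I x), α (sharp x β) = -β (sharp x α)
  smooth : ∀ f g : C^∞⟮I, M; ℝ⟯,
    ContMDiff I 𝓘(ℝ, ℝ) ∞ (fun x => differential I f x (sharp x (differential I g x)))

variable {I M}

/-- The bracket `{f, g} = π(df, dg)`. -/
def BivectorField.bracket (π : BivectorField I M) (f g : C^∞⟮I, M; ℝ⟯) : C^∞⟮I, M; ℝ⟯ :=
  ⟨fun x => differential I f x (π.sharp x (differential I g x)), π.smooth f g⟩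

variable (I M) in
/-- A Poisson structure: a smooth bivector field whose bracket satisfies the Jacobi identity. -/
structure PoissonStructure extends BivectorField I M where
  jacobi : ∀ f g h : C^∞⟮I, M; ℝ⟯,
    toBivectorField.bracket (toBivectorField.bracket f g) h +
      toBivectorField.bracket (toBivectorField.bracket g h) f +
      toBivectorField.bracket (toBivectorField.bracket h f) g = 0

namespace PoissonStructure

variable (π : PoissonStructure I M)

/-- The Poisson bracket of two smooth functions. -/
abbrev bracket (f g : C^∞⟮I, M; ℝ⟯) : C^∞⟮I, M; ℝ⟯ := π.toBivectorField.bracket f g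

/-- The Hamiltonian vector field `X_h = π^♯(dh)`, i.e. `X_h f = {f, h}`. -/
def hamiltonianVectorField (h : C^∞⟮I, M; ℝ⟯) (x : M) : TangentSpace I x :=
  π.sharp x (differential I h x)

/-- `x` and `y` lie in the same symplectic leaf: they are joined by a finite chain of integral
curves of Hamiltonian vector fields. -/
def SameLeaf : M → M → Prop :=
  Relation.EqvGen fun x y => ∃ (h : C^∞⟮I, M; ℝ⟯) (γ : ℝ → M),
    IsMIntegralCurveOn γ (π.hamiltonianVectorField h) (Set.Icc 0 1) ∧ γ 0 = x ∧ γ 1 = y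

/-- The symplectic leaf through `x`. -/
def leaf (x : M) : Set M := {y | π.SameLeaf x y}

/-- The tangent space at `x` of the symplectic leaf through `x`: the image of `π^♯`, i.e. the values
at `x` of the Hamiltonian vector fields. -/
def leafTangent (x : M) : Submodule ℝ (TangentSpace I x) := LinearMap.range (π.sharp x)

/-- The symplectic form `ω = π⁻¹` of the leaf through `x`, at the point `x`:
`ω (π^♯ α, π^♯ β) = π(α, β)`; see `leafForm_sharp`. -/
def leafForm (x : M) (v w : π.leafTangent x) : ℝ :=
  (Classical.choose (LinearMap.mem_range.1 v.2)) (w : TangentSpace I x)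

theorem leafForm_sharp (x : M) (α β : Cotangent I x) :
    π.leafForm x ⟨π.sharp x α, LinearMap.mem_range_self _ α⟩
      ⟨π.sharp x β, LinearMap.mem_range_self _ β⟩ = α (π.sharp x β) := by
  have h := Classical.choose_spec
    (LinearMap.mem_range.1 (LinearMap.mem_range_self (π.sharp x) α))
  unfold leafForm
  rw [π.skew, π.skew x α β]
  exact congrArg (fun v => -β v) h

/-- `L` is a symplectic submanifold of the leaf through `x`: it is an embedded submanifold that is
contained in and tangent to that leaf, and the symplectic form of the leaf is
non-degenerate on each tangent space of `L`. -/
structure IsSymplecticSubmanifoldOfLeaf (x : M) (L : Set M) : Prop where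
  submanifold : ∃ q, IsEmbeddedSubmanifold I q L
  subset_leaf : L ⊆ π.leaf x
  tangent : ∀ y ∈ L, tangentSubspace I L y ≤ π.leafTangent y
  nondegenerate : ∀ y ∈ L, ∀ v : π.leafTangent y, (v : TangentSpace I y) ∈ tangentSubspace I L y →
    (∀ w : π.leafTangent y, (w : TangentSpace I y) ∈ tangentSubspace I L y →
      π.leafForm y v w = 0) → v = 0

/-- `S` is a Poisson–Dirac submanifold: an embedded submanifold with
`T_x S ∩ π^♯ ((T_x S)°) = 0` for all `x ∈ S` whose induced bivector `π_S` is smooth. Here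
`π_S(ξ, η) = π(α, β)` for covectors `α`, `β` on `M` extending the covectors `ξ`, `η` on `S` with
`π^♯ α, π^♯ β ∈ T_x S`; such extensions exist, and `π_S` is well defined, by the first condition. -/
structure IsPoissonDirac (S : Set M) : Prop where
  submanifold : ∃ q, IsEmbeddedSubmanifold I q S
  transverse : ∀ x ∈ S, ∀ α : Cotangent I x, (∀ v ∈ tangentSubspace I S x, α v = 0) →
    π.sharp x α ∈ tangentSubspace I S x → π.sharp x α = 0
  smooth_induced : ∀ f g : C^∞⟮I, M; ℝ⟯, ∃ h : M → ℝ, ContMDiffOn I 𝓘(ℝ, ℝ) ∞ h S ∧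
    ∀ x ∈ S, ∀ α β : Cotangent I x,
      (∀ v ∈ tangentSubspace I S x, α v = differential I f x v) →
      (∀ v ∈ tangentSubspace I S x, β v = differential I g x v) →
      π.sharp x α ∈ tangentSubspace I S x → π.sharp x β ∈ tangentSubspace I S x →
      h x = α (π.sharp x β)

end PoissonStructure

/-- `[X, Y] = 0` for vector fields on `M`: `X (Y f) = Y (X f)` for all smooth functions `f`. -/
def LieCommute (X Y : ∀ x : M, TangentSpace I x) : Prop :=
  ∀ (f : C^∞⟮I, M; ℝ⟯) (x : M),
    differential I (fun y => differential I f y (Y y)) x (X x) =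
      differential I (fun y => differential I f y (X y)) x (Y x)

/-- A vector field is complete: through every point there is an integral curve defined on all
of `ℝ`. -/
def IsComplete (X : ∀ x : M, TangentSpace I x) : Prop :=
  ∀ x, ∃ γ : ℝ → M, γ 0 = x ∧ IsMIntegralCurve γ X

/-- A complete weakly Hamiltonian action of the abelian Lie algebra `𝔤` on `(M, π)`, with its
linear lift `ρ : 𝔤 → C^∞(M)`, `u ↦ H_u`. An abelian Lie algebra is a vector space with zero bracket,
so that `u ↦ X_u = X_{H_u}` is a Lie algebra action if and only if the `X_u` commute. -/
structure WeaklyHamiltonianAction (π : PoissonStructure I M)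
    (𝔤 : Type*) [NormedAddCommGroup 𝔤] [NormedSpace ℝ 𝔤] where
  ρ : 𝔤 →ₗ[ℝ] C^∞⟮I, M; ℝ⟯
  commute : ∀ u v : 𝔤,
    LieCommute (π.hamiltonianVectorField (ρ u)) (π.hamiltonianVectorField (ρ v))
  complete : ∀ u : 𝔤, IsComplete (π.hamiltonianVectorField (ρ u))

section Action

variable {π : PoissonStructure I M} {𝔤 : Type*} [NormedAddCommGroup 𝔤] [NormedSpace ℝ 𝔤]

namespace WeaklyHamiltonianAction

/-- The fundamental vector field `X_u` of `u ∈ 𝔤`. -/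
def fundamental (A : WeaklyHamiltonianAction π 𝔤) (u : 𝔤) (x : M) : TangentSpace I x :=
  π.hamiltonianVectorField (A.ρ u) x

/-- The cocycle `c(u, v) = {H_u, H_v} - H_{[u, v]}`, where `[u, v] = 0`. -/
def cocycle (A : WeaklyHamiltonianAction π 𝔤) (u v : 𝔤) : C^∞⟮I, M; ℝ⟯ :=
  π.bracket (A.ρ u) (A.ρ v)

/-- For all `x`, the form `c(x)` on `𝔤` restricts to a symplectic form on `F_x`. -/
def IsSymplecticOn (A : WeaklyHamiltonianAction π 𝔤) (F : M → Submodule ℝ 𝔤) : Prop :=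
  ∀ x, ∀ u ∈ F x, (∀ v ∈ F x, A.cocycle u v x = 0) → u = 0

/-- `N = {x | H_u(x) = 0 for all u ∈ F_x}`. -/
def zeroLocus (A : WeaklyHamiltonianAction π 𝔤) (F : M → Submodule ℝ 𝔤) : Set M :=
  {x | ∀ u ∈ F x, A.ρ u x = 0}

end WeaklyHamiltonianAction

/-- `F` is a smooth vector sub-bundle of rank `l` of the trivial bundle `𝔤 × M` over the leaf
space: it has local smooth frames, and its fibres at points of the same symplectic leaf are equal. -/
structure IsSubbundleOverLeafSpace (π : PoissonStructure I M) (l : ℕ)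
    (F : M → Submodule ℝ 𝔤) : Prop where
  exists_frame : ∀ x, ∃ (U : Set M) (s : Fin l → M → 𝔤), IsOpen U ∧ x ∈ U ∧
    (∀ i, ContMDiffOn I 𝓘(ℝ, 𝔤) ∞ (s i) U) ∧
    ∀ y ∈ U, LinearIndependent ℝ (fun i => s i y) ∧
      Submodule.span ℝ (Set.range fun i => s i y) = F y
  eq_of_sameLeaf : ∀ x y, π.SameLeaf x y → F x = F y

/-- A framing of `F` over the leaf space: a smooth global trivialization, given by linear
isomorphisms `b_x : F_x ≃ ℝ^l`, which is constant over the symplectic leaves. -/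
structure FramingOverLeafSpace (π : PoissonStructure I M) (l : ℕ)
    (F : M → Submodule ℝ 𝔤) where
  iso : ∀ x, F x ≃ₗ[ℝ] EuclideanSpace ℝ (Fin l)
  smooth : ∀ w : EuclideanSpace ℝ (Fin l),
    ContMDiff I 𝓘(ℝ, 𝔤) ∞ (fun x => ((iso x).symm w : 𝔤))
  eq_of_sameLeaf : ∀ x y, π.SameLeaf x y → ∀ w : EuclideanSpace ℝ (Fin l),
    ((iso x).symm w : 𝔤) = ((iso y).symm w : 𝔤)

/-- The restriction `F|_N`, as a subset of `𝔤 × M`. -/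
def restrictedBundle (F : M → Submodule ℝ 𝔤) (N : Set M) : Set (𝔤 × M) :=
  {p | p.2 ∈ N ∧ p.1 ∈ F p.2}

end Action

end Poisson

end PoissonSplitting

end

/-!
Write `c` for the cocycle and `φ_v` for the time-one flow of `X_v`. By the Jacobi identity and the
commutation of the `X_u`, the functions `c(u, v)` are Casimirs, hence constant on the leaves, and so
`H_u (φ_v y) = H_u y + c(u, v)(y)` (`rho_act`). As `c(y)` is non-degenerate on `F_y`, there is
a unique `v(y) ∈ F_y` with `H_u (φ_{v(y)} y) = 0` for all `u ∈ F_y` (`splittingVector`), and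
`Φ y = (v(y), φ_{v(y)} y)`. Since the flows commute, `v(φ_w y) = v(y) - w` for `w ∈ F_y`
(`splittingVector_act`), so that `(w, x) ↦ φ_{-w} x` inverts `Φ`. Smoothness of `v` is Cramer's rule
in a local frame. Smoothness of `(v, y) ↦ φ_v y` is smooth dependence of solutions on parameters,
which is proved here by the inverse function theorem in a space of continuous curves and is
propagated along compact orbit segments (`contMDiff_act`); that the flows of the commuting fields
combine to an action of the vector group `𝔤` is `act_add`.

All submanifolds that occur are the fixed point sets of smooth retractions: of
`y ↦ φ_{v(y) - σ(y)} y` for the level set `{v = σ}` of a section `σ` of `F` that is constant on the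
leaves, and of `y ↦ φ_{-P v(y)} x` for `L_x`, where `P` is a projection of `𝔤` onto `F_x`. The fixed
point set of a smooth retraction `r` is embedded, with the fixed vectors of `dr` as tangent spaces
(`isEmbeddedSubmanifold_fixed`, `mem_tangentSubspace_fixed_iff`). Along `{v = σ}` the derivative is
`dr(ξ) = ξ + X_{d(v - σ)(ξ)}`, and differentiating the defining equation of `v` along the leaf
(`differential_rho_sharp`) shows that a covector `α` with `π^♯ α` tangent to `{v = σ}` kills the
`X_w` with `w ∈ F_x`. Hence `α ∘ dr = α` (`covector_levelRetraction`). Both Poisson–Dirac conditions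
follow: such an `α` vanishes if it vanishes on the level set, and the bivector induced on the level
set is `π(d(f ∘ r), d(g ∘ r))`. The case `σ = 0` is `N`, and a constant vector `u` in a framing gives
the section `σ(y) = b_y⁻¹ u`. The tangent spaces of `L_x` are spanned by the `X_w` with `w ∈ F`, on
which `dv (X_w) = -w` and the leaf form is `c`; this makes `v` a symplectomorphism from `L_x` to
`F_x`.
-/

namespace PoissonSplitting

-- Blocks of lemmas share their `variable` declarations.
set_option linter.unusedSectionVars false

/-! ### Composition operators on spaces of continuous maps -/

section Nemytskii

variable {K : Type*} [TopologicalSpace K] [CompactSpace K]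

/-- Pointwise application of a continuous family of operators to a continuous family of vectors,
as a continuous bilinear map. -/
noncomputable def pointwiseApply (K : Type*) [TopologicalSpace K] [CompactSpace K]
    (E F : Type*) [NormedAddCommGroup E] [NormedSpace ℝ E] [NormedAddCommGroup F]
    [NormedSpace ℝ F] : C(K, E →L[ℝ] F) →L[ℝ] C(K, E) →L[ℝ] C(K, F) :=
  LinearMap.mkContinuous₂
    (LinearMap.mk₂ ℝ (fun (A : C(K, E →L[ℝ] F)) (h : C(K, E)) =>
      (⟨fun t => A t (h t), by fun_prop⟩ : C(K, F)))
      (fun _ _ _ => by ext; simp) (fun _ _ _ => by ext; simp)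
      (fun _ _ _ => by ext; simp) (fun _ _ _ => by ext; simp)) 1
    (fun A h => by
      refine (ContinuousMap.norm_le _ (by positivity)).2 fun t => ?_
      rw [one_mul]
      exact ((A t).le_opNorm (h t)).trans
        (mul_le_mul (A.norm_coe_le_norm t) (h.norm_coe_le_norm t) (norm_nonneg _) (norm_nonneg A)))

variable {E : Type*} [NormedAddCommGroup E] [NormedSpace ℝ E]

/-- Composition with a `C^1` map is differentiable on continuous maps, with pointwise derivative. -/
theorem hasFDerivAt_continuousMap_comp {F : Type*} [NormedAddCommGroup F] [NormedSpace ℝ F]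
    (f : C(E, F)) (f' : C(E, E →L[ℝ] F)) (hf : ∀ x, HasFDerivAt f (f' x) x) (γ : C(K, E)) :
    HasFDerivAt (fun η : C(K, E) => f.comp η) (pointwiseApply K E F (f'.comp γ)) γ := by
  rw [hasFDerivAt_iff_isLittleO_nhds_zero, Asymptotics.isLittleO_iff]
  intro ε hε
  have hcont : Continuous (fun η : C(K, E) => f'.comp η) := f'.continuous_postcomp
  obtain ⟨δ, hδ, hball⟩ := Metric.mem_nhds_iff.1
    (hcont.continuousAt.preimage_mem_nhds (Metric.ball_mem_nhds (f'.comp γ) hε))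
  filter_upwards [Metric.ball_mem_nhds (0 : C(K, E)) hδ] with h hh
  refine (ContinuousMap.norm_le _ (by positivity)).2 fun t => ?_
  -- the mean value inequality along the segment from `γ t` to `γ t + h t`
  have hseg : ∀ z ∈ segment ℝ (γ t) (γ t + h t), ‖f' z - f' (γ t)‖ ≤ ε := by
    intro z hz
    rw [segment_eq_image'] at hz
    obtain ⟨θ, hθ, rfl⟩ := hz
    have h1 : dist (γ + θ • h) γ < δ := by
      rw [dist_eq_norm, add_sub_cancel_left, norm_smul, Real.norm_of_nonneg hθ.1]
      exact (mul_le_of_le_one_left (norm_nonneg _) hθ.2).trans_lt (by simpa using hh)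
    have h2 := (ContinuousMap.dist_apply_le_dist t).trans (hball h1).le
    simpa [dist_eq_norm] using h2
  have := (convex_segment (γ t) (γ t + h t)).norm_image_sub_le_of_norm_hasFDerivWithin_le'
    (fun z _ => (hf z).hasFDerivWithinAt) hseg (left_mem_segment _ _ _) (right_mem_segment _ _ _)
  simp only [add_sub_cancel_left] at this
  exact this.trans (mul_le_mul_of_nonneg_left (h.norm_coe_le_norm t) hε.le)

universe u

theorem contDiff_continuousMap_comp_nat {K : Type*} [TopologicalSpace K] [CompactSpace K]
    {E : Type u} [NormedAddCommGroup E] [NormedSpace ℝ E] (n : ℕ) :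
    ∀ {F : Type u} [NormedAddCommGroup F] [NormedSpace ℝ F] (f : C(E, F)), ContDiff ℝ n f →
      ContDiff ℝ n (fun η : C(K, E) => f.comp η) := by
  induction n with
  | zero =>
    intro F _ _ f _
    exact contDiff_zero.2 f.continuous_postcomp
  | succ n ih =>
    intro F _ _ f hf
    obtain ⟨f', hf'n, hf'⟩ := contDiff_succ_iff_hasFDerivAt.1 hf
    refine contDiff_succ_iff_hasFDerivAt.2
      ⟨fun γ => pointwiseApply K E F ((⟨f', hf'n.continuous⟩ : C(E, E →L[ℝ] F)).comp γ), ?_,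
        hasFDerivAt_continuousMap_comp f _ hf'⟩
    exact (pointwiseApply K E F).contDiff.comp (ih ⟨f', hf'n.continuous⟩ hf'n)

/-- Composition with a smooth map is a smooth operator between spaces of continuous maps on a
compact space. -/
theorem contDiff_continuousMap_comp {K : Type*} [TopologicalSpace K] [CompactSpace K]
    {E F : Type u} [NormedAddCommGroup E] [NormedSpace ℝ E] [NormedAddCommGroup F]
    [NormedSpace ℝ F] (f : C(E, F)) (hf : ContDiff ℝ ∞ f) :
    ContDiff ℝ ∞ (fun η : C(K, E) => f.comp η) :=
  contDiff_infty.2 fun n => contDiff_continuousMap_comp_nat n f (contDiff_infty.1 hf n)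

end Nemytskii

/-! ### Smooth dependence of local flows on parameters -/

section LocalFlow

variable {E : Type*} [NormedAddCommGroup E] [NormedSpace ℝ E]

/-- The time interval on which local flows are constructed; it contains `[0, 1]` in its interior. -/
abbrev TimeInterval : Type := Set.Icc (-2 : ℝ) 2

/-- The primitive vanishing at `0`, as a bounded operator on continuous functions on
`[-2, 2]`. -/
noncomputable def primitive (E : Type*) [NormedAddCommGroup E] [NormedSpace ℝ E] :
    C(TimeInterval, E) →L[ℝ] C(TimeInterval, E) :=
  LinearMap.mkContinuous
    { toFun := fun η => ⟨fun t => ∫ s in (0 : ℝ)..t, Set.IccExtend (by norm_num) η s, by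
        have : Continuous fun t : ℝ =>
            ∫ s in (0 : ℝ)..t, Set.IccExtend (show (-2 : ℝ) ≤ 2 by norm_num) η s :=
          intervalIntegral.continuous_primitive
            (fun a b => (η.continuous.Icc_extend').intervalIntegrable a b) 0
        exact this.comp continuous_subtype_val⟩
      map_add' := fun η θ => by
        ext t
        exact intervalIntegral.integral_add (η.continuous.Icc_extend'.intervalIntegrable _ _)
          (θ.continuous.Icc_extend'.intervalIntegrable _ _)
      map_smul' := fun c η => by
        ext t
        exact intervalIntegral.integral_smul c _ } 2
    (fun η => by
      refine (ContinuousMap.norm_le _ (by positivity)).2 fun t => ?_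
      have h := intervalIntegral.norm_integral_le_of_norm_le_const
        (f := Set.IccExtend (show (-2 : ℝ) ≤ 2 by norm_num) η) (a := 0) (b := (t : ℝ)) (C := ‖η‖)
        (fun s _ => η.norm_coe_le_norm _)
      refine h.trans ?_
      rw [mul_comm, sub_zero]
      exact mul_le_mul_of_nonneg_right (abs_le.2 t.2) (norm_nonneg _))

universe u

/-- A smooth family `V v` of vector fields with `V 0 = 0` has, near `v = 0` and any given point
`x₀`, a flow defined for `|t| < 2` whose time-one map depends smoothly on the initial value and on
the parameter. The integral equation is solved by the inverse function theorem in the space of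
continuous curves. -/
theorem exists_local_flow {G E : Type u} [NormedAddCommGroup G] [NormedSpace ℝ G]
    [CompleteSpace G] [NormedAddCommGroup E] [NormedSpace ℝ E] [CompleteSpace E]
    (V : G × E → E) (hV : ContDiff ℝ ∞ V) (hV0 : ∀ x, V (0, x) = 0) (x₀ : E)
    {W : Set E} (hW : W ∈ 𝓝 x₀) :
    ∃ θ : G × E → ℝ → E, ContDiffAt ℝ ∞ (fun p => θ p 1) (0, x₀) ∧
      ∀ᶠ p in 𝓝 ((0 : G), x₀), θ p 0 = p.2 ∧ ∀ t ∈ Set.Ioo (-2 : ℝ) 2,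
        θ p t ∈ W ∧ HasDerivAt (θ p) (V (p.1, θ p t)) t := by
  let Vc : C(G × E, E) := ⟨V, hV.continuous⟩
  -- the pairing of a parameter and a curve
  let pair : G × C(TimeInterval, E) →L[ℝ] C(TimeInterval, G × E) :=
    LinearMap.mkContinuous
      { toFun := fun q => (ContinuousMap.const _ q.1).prodMk q.2
        map_add' := fun _ _ => rfl
        map_smul' := fun _ _ => rfl } 1
      (fun q => by
        refine (ContinuousMap.norm_le _ (by positivity)).2 fun t => ?_
        rw [one_mul]
        exact max_le_max le_rfl (q.2.norm_coe_le_norm t))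
  let N : G × C(TimeInterval, E) → C(TimeInterval, E) := fun q => primitive E (Vc.comp (pair q))
  have hN : ContDiff ℝ ∞ N :=
    (primitive E).contDiff.comp ((contDiff_continuousMap_comp Vc hV).comp pair.contDiff)
  have hN0 : ∀ γ, N (0, γ) = 0 := by
    intro γ
    have : Vc.comp (pair (0, γ)) = 0 := by
      ext t
      exact hV0 (γ t)
    change primitive E (Vc.comp (pair (0, γ))) = 0
    rw [this, map_zero]
  let c₀ : C(TimeInterval, E) := ContinuousMap.const _ x₀
  let D : G × C(TimeInterval, E) →L[ℝ] C(TimeInterval, E) := fderiv ℝ N (0, c₀)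
  have hD : HasFDerivAt N D (0, c₀) :=
    (hN.differentiable (by simp)).differentiableAt.hasFDerivAt
  have hD2 : ∀ h, D (0, h) = 0 := by
    intro h
    have h1 : HasFDerivAt (fun γ : C(TimeInterval, E) => N (0, γ))
        (D.comp (ContinuousLinearMap.inr ℝ G C(TimeInterval, E))) c₀ :=
      HasFDerivAt.comp c₀ (f := fun γ : C(TimeInterval, E) => ((0 : G), γ)) hD
          (hasFDerivAt_prodMk_right (0 : G) c₀)
    have h2 : HasFDerivAt (fun γ : C(TimeInterval, E) => N (0, γ))
        (0 : C(TimeInterval, E) →L[ℝ] C(TimeInterval, E)) c₀ := by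
      simp only [hN0]
      exact hasFDerivAt_const _ _
    simpa using congrArg (fun A => A h) (h1.unique h2)
  -- `T` has invertible derivative at `(0, c₀)`, as `N (0, ·) = 0`; solutions of the integral
  -- equation are the curves `γ` with `T (v, γ)` a constant curve
  let T : G × C(TimeInterval, E) → G × C(TimeInterval, E) := fun q => (q.1, q.2 - N q)
  have hT : ContDiff ℝ ∞ T := contDiff_fst.prodMk (contDiff_snd.sub hN)
  let T' : (G × C(TimeInterval, E)) ≃L[ℝ] (G × C(TimeInterval, E)) :=
    ContinuousLinearEquiv.equivOfInverse
      ((ContinuousLinearMap.fst ℝ G C(TimeInterval, E)).prod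
        (ContinuousLinearMap.snd ℝ G C(TimeInterval, E) - D))
      ((ContinuousLinearMap.fst ℝ G C(TimeInterval, E)).prod
        (ContinuousLinearMap.snd ℝ G C(TimeInterval, E) + D))
      (fun q : G × C(TimeInterval, E) => by
        have : D (q.1, q.2 - D q) = D q := by
          have e : (q.1, q.2 - D q) = q - (0, D q) := by ext <;> simp
          rw [e, map_sub, hD2, sub_zero]
        ext1 <;> simp [this])
      (fun q : G × C(TimeInterval, E) => by
        have : D (q.1, q.2 + D q) = D q := by
          have e : (q.1, q.2 + D q) = q + (0, D q) := by ext <;> simp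
          rw [e, map_add, hD2, add_zero]
        ext1 <;> simp [this])
  have hT' : HasFDerivAt T (T' : (G × C(TimeInterval, E)) →L[ℝ] (G × C(TimeInterval, E)))
      (0, c₀) := hasFDerivAt_fst.prodMk (hasFDerivAt_snd.sub hD)
  have hTc : T (0, c₀) = (0, c₀) := by simp [T, hN0]
  let Φ := hT.contDiffAt.toOpenPartialHomeomorph T hT' (by simp)
  have hmem : (0, c₀) ∈ Φ.source :=
    ContDiffAt.mem_toOpenPartialHomeomorph_source hT.contDiffAt hT' (by simp)
  have hΦT : ∀ q, Φ q = T q := fun q => rfl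
  have htgt : (0, c₀) ∈ Φ.target := by
    have := Φ.map_source hmem
    rwa [hΦT, hTc] at this
  have hsymm0 : Φ.symm (0, c₀) = (0, c₀) := by
    have := Φ.left_inv hmem
    rwa [hΦT, hTc] at this
  have hsmooth : ContDiffAt ℝ ∞ Φ.symm (0, c₀) := by
    have := hT.contDiffAt.to_localInverse hT' (by simp)
    rw [hTc] at this
    exact this
  let emb : G × E →L[ℝ] G × C(TimeInterval, E) :=
    (ContinuousLinearMap.fst ℝ G E).prod
      ((ContinuousLinearMap.const ℝ TimeInterval).comp (ContinuousLinearMap.snd ℝ G E))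
  have hemb0 : emb (0, x₀) = (0, c₀) := rfl
  let S : G × E → C(TimeInterval, E) := fun p => (Φ.symm (emb p)).2
  have hS : ContDiffAt ℝ ∞ S (0, x₀) := by
    have h1 : ContDiffAt ℝ ∞ (fun p => Φ.symm (emb p)) (0, x₀) :=
      ContDiffAt.comp _ (by rw [hemb0]; exact hsmooth) emb.contDiff.contDiffAt
    exact h1.snd
  have hSc : S (0, x₀) = c₀ := by simp [S, hemb0, hsymm0]
  -- `S p` solves the integral equation
  have hSeq : ∀ᶠ p in 𝓝 ((0 : G), x₀),
      S p = ContinuousMap.const _ p.2 + primitive E (Vc.comp (pair (p.1, S p))) := by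
    have h1 : ∀ᶠ p in 𝓝 ((0 : G), x₀), emb p ∈ Φ.target :=
      emb.continuous.continuousAt.eventually_mem (by
        rw [hemb0]; exact Φ.open_target.mem_nhds htgt)
    filter_upwards [h1] with p hp
    have h2 := Φ.right_inv hp
    rw [hΦT] at h2
    have h3 : (Φ.symm (emb p)).1 = p.1 := congrArg Prod.fst h2
    have h4 : S p - N (Φ.symm (emb p)) = ContinuousMap.const _ p.2 := congrArg Prod.snd h2
    have h5 : Φ.symm (emb p) = (p.1, S p) := Prod.ext h3 rfl
    rw [h5] at h4
    exact sub_eq_iff_eq_add.1 h4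
  have hSW : ∀ᶠ p in 𝓝 ((0 : G), x₀), ∀ t, S p t ∈ W := by
    obtain ⟨ε, hε, hεW⟩ := Metric.mem_nhds_iff.1 hW
    have h1 : ∀ᶠ p in 𝓝 ((0 : G), x₀), S p ∈ Metric.ball c₀ ε :=
      hS.continuousAt.eventually_mem (by rw [hSc]; exact Metric.ball_mem_nhds _ hε)
    filter_upwards [h1] with p hp t
    exact hεW ((ContinuousMap.dist_apply_le_dist (f := S p) (g := c₀) t).trans_lt hp)
  have h22 : (-2 : ℝ) ≤ 2 := by norm_num
  refine ⟨fun p t => Set.IccExtend h22 (S p) t, ?_, ?_⟩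
  · let e : C(TimeInterval, E) →L[ℝ] E :=
      ContinuousMap.evalCLM ℝ (⟨1, by norm_num, by norm_num⟩ : TimeInterval)
    have h2 : ContDiffAt ℝ ∞ (fun p => e (S p)) (0, x₀) := e.contDiff.contDiffAt.comp _ hS
    refine h2.congr_of_eventuallyEq (Filter.Eventually.of_forall fun p => ?_)
    exact Set.IccExtend_of_mem h22 (S p) (by norm_num)
  · filter_upwards [hSeq, hSW] with p hp hpW
    have key : ∀ t (ht : t ∈ Set.Icc (-2 : ℝ) 2), Set.IccExtend h22 (S p) t =
        p.2 + ∫ s in (0 : ℝ)..t, V (p.1, Set.IccExtend h22 (S p) s) := by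
      intro t ht
      rw [Set.IccExtend_of_mem h22 (S p) ht]
      exact congrArg (fun γ : C(TimeInterval, E) => γ ⟨t, ht⟩) hp
    refine ⟨by rw [key 0 (by norm_num)]; simp, fun t ht => ⟨hpW _, ?_⟩⟩
    have hc : Continuous fun s => V (p.1, Set.IccExtend h22 (S p) s) :=
      hV.continuous.comp (continuous_const.prodMk (S p).continuous.Icc_extend')
    have h1 := (hc.integral_hasStrictDerivAt 0 t).hasDerivAt.const_add p.2
    refine h1.congr_of_eventuallyEq ?_
    filter_upwards [Icc_mem_nhds ht.1 ht.2] with s hs using key s hs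

end LocalFlow

/-! ### Smooth functions, covectors and Hamiltonian vector fields -/

section Basic

variable {E : Type*} [NormedAddCommGroup E] [NormedSpace ℝ E]
  {M : Type*} [TopologicalSpace M] [ChartedSpace E M]

theorem differential_congr {f g : M → ℝ} {x : M} (h : f =ᶠ[𝓝 x] g) :
    differential 𝓘(ℝ, E) f x = differential 𝓘(ℝ, E) g x :=
  h.mfderiv_eq

variable [IsManifold 𝓘(ℝ, E) ∞ M]

theorem contMDiffOn_extChartAt_comp (x : M) (L : E →L[ℝ] ℝ) :
    ContMDiffOn 𝓘(ℝ, E) 𝓘(ℝ, ℝ) ∞ (fun y => L (extChartAt 𝓘(ℝ, E) x y)) (chartAt E x).source :=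
  L.contMDiff.comp_contMDiffOn contMDiffOn_extChartAt

/-- A smooth function on a chart domain extends from a neighbourhood of the centre to a globally
defined smooth function. -/
theorem exists_contMDiffMap_eventuallyEq [FiniteDimensional ℝ E] [T2Space M] (x : M) {g : M → ℝ}
    (hg : ContMDiffOn 𝓘(ℝ, E) 𝓘(ℝ, ℝ) ∞ g (chartAt E x).source) :
    ∃ f : C^∞⟮𝓘(ℝ, E), M; ℝ⟯, ⇑f =ᶠ[𝓝 x] g := by
  obtain ⟨χ⟩ : Nonempty (SmoothBumpFunction 𝓘(ℝ, E) x) := inferInstance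
  refine ⟨⟨fun y => χ y • g y, χ.contMDiff_smul hg⟩, ?_⟩
  filter_upwards [χ.eventuallyEq_one] with y hy
  change χ y • g y = g y
  rw [hy]
  simp

/-- Every covector is the differential of a globally defined smooth function. -/
theorem exists_differential_eq [FiniteDimensional ℝ E] [T2Space M] (x : M)
    (α : Cotangent 𝓘(ℝ, E) x) :
    ∃ f : C^∞⟮𝓘(ℝ, E), M; ℝ⟯, differential 𝓘(ℝ, E) f x = α := by
  let L : E →L[ℝ] ℝ := α
  obtain ⟨f, hf⟩ := exists_contMDiffMap_eventuallyEq x (contMDiffOn_extChartAt_comp x L)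
  refine ⟨f, ?_⟩
  rw [differential_congr hf]
  have h1 : HasMFDerivAt 𝓘(ℝ, E) 𝓘(ℝ, E) (extChartAt 𝓘(ℝ, E) x) x
      (mfderiv 𝓘(ℝ, E) 𝓘(ℝ, E) (extChartAt 𝓘(ℝ, E) x) x) :=
    (mdifferentiableAt_extChartAt (mem_chart_source E x)).hasMFDerivAt
  rw [mfderiv_extChartAt_self] at h1
  have h2 : HasMFDerivAt 𝓘(ℝ, E) 𝓘(ℝ, ℝ) (fun y => L (extChartAt 𝓘(ℝ, E) x y)) x
      (L.comp (ContinuousLinearMap.id ℝ E)) :=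
    (L.hasMFDerivAt).comp x h1
  exact h2.mfderiv

/-- A vector field that sends smooth functions to smooth functions is a smooth section of the
tangent bundle. -/
theorem contMDiff_vectorField [FiniteDimensional ℝ E] [T2Space M]
    (X : ∀ x : M, TangentSpace 𝓘(ℝ, E) x)
    (hX : ∀ f : C^∞⟮𝓘(ℝ, E), M; ℝ⟯, ContMDiff 𝓘(ℝ, E) 𝓘(ℝ, ℝ) ∞
      fun x => differential 𝓘(ℝ, E) f x (X x)) :
    ContMDiff 𝓘(ℝ, E) 𝓘(ℝ, E).tangent ∞
      (fun x => (⟨x, X x⟩ : TangentBundle 𝓘(ℝ, E) M)) := by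
  intro x₀
  rw [Bundle.contMDiffAt_section]
  let b := Module.finBasis ℝ E
  let e := b.equivFunL
  have key : ContMDiffAt 𝓘(ℝ, E) 𝓘(ℝ, Fin (Module.finrank ℝ E) → ℝ) ∞
      (fun x => e ((trivializationAt E (TangentSpace 𝓘(ℝ, E)) x₀ ⟨x, X x⟩).2)) x₀ := by
    rw [contMDiffAt_pi_space]
    intro i
    let L : E →L[ℝ] ℝ := (ContinuousLinearMap.proj
      (φ := fun _ : Fin (Module.finrank ℝ E) => ℝ) i).comp (e : E →L[ℝ] _)
    obtain ⟨f, hf⟩ := exists_contMDiffMap_eventuallyEq x₀ (contMDiffOn_extChartAt_comp x₀ L)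
    refine (hX f x₀).congr_of_eventuallyEq ?_
    filter_upwards [hf.eventuallyEq_nhds, (chartAt E x₀).open_source.mem_nhds
      (mem_chart_source E x₀)] with x hx hxs
    rw [differential_congr hx]
    have h1 : HasMFDerivAt 𝓘(ℝ, E) 𝓘(ℝ, E) (extChartAt 𝓘(ℝ, E) x₀) x
        (mfderiv 𝓘(ℝ, E) 𝓘(ℝ, E) (extChartAt 𝓘(ℝ, E) x₀) x) :=
      (mdifferentiableAt_extChartAt hxs).hasMFDerivAt
    rw [← TangentBundle.continuousLinearMapAt_trivializationAt hxs] at h1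
    have h2 : HasMFDerivAt 𝓘(ℝ, E) 𝓘(ℝ, ℝ) (fun y => L (extChartAt 𝓘(ℝ, E) x₀ y)) x
        (L.comp ((trivializationAt E (TangentSpace 𝓘(ℝ, E)) x₀).continuousLinearMapAt ℝ x)) :=
      (L.hasMFDerivAt).comp x h1
    have h3 := congrArg (fun A : TangentSpace 𝓘(ℝ, E) x →L[ℝ] ℝ => A (X x)) h2.mfderiv
    refine Eq.trans ?_ h3.symm
    change L _ = L _
    congr 1
    exact (Bundle.Trivialization.continuousLinearMapAt_apply_of_mem (R := ℝ)
      (trivializationAt E (TangentSpace 𝓘(ℝ, E)) x₀) hxs (X x)).symm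
  have h4 := (e.symm : (Fin (Module.finrank ℝ E) → ℝ) →L[ℝ] E).contMDiff.contMDiffAt.comp x₀ key
  refine h4.congr_of_eventuallyEq (Filter.Eventually.of_forall fun x => ?_)
  exact (e.symm_apply_apply _).symm

variable [FiniteDimensional ℝ E] [T2Space M] (π : PoissonStructure 𝓘(ℝ, E) M)

theorem contMDiff_hamiltonianVectorField (h : C^∞⟮𝓘(ℝ, E), M; ℝ⟯) :
    ContMDiff 𝓘(ℝ, E) 𝓘(ℝ, E).tangent ∞
      (fun x => (⟨x, π.hamiltonianVectorField h x⟩ : TangentBundle 𝓘(ℝ, E) M)) :=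
  contMDiff_vectorField _ fun f => π.smooth f h

/-- Tangent vectors are separated by the globally defined smooth functions. -/
theorem tangent_ext {x : M} {v w : TangentSpace 𝓘(ℝ, E) x}
    (h : ∀ f : C^∞⟮𝓘(ℝ, E), M; ℝ⟯, differential 𝓘(ℝ, E) f x v = differential 𝓘(ℝ, E) f x w) :
    v = w := by
  let b := Module.finBasis ℝ E
  refine b.ext_elem (x := v) (y := w) fun i => ?_
  let L : E →L[ℝ] ℝ := (ContinuousLinearMap.proj
    (φ := fun _ : Fin (Module.finrank ℝ E) => ℝ) i).comp (b.equivFunL : E →L[ℝ] _)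
  obtain ⟨f, hf⟩ := exists_differential_eq x (L : Cotangent 𝓘(ℝ, E) x)
  have := h f
  rw [hf] at this
  exact this

end Basic

/-! ### The flow of a complete weakly Hamiltonian action -/

/-- A smooth function on an open set extends, from a neighbourhood of a given point, to a globally
defined smooth function. -/
theorem exists_contDiff_eventuallyEq {E F : Type*} [NormedAddCommGroup E] [NormedSpace ℝ E]
    [FiniteDimensional ℝ E] [NormedAddCommGroup F] [NormedSpace ℝ F] {f : E → F} {s : Set E}
    (hs : IsOpen s) (hf : ContDiffOn ℝ ∞ f s) {x : E} (hx : x ∈ s) :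
    ∃ g : E → F, ContDiff ℝ ∞ g ∧ g =ᶠ[𝓝 x] f := by
  obtain ⟨r, hr, hrs⟩ := Metric.nhds_basis_closedBall.mem_iff.1 (hs.mem_nhds hx)
  let χ : ContDiffBump x := ⟨r / 2, r, half_pos hr, half_lt_self hr⟩
  refine ⟨fun y => χ y • f y, contDiff_iff_contDiffAt.2 fun y => ?_, ?_⟩
  · by_cases hy : y ∈ tsupport χ
    · rw [χ.tsupport_eq] at hy
      exact χ.contDiff.contDiffAt.smul (hf.contDiffAt (hs.mem_nhds (hrs hy)))
    · refine (contDiffAt_const (c := (0 : F))).congr_of_eventuallyEq ?_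
      filter_upwards [(isClosed_tsupport χ).isOpen_compl.mem_nhds hy] with z hz
      rw [image_eq_zero_of_notMem_tsupport hz, zero_smul]
  · filter_upwards [χ.eventuallyEq_one] with y hy
    rw [hy]
    simp

theorem differential_add {E : Type*} [NormedAddCommGroup E] [NormedSpace ℝ E]
    {M : Type*} [TopologicalSpace M] [ChartedSpace E M]
    (f g : C^∞⟮𝓘(ℝ, E), M; ℝ⟯) (x : M) : differential 𝓘(ℝ, E) (f + g : C^∞⟮𝓘(ℝ, E), M; ℝ⟯) x =
      differential 𝓘(ℝ, E) f x + differential 𝓘(ℝ, E) g x :=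
  (((f.contMDiff x).mdifferentiableAt (by simp)).hasMFDerivAt.add
    ((g.contMDiff x).mdifferentiableAt (by simp)).hasMFDerivAt).mfderiv

theorem differential_smul {E : Type*} [NormedAddCommGroup E] [NormedSpace ℝ E]
    {M : Type*} [TopologicalSpace M] [ChartedSpace E M]
    (c : ℝ) (f : C^∞⟮𝓘(ℝ, E), M; ℝ⟯) (x : M) :
    differential 𝓘(ℝ, E) (c • f : C^∞⟮𝓘(ℝ, E), M; ℝ⟯) x = c • differential 𝓘(ℝ, E) f x :=
  (((f.contMDiff x).mdifferentiableAt (by simp)).hasMFDerivAt.const_smul c).mfderiv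

namespace WeaklyHamiltonianAction

variable {E : Type} [NormedAddCommGroup E] [NormedSpace ℝ E]
  {M : Type*} [TopologicalSpace M] [ChartedSpace E M]
  {π : PoissonStructure 𝓘(ℝ, E) M} {𝔤 : Type*} [NormedAddCommGroup 𝔤] [NormedSpace ℝ 𝔤]
  (A : WeaklyHamiltonianAction π 𝔤)

theorem fundamental_add (u v : 𝔤) (x : M) :
    A.fundamental (u + v) x = A.fundamental u x + A.fundamental v x := by
  simp only [fundamental, PoissonStructure.hamiltonianVectorField, map_add, differential_add]

theorem fundamental_smul (c : ℝ) (u : 𝔤) (x : M) :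
    A.fundamental (c • u) x = c • A.fundamental u x := by
  simp only [fundamental, PoissonStructure.hamiltonianVectorField, map_smul, differential_smul]

/-- The fundamental vector fields at a point, as a linear map. -/
noncomputable def fundamentalₗ (x : M) : 𝔤 →ₗ[ℝ] TangentSpace 𝓘(ℝ, E) x where
  toFun u := A.fundamental u x
  map_add' u v := A.fundamental_add u v x
  map_smul' c u := A.fundamental_smul c u x

@[simp] theorem fundamentalₗ_apply (x : M) (u : 𝔤) : A.fundamentalₗ x u = A.fundamental u x := rfl

/-- The time-one map of the flow of the fundamental vector field `X_v`, applied to `y`. -/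
noncomputable def act (v : 𝔤) (y : M) : M := Classical.choose (A.complete v y) 1

variable [IsManifold 𝓘(ℝ, E) ∞ M] [FiniteDimensional ℝ E] [T2Space M]

theorem contMDiff_fundamental (v : 𝔤) : ContMDiff 𝓘(ℝ, E) 𝓘(ℝ, E).tangent ∞
    (fun x => (⟨x, A.fundamental v x⟩ : TangentBundle 𝓘(ℝ, E) M)) :=
  contMDiff_hamiltonianVectorField π (A.ρ v)

theorem integralCurve_unique {v : 𝔤} {γ γ' : ℝ → M} (hγ : IsMIntegralCurve γ (A.fundamental v))
    (hγ' : IsMIntegralCurve γ' (A.fundamental v)) (h : γ 0 = γ' 0) : γ = γ' :=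
  isMIntegralCurve_Ioo_eq_of_contMDiff_boundaryless
    ((A.contMDiff_fundamental v).of_le (by simp)) hγ hγ' h

/-- Rescaling time, the flow of `X_v` at time `t` is the time-one flow of `X_{t v}`. -/
theorem integralCurve_eq_act {v : 𝔤} {y : M} {γ : ℝ → M}
    (hγ : IsMIntegralCurve γ (A.fundamental v)) (h0 : γ 0 = y) (t : ℝ) :
    γ t = A.act (t • v) y := by
  have hspec := Classical.choose_spec (A.complete (t • v) y)
  have h1 : IsMIntegralCurve (γ ∘ (· * t)) (A.fundamental (t • v)) := by
    have : A.fundamental (t • v) = t • A.fundamental v := by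
      funext x
      exact A.fundamental_smul t v x
    rw [this]
    exact hγ.comp_mul t
  have h2 := A.integralCurve_unique h1 hspec.2 (by simp [h0, hspec.1])
  have h3 := congrFun h2 1
  rw [Function.comp_apply, one_mul] at h3
  exact h3

theorem isMIntegralCurve_act (v : 𝔤) (y : M) :
    IsMIntegralCurve (fun t : ℝ => A.act (t • v) y) (A.fundamental v) := by
  obtain ⟨γ, h0, hγ⟩ := A.complete v y
  have : (fun t : ℝ => A.act (t • v) y) = γ :=
    funext fun t => (A.integralCurve_eq_act hγ h0 t).symm
  rw [this]
  exact hγ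

@[simp] theorem act_zero (y : M) : A.act 0 y = y := by
  obtain ⟨γ, h0, hγ⟩ := A.complete (0 : 𝔤) y
  simpa [h0] using (A.integralCurve_eq_act hγ h0 0).symm

theorem act_add_smul (s t : ℝ) (v : 𝔤) (y : M) :
    A.act ((s + t) • v) y = A.act (s • v) (A.act (t • v) y) := by
  have h1 := (A.isMIntegralCurve_act v y).comp_add t
  exact A.integralCurve_eq_act h1 (by simp) s

theorem act_neg_act (v : 𝔤) (y : M) : A.act (-v) (A.act v y) = y := by
  have := A.act_add_smul (-1) 1 v y
  simpa using this.symm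

theorem act_act_neg (v : 𝔤) (y : M) : A.act v (A.act (-v) y) = y := by
  have := A.act_neg_act (-v) y
  simpa using this

/-- The local time-one map agrees with `act`: an integral curve defined only on `(-2, 2)`
suffices. -/
theorem act_eq_of_isMIntegralCurveOn {v : 𝔤} {y : M} {γ : ℝ → M}
    (hγ : IsMIntegralCurveOn γ (A.fundamental v) (Set.Ioo (-2) 2)) (h0 : γ 0 = y) :
    A.act v y = γ 1 := by
  have h := isMIntegralCurveOn_Ioo_eqOn_of_contMDiff_boundaryless (t₀ := 0) (by norm_num)
    ((A.contMDiff_fundamental v).of_le (by simp)) hγ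
    ((A.isMIntegralCurve_act v y).isMIntegralCurveOn _) (by simp [h0])
  have := h (show (1 : ℝ) ∈ Set.Ioo (-2 : ℝ) 2 by norm_num)
  simpa using this.symm

/-- The fundamental vector field of `v` in the chart at `x₀`. -/
noncomputable def chartField (x₀ : M) (v : 𝔤) (z : E) : E :=
  mfderiv 𝓘(ℝ, E) 𝓘(ℝ, E) (extChartAt 𝓘(ℝ, E) x₀) ((extChartAt 𝓘(ℝ, E) x₀).symm z)
    (A.fundamental v ((extChartAt 𝓘(ℝ, E) x₀).symm z))

theorem contDiffOn_chartField (x₀ : M) (v : 𝔤) :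
    ContDiffOn ℝ ∞ (A.chartField x₀ v) (extChartAt 𝓘(ℝ, E) x₀).target := by
  rw [← contMDiffOn_iff_contDiffOn]
  have h1 : ContMDiffOn 𝓘(ℝ, E) 𝓘(ℝ, E) ∞
      (fun x => (trivializationAt E (TangentSpace 𝓘(ℝ, E)) x₀ ⟨x, A.fundamental v x⟩).2)
      (chartAt E x₀).source :=
    ((trivializationAt E (TangentSpace 𝓘(ℝ, E)) x₀).contMDiffOn_section_iff
      (chartAt E x₀).open_source subset_rfl).1 (A.contMDiff_fundamental v).contMDiffOn
  have h2 : ContMDiffOn 𝓘(ℝ, E) 𝓘(ℝ, E) ∞ (extChartAt 𝓘(ℝ, E) x₀).symm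
      (extChartAt 𝓘(ℝ, E) x₀).target := contMDiffOn_extChartAt_symm x₀
  have h3 : ∀ z ∈ (extChartAt 𝓘(ℝ, E) x₀).target,
      (extChartAt 𝓘(ℝ, E) x₀).symm z ∈ (chartAt E x₀).source := fun z hz => by
    have := (extChartAt 𝓘(ℝ, E) x₀).map_target hz
    rwa [extChartAt_source] at this
  refine (h1.comp h2 h3).congr fun z hz => ?_
  simp only [chartField]
  rw [← TangentBundle.continuousLinearMapAt_trivializationAt (h3 z hz)]
  exact Bundle.Trivialization.continuousLinearMapAt_apply_of_mem (R := ℝ)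
    (trivializationAt E (TangentSpace 𝓘(ℝ, E)) x₀) (h3 z hz) _

theorem chartField_sum {k : ℕ} (x₀ : M) (e : Fin k → 𝔤) (a : Fin k → ℝ) (z : E) :
    A.chartField x₀ (∑ i, a i • e i) z = ∑ i, a i • A.chartField x₀ (e i) z := by
  have : A.fundamental (∑ i, a i • e i) ((extChartAt 𝓘(ℝ, E) x₀).symm z) =
      ∑ i, a i • A.fundamental (e i) ((extChartAt 𝓘(ℝ, E) x₀).symm z) := by
    simp only [← fundamentalₗ_apply, map_sum, map_smul]
  simp only [chartField, this, map_sum, map_smul]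
  rfl

theorem isMIntegralCurveOn_of_chart {x₀ : M} {v : 𝔤} {θ : ℝ → E} {s : Set ℝ}
    (hs : ∀ t ∈ s, θ t ∈ (extChartAt 𝓘(ℝ, E) x₀).target)
    (hθ : ∀ t ∈ s, HasDerivAt θ (A.chartField x₀ v (θ t)) t) :
    IsMIntegralCurveOn (fun t => (extChartAt 𝓘(ℝ, E) x₀).symm (θ t)) (A.fundamental v) s := by
  intro t ht
  have h1 : HasMFDerivAt 𝓘(ℝ, ℝ) 𝓘(ℝ, E) θ t
      ((1 : ℝ →L[ℝ] ℝ).smulRight (A.chartField x₀ v (θ t))) := by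
    have := (hθ t ht).hasFDerivAt.hasMFDerivAt
    rwa [← ContinuousLinearMap.smulRight_one_eq_toSpanSingleton] at this
  have h2 := (mdifferentiableWithinAt_extChartAt_symm (I := 𝓘(ℝ, E)) (hs t ht)).hasMFDerivWithinAt
  rw [modelWithCornersSelf_coe, Set.range_id, hasMFDerivWithinAt_univ] at h2
  have h3 := (h2.comp t h1).hasMFDerivWithinAt (s := s)
  refine h3.congr_mfderiv ?_
  ext
  have h4 := mfderivWithin_extChartAt_symm_comp_mfderiv_extChartAt (I := 𝓘(ℝ, E)) (hs t ht)
  rw [modelWithCornersSelf_coe, Set.range_id] at h4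
  have h5 := congrArg (fun B => B (A.fundamental v ((extChartAt 𝓘(ℝ, E) x₀).symm (θ t)))) h4
  change mfderivWithin 𝓘(ℝ, E) 𝓘(ℝ, E) (extChartAt 𝓘(ℝ, E) x₀).symm Set.univ (θ t)
    ((1 : ℝ) • A.chartField x₀ v (θ t)) =
      (1 : ℝ) • A.fundamental v ((extChartAt 𝓘(ℝ, E) x₀).symm (θ t))
  rw [one_smul, one_smul]
  exact h5

variable [FiniteDimensional ℝ 𝔤]

/-- The time-one flow is smooth in `(v, y)` near `v = 0`. In a chart, `v ↦ X_v` is a family of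
vector fields that is linear in the coordinates of `v`, to which `exists_local_flow` applies. -/
theorem contMDiffAt_act_zero (x₀ : M) :
    ContMDiffAt (𝓘(ℝ, 𝔤).prod 𝓘(ℝ, E)) 𝓘(ℝ, E) ∞ (fun p : 𝔤 × M => A.act p.1 p.2) (0, x₀) := by
  let b := Module.finBasis ℝ 𝔤
  have hopen : IsOpen (extChartAt 𝓘(ℝ, E) x₀).target := isOpen_extChartAt_target x₀
  have hmem : extChartAt 𝓘(ℝ, E) x₀ x₀ ∈ (extChartAt 𝓘(ℝ, E) x₀).target := mem_extChartAt_target x₀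
  choose W hW hWeq using fun i =>
    exists_contDiff_eventuallyEq hopen (A.contDiffOn_chartField x₀ (b i)) hmem
  let V : (Fin (Module.finrank ℝ 𝔤) → ℝ) × E → E := fun p => ∑ i, p.1 i • W i p.2
  have hV : ContDiff ℝ ∞ V := by
    refine ContDiff.sum fun i _ => ?_
    exact ((contDiff_apply ℝ ℝ i).comp contDiff_fst).smul ((hW i).comp contDiff_snd)
  have hN : {z | z ∈ (extChartAt 𝓘(ℝ, E) x₀).target ∧ ∀ i, W i z = A.chartField x₀ (b i) z} ∈
      𝓝 (extChartAt 𝓘(ℝ, E) x₀ x₀) :=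
    Filter.Eventually.and (hopen.mem_nhds hmem) (Filter.eventually_all.2 hWeq)
  obtain ⟨θ, hθ, hθ'⟩ := exists_local_flow V hV (fun x => by simp [V]) _ hN
  let q : 𝔤 × M → (Fin (Module.finrank ℝ 𝔤) → ℝ) × E :=
    fun p => (b.equivFunL p.1, extChartAt 𝓘(ℝ, E) x₀ p.2)
  have hq : ContMDiffAt (𝓘(ℝ, 𝔤).prod 𝓘(ℝ, E))
      𝓘(ℝ, (Fin (Module.finrank ℝ 𝔤) → ℝ) × E) ∞ q (0, x₀) := by
    refine ContMDiffAt.prodMk_space ?_ ?_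
    · exact (b.equivFunL : 𝔤 →L[ℝ] (Fin (Module.finrank ℝ 𝔤) → ℝ)).contMDiff.contMDiffAt.comp _
        contMDiffAt_fst
    · exact ContMDiffAt.comp (0, x₀) (contMDiffAt_extChartAt (x := x₀)) contMDiffAt_snd
  have hq0 : q (0, x₀) = (0, extChartAt 𝓘(ℝ, E) x₀ x₀) := by simp [q]
  have hev : ∀ᶠ p in 𝓝 ((0 : 𝔤), x₀), p.2 ∈ (extChartAt 𝓘(ℝ, E) x₀).source ∧
      θ (q p) 0 = (q p).2 ∧ ∀ t ∈ Set.Ioo (-2 : ℝ) 2,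
        (θ (q p) t ∈ (extChartAt 𝓘(ℝ, E) x₀).target ∧
          ∀ i, W i (θ (q p) t) = A.chartField x₀ (b i) (θ (q p) t)) ∧
        HasDerivAt (θ (q p)) (V ((q p).1, θ (q p) t)) t := by
    refine Filter.Eventually.and ?_ ?_
    · exact continuous_snd.continuousAt.eventually_mem (extChartAt_source_mem_nhds x₀)
    · have := hq.continuousAt
      rw [ContinuousAt, hq0] at this
      exact this.eventually hθ'
  have hact : (fun p : 𝔤 × M => A.act p.1 p.2) =ᶠ[𝓝 (0, x₀)]
      fun p => (extChartAt 𝓘(ℝ, E) x₀).symm (θ (q p) 1) := by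
    filter_upwards [hev] with p hp
    refine A.act_eq_of_isMIntegralCurveOn
      (γ := fun t => (extChartAt 𝓘(ℝ, E) x₀).symm (θ (q p) t)) ?_ ?_
    · refine A.isMIntegralCurveOn_of_chart (fun t ht => (hp.2.2 t ht).1.1) fun t ht => ?_
      have h1 := (hp.2.2 t ht).2
      have h2 : V ((q p).1, θ (q p) t) = A.chartField x₀ p.1 (θ (q p) t) := by
        conv_rhs => rw [← b.sum_equivFun p.1, A.chartField_sum]
        exact Finset.sum_congr rfl fun i _ => by rw [(hp.2.2 t ht).1.2 i]; rfl
      rwa [h2] at h1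
    · simp only [hp.2.1, q]
      exact (extChartAt 𝓘(ℝ, E) x₀).left_inv hp.1
  refine ContMDiffAt.congr_of_eventuallyEq ?_ hact
  have h1 : ContMDiffAt (𝓘(ℝ, 𝔤).prod 𝓘(ℝ, E)) 𝓘(ℝ, E) ∞ (fun p => θ (q p) 1) (0, x₀) := by
    have : ContMDiffAt 𝓘(ℝ, (Fin (Module.finrank ℝ 𝔤) → ℝ) × E) 𝓘(ℝ, E) ∞
        (fun p => θ p 1) (q (0, x₀)) := by
      rw [hq0]
      exact hθ.contMDiffAt
    exact this.comp (0, x₀) hq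
  have h0 : θ (q (0, x₀)) 1 ∈ (extChartAt 𝓘(ℝ, E) x₀).target :=
    ((hev.self_of_nhds.2.2) 1 (by norm_num)).1.1
  exact ((contMDiffOn_extChartAt_symm x₀).contMDiffAt (hopen.mem_nhds h0)).comp (0, x₀) h1

/-- Smoothness of the time-one flow at arbitrary `v₀`: `φ_{v₀}` is an iterate of `φ_{v₀ / (k + 1)}`,
and for large `k` all the factors lie in the domain of `contMDiffAt_act_zero`. The order `m` is
finite, as being `C^m` at a point is then an open condition. -/
theorem contMDiffAt_act_nat (m : ℕ) (p₀ : 𝔤 × M) :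
    ContMDiffAt (𝓘(ℝ, 𝔤).prod 𝓘(ℝ, E)) 𝓘(ℝ, E) m (fun p : 𝔤 × M => A.act p.1 p.2) p₀ := by
  obtain ⟨v₀, y₀⟩ := p₀
  have hm : (m : WithTop ℕ∞) ≠ ∞ := by simp
  let O : Set (𝔤 × M) := {p | ContMDiffAt (𝓘(ℝ, 𝔤).prod 𝓘(ℝ, E)) 𝓘(ℝ, E) m
    (fun p : 𝔤 × M => A.act p.1 p.2) p}
  have hO : IsOpen O := isOpen_iff_eventually.2 fun p hp =>
    (contMDiffAt_iff_contMDiffAt_nhds hm).1 hp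
  -- the orbit segment from `y₀` to `act v₀ y₀` is compact, so that the action is smooth on a
  -- uniform neighbourhood of it
  let K : Set M := (fun t : ℝ => A.act (t • v₀) y₀) '' Set.Icc 0 1
  have hK : IsCompact K := isCompact_Icc.image (A.isMIntegralCurve_act v₀ y₀).continuous
  have hsub : ({0} : Set 𝔤) ×ˢ K ⊆ O := by
    rintro ⟨v, x⟩ ⟨hv, -⟩
    obtain rfl : v = 0 := hv
    exact (A.contMDiffAt_act_zero x).of_le (mod_cast le_top)
  obtain ⟨U, U', hU, hU', h0U, hKU', hUO⟩ :=
    generalized_tube_lemma isCompact_singleton hK hO hsub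
  have hlim : Filter.Tendsto (fun k : ℕ => (1 / ((k : ℝ) + 1)) • v₀) Filter.atTop (𝓝 0) := by
    simpa using (tendsto_one_div_add_atTop_nhds_zero_nat (𝕜 := ℝ)).smul_const v₀
  obtain ⟨k, hk⟩ := (hlim.eventually_mem (hU.mem_nhds (h0U rfl))).exists
  have step : ∀ j : ℕ, j ≤ k + 1 → ContMDiffAt (𝓘(ℝ, 𝔤).prod 𝓘(ℝ, E)) 𝓘(ℝ, E) m
      (fun p : 𝔤 × M => A.act (((j : ℝ) / ((k : ℝ) + 1)) • p.1) p.2) (v₀, y₀) := by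
    intro j
    induction j with
    | zero =>
      intro _
      simpa using contMDiffAt_snd
    | succ j ih =>
      intro hj
      have hrw : (fun p : 𝔤 × M => A.act ((((j + 1 : ℕ) : ℝ) / ((k : ℝ) + 1)) • p.1) p.2) =
          (fun p : 𝔤 × M => A.act p.1 p.2) ∘ fun p : 𝔤 × M => ((1 / ((k : ℝ) + 1)) • p.1,
            A.act (((j : ℝ) / ((k : ℝ) + 1)) • p.1) p.2) := by
        funext p
        simp only [Function.comp_apply]
        rw [← A.act_add_smul]
        congr 2
        push_cast
        ring
      rw [hrw]
      refine ContMDiffAt.comp (I' := 𝓘(ℝ, 𝔤).prod 𝓘(ℝ, E)) (v₀, y₀) ?_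
        (ContMDiffAt.prodMk ?_ (ih (by omega)))
      · refine hUO ⟨hk, hKU' ⟨(j : ℝ) / ((k : ℝ) + 1), ⟨by positivity, ?_⟩, rfl⟩⟩
        rw [div_le_one (by positivity)]
        exact_mod_cast (by omega : j ≤ k + 1)
      · exact ((1 / ((k : ℝ) + 1)) • ContinuousLinearMap.id ℝ 𝔤).contMDiff.contMDiffAt.comp
          (v₀, y₀) contMDiffAt_fst
  have := step (k + 1) le_rfl
  have h1 : (((k + 1 : ℕ) : ℝ) / ((k : ℝ) + 1)) = 1 := by
    push_cast
    exact div_self (by positivity)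
  simpa only [h1, one_smul] using this

/-- The time-one flow depends smoothly on the vector `v ∈ 𝔤` and the initial point. -/
theorem contMDiff_act : ContMDiff (𝓘(ℝ, 𝔤).prod 𝓘(ℝ, E)) 𝓘(ℝ, E) ∞
    (fun p : 𝔤 × M => A.act p.1 p.2) :=
  contMDiff_infty.2 fun m p => A.contMDiffAt_act_nat m p

end WeaklyHamiltonianAction

/-! ### Leaves and Casimir functions -/

section Leaves

variable {E : Type*} [NormedAddCommGroup E] [NormedSpace ℝ E]
  {M : Type*} [TopologicalSpace M] [ChartedSpace E M]

theorem hasDerivWithinAt_comp_integralCurve {V : Type*} [NormedAddCommGroup V] [NormedSpace ℝ V]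
    {X : ∀ x : M, TangentSpace 𝓘(ℝ, E) x} {γ : ℝ → M} {s : Set ℝ} {t : ℝ}
    (hγ : HasMFDerivWithinAt 𝓘(ℝ, ℝ) 𝓘(ℝ, E) γ s t ((1 : ℝ →L[ℝ] ℝ).smulRight (X (γ t))))
    {f : M → V} (hf : MDifferentiableAt 𝓘(ℝ, E) 𝓘(ℝ, V) f (γ t)) :
    HasDerivWithinAt (fun τ => f (γ τ)) (mfderiv 𝓘(ℝ, E) 𝓘(ℝ, V) f (γ t) (X (γ t)) : V) s t := by
  let L : ℝ →L[ℝ] V := (mfderiv 𝓘(ℝ, E) 𝓘(ℝ, V) f (γ t)).comp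
    ((1 : ℝ →L[ℝ] ℝ).smulRight (X (γ t)))
  have h1 : HasFDerivWithinAt (fun τ => f (γ τ)) L s t :=
    (hf.hasMFDerivAt.comp_hasMFDerivWithinAt t hγ).hasFDerivWithinAt
  refine h1.hasDerivWithinAt.congr_deriv ?_
  change mfderiv 𝓘(ℝ, E) 𝓘(ℝ, V) f (γ t) ((1 : ℝ) • X (γ t)) = _
  rw [one_smul]

theorem hasDerivAt_comp_integralCurve {V : Type*} [NormedAddCommGroup V] [NormedSpace ℝ V]
    {X : ∀ x : M, TangentSpace 𝓘(ℝ, E) x} {γ : ℝ → M} {t : ℝ}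
    (hγ : HasMFDerivAt 𝓘(ℝ, ℝ) 𝓘(ℝ, E) γ t ((1 : ℝ →L[ℝ] ℝ).smulRight (X (γ t))))
    {f : M → V} (hf : MDifferentiableAt 𝓘(ℝ, E) 𝓘(ℝ, V) f (γ t)) :
    HasDerivAt (fun τ => f (γ τ)) (mfderiv 𝓘(ℝ, E) 𝓘(ℝ, V) f (γ t) (X (γ t)) : V) t := by
  exact hasDerivWithinAt_univ.1
    (hasDerivWithinAt_comp_integralCurve hγ.hasMFDerivWithinAt hf)

variable {π : PoissonStructure 𝓘(ℝ, E) M}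

theorem eq_of_sameLeaf_of_casimir {f : C^∞⟮𝓘(ℝ, E), M; ℝ⟯}
    (hf : ∀ x (α : Cotangent 𝓘(ℝ, E) x), differential 𝓘(ℝ, E) f x (π.sharp x α) = 0)
    {x y : M} (hxy : π.SameLeaf x y) : f x = f y := by
  induction hxy with
  | rel x y h =>
    obtain ⟨h, γ, hγ, rfl, rfl⟩ := h
    have hd : ∀ t ∈ Set.Icc (0 : ℝ) 1, HasDerivWithinAt (fun τ => f (γ τ)) 0 (Set.Icc 0 1) t := by
      intro t ht
      have := hasDerivWithinAt_comp_integralCurve (hγ t ht)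
        ((f.contMDiff (γ t)).mdifferentiableAt (by simp))
      exact this.congr_deriv (hf (γ t) (differential 𝓘(ℝ, E) h (γ t)))
    have := constant_of_derivWithin_zero (fun t ht => (hd t ht).differentiableWithinAt)
      (fun t ht => (hd t ⟨ht.1, ht.2.le⟩).derivWithin
        (uniqueDiffOn_Icc zero_lt_one t ⟨ht.1, ht.2.le⟩)) 1 (by simp)
    exact this.symm
  | refl x => rfl
  | symm x y _ ih => exact ih.symm
  | trans x y z _ _ ih1 ih2 => exact ih1.trans ih2

variable [IsManifold 𝓘(ℝ, E) ∞ M] [FiniteDimensional ℝ E] [T2Space M]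

/-- A function that is constant on a leaf has vanishing derivative in the directions tangent to
the leaf. -/
theorem mfderiv_sharp_eq_zero_of_leaf {V : Type*} [NormedAddCommGroup V] [NormedSpace ℝ V]
    {f : M → V} {x : M} (hf : MDifferentiableAt 𝓘(ℝ, E) 𝓘(ℝ, V) f x)
    (hleaf : ∀ y, π.SameLeaf x y → f y = f x) (α : Cotangent 𝓘(ℝ, E) x) :
    (mfderiv 𝓘(ℝ, E) 𝓘(ℝ, V) f x (π.sharp x α) : V) = 0 := by
  obtain ⟨h, rfl⟩ := exists_differential_eq x α
  obtain ⟨γ, h0, hγ⟩ := exists_isMIntegralCurveAt_of_contMDiffAt_boundaryless 0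
    ((contMDiff_hamiltonianVectorField π h x).of_le (by simp : (1 : WithTop ℕ∞) ≤ ∞))
  subst h0
  obtain ⟨ε, hε, hγε⟩ := isMIntegralCurveAt_iff'.1 hγ
  have hleafγ : ∀ s ∈ Metric.ball (0 : ℝ) ε, π.SameLeaf (γ 0) (γ s) := by
    intro s hs
    refine Relation.EqvGen.rel _ _ ⟨s • h, γ ∘ (· * s), ?_, by simp, by simp⟩
    have h1 : π.hamiltonianVectorField (s • h) = s • π.hamiltonianVectorField h := by
      funext y
      change π.sharp y (differential 𝓘(ℝ, E) (s • h : C^∞⟮𝓘(ℝ, E), M; ℝ⟯) y) = _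
      rw [differential_smul, map_smul]
      rfl
    rw [h1]
    refine (hγε.comp_mul s).mono fun t ht => ?_
    simp only [Set.mem_ofPred_eq, Metric.mem_ball, dist_zero_right, norm_mul] at hs ⊢
    refine lt_of_le_of_lt (mul_le_of_le_one_left (norm_nonneg _) ?_) hs
    rw [Real.norm_of_nonneg ht.1]
    exact ht.2
  have h1 := hasDerivAt_comp_integralCurve hγ.hasMFDerivAt hf
  have h2 : HasDerivAt (fun τ => f (γ τ)) 0 0 := by
    refine (hasDerivAt_const (0 : ℝ) (f (γ 0))).congr_of_eventuallyEq ?_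
    filter_upwards [Metric.ball_mem_nhds (0 : ℝ) hε] with s hs using hleaf _ (hleafγ s hs)
  exact h1.unique h2

end Leaves

namespace WeaklyHamiltonianAction

section Casimir

variable {E : Type*} [NormedAddCommGroup E] [NormedSpace ℝ E]
  {M : Type*} [TopologicalSpace M] [ChartedSpace E M]
  {π : PoissonStructure 𝓘(ℝ, E) M} {𝔤 : Type*} [NormedAddCommGroup 𝔤] [NormedSpace ℝ 𝔤]
  (A : WeaklyHamiltonianAction π 𝔤)

theorem cocycle_apply (u v : 𝔤) (x : M) :
    A.cocycle u v x = differential 𝓘(ℝ, E) (A.ρ u) x (A.fundamental v x) := rfl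

theorem cocycle_skew (u v : 𝔤) (x : M) : A.cocycle u v x = -A.cocycle v u x :=
  π.skew x _ _

variable [IsManifold 𝓘(ℝ, E) ∞ M] [FiniteDimensional ℝ E] [T2Space M]

/-- The cocycle takes values in the Casimir functions: by the Jacobi identity, its Hamiltonian
vector field is the commutator of two fundamental vector fields. -/
theorem differential_cocycle_sharp (u v : 𝔤) (x : M) (α : Cotangent 𝓘(ℝ, E) x) :
    differential 𝓘(ℝ, E) (A.cocycle u v) x (π.sharp x α) = 0 := by
  obtain ⟨h, rfl⟩ := exists_differential_eq x α
  have hj := congrArg (fun F : C^∞⟮𝓘(ℝ, E), M; ℝ⟯ => F x) (π.jacobi (A.ρ u) (A.ρ v) h)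
  have hc := A.commute u v h x
  have hskew : π.bracket (A.ρ v) h = (-1 : ℝ) • π.bracket h (A.ρ v) := by
    ext y
    change π.bracket (A.ρ v) h y = -1 * π.bracket h (A.ρ v) y
    rw [neg_one_mul]
    exact π.skew y _ _
  have e2 : π.bracket (π.bracket (A.ρ v) h) (A.ρ u) x =
      -differential 𝓘(ℝ, E) (π.bracket h (A.ρ v)) x (A.fundamental u x) := by
    rw [hskew]
    change differential 𝓘(ℝ, E) ((-1 : ℝ) • π.bracket h (A.ρ v) : C^∞⟮𝓘(ℝ, E), M; ℝ⟯) x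
      (A.fundamental u x) = _
    rw [differential_smul]
    exact neg_one_mul _
  change π.bracket (π.bracket (A.ρ u) (A.ρ v)) h x + π.bracket (π.bracket (A.ρ v) h) (A.ρ u) x +
    π.bracket (π.bracket h (A.ρ u)) (A.ρ v) x = 0 at hj
  rw [e2] at hj
  change differential 𝓘(ℝ, E) (π.bracket h (A.ρ v)) x (A.fundamental u x) =
    differential 𝓘(ℝ, E) (π.bracket h (A.ρ u)) x (A.fundamental v x) at hc
  change differential 𝓘(ℝ, E) (A.cocycle u v) x (π.hamiltonianVectorField h x) +
    -differential 𝓘(ℝ, E) (π.bracket h (A.ρ v)) x (A.fundamental u x) +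
    differential 𝓘(ℝ, E) (π.bracket h (A.ρ u)) x (A.fundamental v x) = 0 at hj
  rw [hc] at hj
  change differential 𝓘(ℝ, E) (A.cocycle u v) x (π.hamiltonianVectorField h x) = 0
  linarith

theorem cocycle_eq_of_sameLeaf (u v : 𝔤) {x y : M} (hxy : π.SameLeaf x y) :
    A.cocycle u v x = A.cocycle u v y :=
  eq_of_sameLeaf_of_casimir (A.differential_cocycle_sharp u v) hxy

end Casimir

/-! ### The action of the vector group by commuting flows -/

section Group

variable {E : Type} [NormedAddCommGroup E] [NormedSpace ℝ E]
  {M : Type*} [TopologicalSpace M] [ChartedSpace E M]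
  {π : PoissonStructure 𝓘(ℝ, E) M} {𝔤 : Type*} [NormedAddCommGroup 𝔤] [NormedSpace ℝ 𝔤]
  (A : WeaklyHamiltonianAction π 𝔤)
  [IsManifold 𝓘(ℝ, E) ∞ M] [FiniteDimensional ℝ E] [T2Space M]

theorem sameLeaf_act (v : 𝔤) (y : M) : π.SameLeaf y (A.act v y) :=
  Relation.EqvGen.rel _ _ ⟨A.ρ v, fun t => A.act (t • v) y,
    (A.isMIntegralCurve_act v y).isMIntegralCurveOn _, by simp, by simp⟩

/-- Along the flow of `X_v`, the Hamiltonian `H_u` grows at the rate `c(u, v)`, which is constant on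
the leaf. -/
theorem rho_act (u v : 𝔤) (y : M) :
    A.ρ u (A.act v y) = A.ρ u y + A.cocycle u v y := by
  have hd : ∀ t : ℝ, HasDerivAt (fun t : ℝ => A.ρ u (A.act (t • v) y) - t * A.cocycle u v y)
      0 t := by
    intro t
    have h1 := hasDerivAt_comp_integralCurve (A.isMIntegralCurve_act v y t)
      (((A.ρ u).contMDiff (A.act (t • v) y)).mdifferentiableAt (by simp))
    have h2 : A.cocycle u v y = A.cocycle u v (A.act (t • v) y) :=
      A.cocycle_eq_of_sameLeaf u v (A.sameLeaf_act (t • v) y)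
    have h3 := h1.sub ((hasDerivAt_id t).mul_const (A.cocycle u v y))
    refine h3.congr_deriv ?_
    rw [h2, one_mul]
    exact sub_self _
  have := is_const_of_deriv_eq_zero (fun t => (hd t).differentiableAt) (fun t => (hd t).deriv) 1 0
  simp only [one_smul, zero_smul, act_zero, one_mul, zero_mul, sub_zero] at this
  linarith

variable [FiniteDimensional ℝ 𝔤]

theorem contMDiff_act_right (v : 𝔤) : ContMDiff 𝓘(ℝ, E) 𝓘(ℝ, E) ∞ (A.act v) :=
  A.contMDiff_act.comp (contMDiff_const.prodMk contMDiff_id)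

theorem contMDiff_act_left (y : M) : ContMDiff 𝓘(ℝ, 𝔤) 𝓘(ℝ, E) ∞ (fun v => A.act v y) :=
  A.contMDiff_act.comp (contMDiff_id.prodMk contMDiff_const)

/-- The pull-back of a function by the time-one flow of `X_v`. -/
noncomputable def pull (v : 𝔤) (f : C^∞⟮𝓘(ℝ, E), M; ℝ⟯) : C^∞⟮𝓘(ℝ, E), M; ℝ⟯ :=
  ⟨fun x => f (A.act v x), f.contMDiff.comp (A.contMDiff_act_right v)⟩

theorem hasDerivAt_act (v : 𝔤) (y : M) (f : C^∞⟮𝓘(ℝ, E), M; ℝ⟯) (t : ℝ) :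
    HasDerivAt (fun t : ℝ => f (A.act (t • v) y)) (π.bracket f (A.ρ v) (A.act (t • v) y)) t :=
  hasDerivAt_comp_integralCurve (A.isMIntegralCurve_act v y t)
    ((f.contMDiff (A.act (t • v) y)).mdifferentiableAt (by simp))

/-- The derivative of the backward flow in time, expressed through a derivative at the initial
point. -/
theorem hasDerivAt_act_neg (v : 𝔤) (z : M) (f : C^∞⟮𝓘(ℝ, E), M; ℝ⟯) (t : ℝ) :
    HasDerivAt (fun τ : ℝ => f (A.act (-(τ • v)) z))
      (-π.bracket (A.pull (-(t • v)) f) (A.ρ v) z) t := by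
  have h1 := A.hasDerivAt_act v z (A.pull (-(t • v)) f) 0
  rw [zero_smul, act_zero] at h1
  have h2 : HasDerivAt (fun τ : ℝ => t - τ) (-1) t := by
    simpa using (hasDerivAt_id t).const_sub t
  have h1' : HasDerivAt (fun s : ℝ => A.pull (-(t • v)) f (A.act (s • v) z))
      (π.bracket (A.pull (-(t • v)) f) (A.ρ v) z) (t - t) := by rwa [sub_self]
  have h3 := h1'.comp t h2
  refine (h3.congr_deriv (by ring)).congr_of_eventuallyEq (Filter.Eventually.of_forall fun τ => ?_)
  change f _ = f (A.act (-(t • v)) (A.act ((t - τ) • v) z))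
  rw [← neg_smul, ← neg_smul, ← A.act_add_smul]
  congr 3
  ring

theorem hasDerivAt_fderiv_comp {V : Type*} [NormedAddCommGroup V] [NormedSpace ℝ V]
    {G : V → ℝ} (hG : ContDiff ℝ ∞ G) {c : ℝ → V} {c' : V} {t : ℝ} (hc : HasDerivAt c c' t)
    (w : V) : HasDerivAt (fun τ => fderiv ℝ G (c τ) w) (fderiv ℝ (fderiv ℝ G) (c t) c' w) t := by
  have hG' : ContDiff ℝ ∞ (fderiv ℝ G) := hG.fderiv_right (by simp)
  have h1 : HasFDerivAt (fderiv ℝ G) (fderiv ℝ (fderiv ℝ G) (c t)) (c t) :=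
    (hG'.differentiable (by simp) (c t)).hasFDerivAt
  have h2 := h1.comp_hasDerivAt t hc
  have h3 := ((ContinuousLinearMap.apply ℝ ℝ w).hasFDerivAt
    (x := fderiv ℝ G (c t))).comp_hasDerivAt t h2
  exact h3

/-- If the mixed second derivatives of `G` cancel along the diagonal, then the derivative of `G` in
the last variable is constant along the diagonal. -/
theorem fderiv_diagonal_const {G : ℝ × ℝ × ℝ → ℝ} (hG : ContDiff ℝ ∞ G) {a b : ℝ → ℝ}
    (ha : ∀ t, HasDerivAt (fun r => fderiv ℝ G (t, r, 0) (0, 0, 1)) (a t) t)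
    (hb : ∀ t, HasDerivAt (fun s => fderiv ℝ G (t, t, s) (1, 0, 0)) (b t) 0)
    (hab : ∀ t, a t + b t = 0) (t : ℝ) :
    fderiv ℝ G (t, t, 0) (0, 0, 1) = fderiv ℝ G (0, 0, 0) (0, 0, 1) := by
  have hsymm : ∀ p v w, fderiv ℝ (fderiv ℝ G) p v w = fderiv ℝ (fderiv ℝ G) p w v := fun p v w =>
    (hG.contDiffAt.isSymmSndFDerivAt (by
      simp only [minSmoothness_of_isRCLikeNormedField]
      exact WithTop.coe_le_coe.2 (le_top : (2 : ℕ∞) ≤ ⊤))) v w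
  have key : ∀ t, HasDerivAt (fun t => fderiv ℝ G (t, t, 0) (0, 0, 1)) 0 t := by
    intro t
    have c1 : HasDerivAt (fun t : ℝ => (t, t, (0 : ℝ))) (1, 1, 0) t :=
      (hasDerivAt_id t).prodMk ((hasDerivAt_id t).prodMk (hasDerivAt_const t 0))
    have c2 : HasDerivAt (fun r : ℝ => (t, r, (0 : ℝ))) (0, 1, 0) t :=
      (hasDerivAt_const t t).prodMk ((hasDerivAt_id t).prodMk (hasDerivAt_const t 0))
    have c3 : HasDerivAt (fun s : ℝ => (t, t, s)) (0, 0, 1) 0 :=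
      (hasDerivAt_const 0 t).prodMk ((hasDerivAt_const 0 t).prodMk (hasDerivAt_id 0))
    have d1 := hasDerivAt_fderiv_comp hG c1 (0, 0, 1)
    have e2 := (hasDerivAt_fderiv_comp hG c2 (0, 0, 1)).unique (ha t)
    have e3 := (hasDerivAt_fderiv_comp hG c3 (1, 0, 0)).unique (hb t)
    refine d1.congr_deriv ?_
    have : ((1 : ℝ), (1 : ℝ), (0 : ℝ)) = (1, 0, 0) + (0, 1, 0) := by simp
    rw [this, map_add, add_apply, hsymm _ (1, 0, 0), e2, e3, add_comm]
    exact hab t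
  exact is_const_of_deriv_eq_zero (fun t => (key t).differentiableAt) (fun t => (key t).deriv) t 0

/-- The flow of `X_v` preserves `X_w`. -/
theorem bracket_pull (v w : 𝔤) (f : C^∞⟮𝓘(ℝ, E), M; ℝ⟯) (y : M) :
    π.bracket (A.pull v f) (A.ρ w) y = π.bracket f (A.ρ w) (A.act v y) := by
  suffices H : ∀ g : C^∞⟮𝓘(ℝ, E), M; ℝ⟯,
      π.bracket (A.pull (-v) g) (A.ρ w) (A.act v y) = π.bracket g (A.ρ w) y by
    rw [← H]
    congr 2
    ext x
    change f (A.act v (A.act (-v) x)) = f x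
    rw [act_act_neg]
  intro g
  -- for `r = t`, the derivative in `s` at `s = 0` is the derivative of `g` along the pull-back of
  -- `X_w` by the flow of `X_v` at time `t`; it has to be shown independent of `t`
  let G : ℝ × ℝ × ℝ → ℝ := fun p =>
    g (A.act (-(p.1 • v)) (A.act (p.2.2 • w) (A.act (p.2.1 • v) y)))
  have hG : ContDiff ℝ ∞ G := by
    rw [← contMDiff_iff_contDiff]
    have l1 : ContMDiff 𝓘(ℝ, ℝ × ℝ × ℝ) 𝓘(ℝ, 𝔤) ∞ fun p : ℝ × ℝ × ℝ => -(p.1 • v) :=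
      ContDiff.contMDiff (by fun_prop)
    have l2 : ContMDiff 𝓘(ℝ, ℝ × ℝ × ℝ) 𝓘(ℝ, 𝔤) ∞ fun p : ℝ × ℝ × ℝ => p.2.1 • v :=
      ContDiff.contMDiff (by fun_prop)
    have l3 : ContMDiff 𝓘(ℝ, ℝ × ℝ × ℝ) 𝓘(ℝ, 𝔤) ∞ fun p : ℝ × ℝ × ℝ => p.2.2 • w :=
      ContDiff.contMDiff (by fun_prop)
    exact g.contMDiff.comp (A.contMDiff_act.comp (l1.prodMk (A.contMDiff_act.comp
      (l3.prodMk (A.contMDiff_act.comp (l2.prodMk contMDiff_const))))))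
  have hGd : ∀ p, HasFDerivAt G (fderiv ℝ G p) p := fun p =>
    (hG.differentiable (by simp) p).hasFDerivAt
  -- the partial derivatives of `G` in the last and in the first variable
  have p3 : ∀ t r s, fderiv ℝ G (t, r, s) (0, 0, 1) =
      π.bracket (A.pull (-(t • v)) g) (A.ρ w) (A.act (s • w) (A.act (r • v) y)) := by
    intro t r s
    have c3 : HasDerivAt (fun s : ℝ => (t, r, s)) (0, 0, 1) s :=
      (hasDerivAt_const s t).prodMk ((hasDerivAt_const s r).prodMk (hasDerivAt_id s))
    exact ((hGd (t, r, s)).comp_hasDerivAt s c3).unique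
      (A.hasDerivAt_act w (A.act (r • v) y) (A.pull (-(t • v)) g) s)
  have p1 : ∀ t r s, fderiv ℝ G (t, r, s) (1, 0, 0) =
      -π.bracket (A.pull (-(t • v)) g) (A.ρ v) (A.act (s • w) (A.act (r • v) y)) := by
    intro t r s
    have c1 : HasDerivAt (fun t : ℝ => (t, r, s)) (1, 0, 0) t :=
      (hasDerivAt_id t).prodMk ((hasDerivAt_const t r).prodMk (hasDerivAt_const t s))
    exact ((hGd (t, r, s)).comp_hasDerivAt t c1).unique
      (A.hasDerivAt_act_neg v (A.act (s • w) (A.act (r • v) y)) g t)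
  have := fderiv_diagonal_const hG
    (a := fun t => π.bracket (π.bracket (A.pull (-(t • v)) g) (A.ρ w)) (A.ρ v) (A.act (t • v) y))
    (b := fun t => -π.bracket (π.bracket (A.pull (-(t • v)) g) (A.ρ v)) (A.ρ w) (A.act (t • v) y))
    (fun t => by
      simp only [p3, zero_smul, act_zero]
      exact A.hasDerivAt_act v y (π.bracket (A.pull (-(t • v)) g) (A.ρ w)) t)
    (fun t => by
      simp only [p1]
      have h1 := A.hasDerivAt_act w (A.act (t • v) y) (π.bracket (A.pull (-(t • v)) g) (A.ρ v)) 0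
      rw [zero_smul, act_zero] at h1
      exact h1.neg)
    (fun t => by
      have := A.commute v w (A.pull (-(t • v)) g) (A.act (t • v) y)
      change π.bracket (π.bracket (A.pull (-(t • v)) g) (A.ρ w)) (A.ρ v) (A.act (t • v) y) =
        π.bracket (π.bracket (A.pull (-(t • v)) g) (A.ρ v)) (A.ρ w) (A.act (t • v) y) at this
      rw [this]
      ring) 1
  rw [p3, p3] at this
  simp only [one_smul, zero_smul, act_zero, neg_zero] at this
  rw [this]
  congr 2
  ext x
  change g (A.act 0 x) = g x
  rw [act_zero]

/-- The commuting flows define an action of the vector group `𝔤` on `M`. -/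
theorem act_add (v w : 𝔤) (y : M) : A.act (v + w) y = A.act v (A.act w y) := by
  have hη : ContMDiff 𝓘(ℝ, ℝ) 𝓘(ℝ, E) ∞ (fun t : ℝ => A.act (t • v) (A.act (t • w) y)) := by
    have l1 : ContMDiff 𝓘(ℝ, ℝ) 𝓘(ℝ, 𝔤) ∞ fun t : ℝ => t • v := ContDiff.contMDiff (by fun_prop)
    have l2 : ContMDiff 𝓘(ℝ, ℝ) 𝓘(ℝ, 𝔤) ∞ fun t : ℝ => t • w := ContDiff.contMDiff (by fun_prop)
    exact A.contMDiff_act.comp (l1.prodMk (A.contMDiff_act.comp (l2.prodMk contMDiff_const)))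
  have hcurve : IsMIntegralCurve (fun t : ℝ => A.act (t • v) (A.act (t • w) y))
      (A.fundamental (v + w)) := by
    intro t
    have hd := ((hη t).mdifferentiableAt (by simp)).hasMFDerivAt
    refine hd.congr_mfderiv ?_
    refine ContinuousLinearMap.ext_ring ?_
    change _ = (1 : ℝ) • A.fundamental (v + w) _
    rw [one_smul]
    refine tangent_ext fun f => ?_
    let L : ℝ →L[ℝ] ℝ := (differential 𝓘(ℝ, E) f (A.act (t • v) (A.act (t • w) y))).comp
      (mfderiv 𝓘(ℝ, ℝ) 𝓘(ℝ, E) (fun t : ℝ => A.act (t • v) (A.act (t • w) y)) t)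
    have h0 : HasFDerivAt (fun t : ℝ => f (A.act (t • v) (A.act (t • w) y))) L t :=
      ((((f.contMDiff (A.act (t • v) (A.act (t • w) y))).mdifferentiableAt
        (by simp)).hasMFDerivAt).comp t hd).hasFDerivAt
    have h1 := h0.hasDerivAt
    let G : ℝ × ℝ → ℝ := fun p => f (A.act (p.1 • v) (A.act (p.2 • w) y))
    have hG : ContDiff ℝ ∞ G := by
      rw [← contMDiff_iff_contDiff]
      have l1 : ContMDiff 𝓘(ℝ, ℝ × ℝ) 𝓘(ℝ, 𝔤) ∞ fun p : ℝ × ℝ => p.1 • v :=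
        ContDiff.contMDiff (by fun_prop)
      have l2 : ContMDiff 𝓘(ℝ, ℝ × ℝ) 𝓘(ℝ, 𝔤) ∞ fun p : ℝ × ℝ => p.2 • w :=
        ContDiff.contMDiff (by fun_prop)
      exact f.contMDiff.comp (A.contMDiff_act.comp (l1.prodMk (A.contMDiff_act.comp
        (l2.prodMk contMDiff_const))))
    have hGd : HasFDerivAt G (fderiv ℝ G (t, t)) (t, t) :=
      (hG.differentiable (by simp) (t, t)).hasFDerivAt
    have e1 : fderiv ℝ G (t, t) (1, 0) =
        π.bracket f (A.ρ v) (A.act (t • v) (A.act (t • w) y)) :=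
      (hGd.comp_hasDerivAt t (f := fun s : ℝ => (s, t))
        ((hasDerivAt_id t).prodMk (hasDerivAt_const t t))).unique
        (A.hasDerivAt_act v (A.act (t • w) y) f t)
    have e2 : fderiv ℝ G (t, t) (0, 1) =
        π.bracket f (A.ρ w) (A.act (t • v) (A.act (t • w) y)) := by
      rw [← A.bracket_pull]
      exact (hGd.comp_hasDerivAt t (f := fun s : ℝ => (t, s))
        ((hasDerivAt_const t t).prodMk (hasDerivAt_id t))).unique
        (A.hasDerivAt_act w y (A.pull (t • v) f) t)
    have h2 : HasDerivAt (fun t : ℝ => f (A.act (t • v) (A.act (t • w) y)))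
        (fderiv ℝ G (t, t) (1, 1)) t :=
      hGd.comp_hasDerivAt t (f := fun s : ℝ => (s, s)) ((hasDerivAt_id t).prodMk (hasDerivAt_id t))
    have e3 : fderiv ℝ G (t, t) (1, 1) =
        differential 𝓘(ℝ, E) f (A.act (t • v) (A.act (t • w) y))
          (A.fundamental (v + w) (A.act (t • v) (A.act (t • w) y))) := by
      have : ((1 : ℝ), (1 : ℝ)) = (1, 0) + (0, 1) := by simp
      rw [this, map_add, e1, e2, fundamental_add, map_add]
      rfl
    rw [← e3]
    exact h1.unique h2
  have := A.integralCurve_eq_act hcurve (y := y) (by simp) 1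
  simpa using this.symm

theorem mfderiv_act_left (v w : 𝔤) (y : M) :
    mfderiv 𝓘(ℝ, 𝔤) 𝓘(ℝ, E) (fun u => A.act u y) v w = A.fundamental w (A.act v y) := by
  have h1 := ((A.contMDiff_act_left y v).mdifferentiableAt (by simp)).hasMFDerivAt
  have h2 : HasMFDerivAt 𝓘(ℝ, ℝ) 𝓘(ℝ, 𝔤) (fun t : ℝ => t • w + v) 0
      ((1 : ℝ →L[ℝ] ℝ).smulRight w) := by
    have : HasFDerivAt (fun t : ℝ => t • w + v) ((1 : ℝ →L[ℝ] ℝ).smulRight w) 0 :=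
      ((hasFDerivAt_id (0 : ℝ)).smul_const w).add_const v
    exact this.hasMFDerivAt
  have h1' : HasMFDerivAt 𝓘(ℝ, 𝔤) 𝓘(ℝ, E) (fun u => A.act u y) ((0 : ℝ) • w + v)
      (mfderiv 𝓘(ℝ, 𝔤) 𝓘(ℝ, E) (fun u => A.act u y) v) := by
    rw [zero_smul, zero_add]
    exact h1
  have h3 := h1'.comp (0 : ℝ) h2
  have h4 := A.isMIntegralCurve_act w (A.act v y) 0
  have e : (fun u => A.act u y) ∘ (fun t : ℝ => t • w + v) =
      fun t : ℝ => A.act (t • w) (A.act v y) :=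
    funext fun t => A.act_add (t • w) v y
  rw [e] at h3
  have h5 := congrArg (fun B => B (1 : ℝ)) (hasMFDerivAt_unique h3 h4)
  change mfderiv 𝓘(ℝ, 𝔤) 𝓘(ℝ, E) (fun u => A.act u y) v ((1 : ℝ) • w) =
    (1 : ℝ) • A.fundamental w (A.act ((0 : ℝ) • w) (A.act v y)) at h5
  rw [one_smul, one_smul, zero_smul, act_zero] at h5
  exact h5

end Group

end WeaklyHamiltonianAction

/-! ### Fixed point sets of smooth retractions -/

section Retraction

theorem eventually_surjective_of_continuousAt {X E F : Type*} [TopologicalSpace X]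
    [NormedAddCommGroup E] [NormedSpace ℝ E] [NormedAddCommGroup F] [NormedSpace ℝ F]
    [FiniteDimensional ℝ F] {B : X → E →L[ℝ] F} {x : X} (hB : ContinuousAt B x)
    (hsurj : Function.Surjective (B x)) : ∀ᶠ y in 𝓝 x, Function.Surjective (B y) := by
  obtain ⟨R, hR⟩ := (B x : E →ₗ[ℝ] F).exists_rightInverse_of_surjective
    (LinearMap.range_eq_top.2 hsurj)
  have : CompleteSpace F := FiniteDimensional.complete ℝ F
  let R' : F →L[ℝ] E := LinearMap.toContinuousLinearMap R
  have h1 : ContinuousAt (fun y => (B y).comp R') x := hB.clm_comp continuousAt_const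
  have h2 : (B x).comp R' = 1 := by
    ext v
    exact LinearMap.congr_fun hR v
  have h3 : ∀ᶠ y in 𝓝 x, IsUnit ((B y).comp R') := by
    refine h1.eventually_mem (s := {C : F →L[ℝ] F | IsUnit C}) ?_
    rw [h2]
    exact Units.isOpen.mem_nhds isUnit_one
  filter_upwards [h3] with y hy
  obtain ⟨u, hu⟩ := hy
  intro w
  refine ⟨R' ((↑u⁻¹ : F →L[ℝ] F) w), ?_⟩
  change ((B y).comp R') _ = w
  rw [← hu]
  exact congrArg (fun C : F →L[ℝ] F => C w) u.mul_inv

variable {E : Type*} [NormedAddCommGroup E] [NormedSpace ℝ E]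
  {M : Type*} [TopologicalSpace M] [ChartedSpace E M] [IsManifold 𝓘(ℝ, E) ∞ M]

/-- The derivative of a map `M → M` at `x`, as an endomorphism of the model space. It represents an
endomorphism of `T_x M` if `x` is a fixed point, since `T_x M` is by definition the model space,
in the coordinates of the preferred chart at `x`. -/
noncomputable def fixedDeriv (E : Type*) [NormedAddCommGroup E] [NormedSpace ℝ E]
    {M : Type*} [TopologicalSpace M] [ChartedSpace E M] (r : M → M) (x : M) : E →L[ℝ] E :=
  mfderiv 𝓘(ℝ, E) 𝓘(ℝ, E) r x

theorem hasFDerivAt_comp_extChartAt_symm {V : Type*} [NormedAddCommGroup V] [NormedSpace ℝ V]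
    {f : M → V} {x : M} {L : E →L[ℝ] V} (hf : HasMFDerivAt 𝓘(ℝ, E) 𝓘(ℝ, V) f x L) :
    HasFDerivAt (f ∘ (extChartAt 𝓘(ℝ, E) x).symm) L (extChartAt 𝓘(ℝ, E) x x) := by
  have h : HasFDerivWithinAt (f ∘ (extChartAt 𝓘(ℝ, E) x).symm) L (Set.range 𝓘(ℝ, E))
    (extChartAt 𝓘(ℝ, E) x x) := hf.2
  rwa [modelWithCornersSelf_coe, Set.range_id, hasFDerivWithinAt_univ] at h

theorem hasMFDerivAt_extChartAt_self (x : M) : HasMFDerivAt 𝓘(ℝ, E) 𝓘(ℝ, E)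
    (extChartAt 𝓘(ℝ, E) x) x (ContinuousLinearMap.id ℝ E) := by
  have h1 := (mdifferentiableAt_extChartAt (I := 𝓘(ℝ, E)) (mem_chart_source E x)).hasMFDerivAt
  rw [mfderiv_extChartAt_self] at h1
  exact h1

variable {r : M → M} (hr : ContMDiff 𝓘(ℝ, E) 𝓘(ℝ, E) ∞ r) (hrr : ∀ y, r (r y) = r y)
include hr

theorem hasMFDerivAt_comp_fixed {V : Type*} [NormedAddCommGroup V] [NormedSpace ℝ V] {x : M}
    (hx : r x = x) {f : M → V} {L : E →L[ℝ] V} (hf : HasMFDerivAt 𝓘(ℝ, E) 𝓘(ℝ, V) f x L) :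
    HasMFDerivAt 𝓘(ℝ, E) 𝓘(ℝ, V) (fun y => f (r y)) x (L.comp (fixedDeriv E r x)) := by
  have h1 := ((hr x).mdifferentiableAt (by simp)).hasMFDerivAt
  have h2 : ∀ z, z = x → HasMFDerivAt 𝓘(ℝ, E) 𝓘(ℝ, V) f z L := by
    rintro z rfl
    exact hf
  exact (h2 (r x) hx).comp x h1

/-- The displacement `y - r y` in the chart at a fixed point has derivative `1 - dr`. -/
theorem hasMFDerivAt_displacement {x : M} (hx : r x = x) : HasMFDerivAt 𝓘(ℝ, E) 𝓘(ℝ, E)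
    (fun y => extChartAt 𝓘(ℝ, E) x y - extChartAt 𝓘(ℝ, E) x (r y)) x
    (ContinuousLinearMap.id ℝ E - fixedDeriv E r x) := by
  have h1 := hasMFDerivAt_extChartAt_self (E := E) x
  have h2 := hasMFDerivAt_comp_fixed hr hx h1
  exact h1.sub h2

theorem contMDiffOn_displacement (x : M) : ContMDiffOn 𝓘(ℝ, E) 𝓘(ℝ, E) ∞
    (fun y => extChartAt 𝓘(ℝ, E) x y - extChartAt 𝓘(ℝ, E) x (r y))
    ((chartAt E x).source ∩ r ⁻¹' (chartAt E x).source) := by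
  have h1 : ContMDiffOn 𝓘(ℝ, E) 𝓘(ℝ, E) ∞ (extChartAt 𝓘(ℝ, E) x) (chartAt E x).source :=
    contMDiffOn_extChartAt
  exact (h1.mono Set.inter_subset_left).sub
    (h1.comp (hr.contMDiffOn) fun y hy => hy.2)

include hrr

/-- The tangent space of the fixed point set of a smooth retraction consists of the fixed vectors
of its derivative. -/
theorem mem_tangentSubspace_fixed_iff [FiniteDimensional ℝ E] {x : M} (hx : r x = x)
    (ξ : TangentSpace 𝓘(ℝ, E) x) :
    ξ ∈ tangentSubspace 𝓘(ℝ, E) {y | r y = y} x ↔ fixedDeriv E r x ξ = (ξ : E) := by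
  constructor
  · intro hξ
    let b := Module.finBasis ℝ E
    refine (b.ext_elem (x := (ξ : E)) (y := fixedDeriv E r x ξ) fun i => ?_).symm
    let L : E →L[ℝ] ℝ := (ContinuousLinearMap.proj (φ := fun _ : Fin (Module.finrank ℝ E) => ℝ)
      i).comp (b.equivFunL : E →L[ℝ] _)
    have hd := L.hasMFDerivAt.comp x (hasMFDerivAt_displacement hr hx)
    have hU : (chartAt E x).source ∩ r ⁻¹' (chartAt E x).source ∈ 𝓝 x := by
      refine Filter.inter_mem ((chartAt E x).open_source.mem_nhds (mem_chart_source E x)) ?_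
      refine hr.continuous.continuousAt.preimage_mem_nhds ?_
      rw [hx]
      exact (chartAt E x).open_source.mem_nhds (mem_chart_source E x)
    have hsm : ContMDiffAt 𝓘(ℝ, E) 𝓘(ℝ, ℝ) ∞
        (fun y => L (extChartAt 𝓘(ℝ, E) x y - extChartAt 𝓘(ℝ, E) x (r y))) x :=
      L.contMDiff.contMDiffAt.comp x ((contMDiffOn_displacement hr x).contMDiffAt hU)
    have h1 := hξ _ hsm (by
      filter_upwards [self_mem_nhdsWithin] with y hy
      have hy : r y = y := hy
      rw [hy, sub_self, map_zero])
    let ξ' : E := ξ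
    have h2 : L (ξ' - fixedDeriv E r x ξ') = 0 :=
      (congrArg (fun B : E →L[ℝ] ℝ => B ξ) hd.mfderiv).symm.trans h1
    rw [map_sub, sub_eq_zero] at h2
    exact h2
  · intro hξ f hf h0
    have hd := ((hf.mdifferentiableAt (by simp))).hasMFDerivAt
    have h1 := hasMFDerivAt_comp_fixed hr hx hd
    have h2 : Filter.Tendsto r (𝓝 x) (𝓝[{y | r y = y}] x) := by
      refine tendsto_nhdsWithin_iff.2 ⟨?_, Filter.Eventually.of_forall hrr⟩
      have := hr.continuous.continuousAt (x := x)
      rwa [ContinuousAt, hx] at this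
    have h3 : (fun y => f (r y)) =ᶠ[𝓝 x] fun _ => (0 : ℝ) := h2.eventually h0
    have h4 : HasMFDerivAt 𝓘(ℝ, E) 𝓘(ℝ, ℝ) (fun y => f (r y)) x (0 : E →L[ℝ] ℝ) :=
      (hasMFDerivAt_const (0 : ℝ) x).congr_of_eventuallyEq h3
    have h5 := congrArg (fun B : E →L[ℝ] ℝ => B ξ) (hasMFDerivAt_unique h1 h4)
    change mfderiv 𝓘(ℝ, E) 𝓘(ℝ, ℝ) f x (fixedDeriv E r x ξ) = 0 at h5
    rw [hξ] at h5
    exact h5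

theorem fixedDeriv_idem {x : M} (hx : r x = x) (ξ : E) :
    fixedDeriv E r x (fixedDeriv E r x ξ) = fixedDeriv E r x ξ := by
  have h1 := hasMFDerivAt_comp_fixed hr hx
    (hasMFDerivAt_comp_fixed hr hx (hasMFDerivAt_extChartAt_self x))
  have h2 := hasMFDerivAt_comp_fixed hr hx (hasMFDerivAt_extChartAt_self x)
  have e : (fun y => extChartAt 𝓘(ℝ, E) x (r (r y))) = fun y => extChartAt 𝓘(ℝ, E) x (r y) :=
    funext fun y => by rw [hrr]
  rw [e] at h1
  exact congrArg (fun B : E →L[ℝ] E => B ξ) (hasMFDerivAt_unique h1 h2)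

/-- Near a fixed point `x`, the fixed point set of a smooth retraction `r` with derivative `D` at
`x` is the zero set of the component of `y - r y` in the kernel of `D`. -/
theorem isEmbeddedSubmanifold_fixed [FiniteDimensional ℝ E] {q : ℕ}
    (hq : ∀ x, r x = x → Module.finrank ℝ (LinearMap.ker (fixedDeriv E r x : E →ₗ[ℝ] E)) = q) :
    IsEmbeddedSubmanifold 𝓘(ℝ, E) q {y | r y = y} := by
  intro x hx
  have hx : r x = x := hx
  have : CompleteSpace E := FiniteDimensional.complete ℝ E
  let D : E →L[ℝ] E := fixedDeriv E r x
  have hDD : ∀ ξ, D (D ξ) = D ξ := fixedDeriv_idem hr hrr hx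
  let e : LinearMap.ker (D : E →ₗ[ℝ] E) ≃ₗ[ℝ] (Fin q → ℝ) :=
    LinearEquiv.ofFinrankEq _ _ (by rw [hq x hx, Module.finrank_fin_fun])
  let P : E →ₗ[ℝ] LinearMap.ker (D : E →ₗ[ℝ] E) :=
    LinearMap.codRestrict _ (LinearMap.id - (D : E →ₗ[ℝ] E)) fun ξ => by
      simp [LinearMap.mem_ker, hDD]
  have hP : ∀ ξ, (P ξ : E) = ξ - D ξ := fun ξ => rfl
  let T : E →L[ℝ] (Fin q → ℝ) := LinearMap.toContinuousLinearMap (e.toLinearMap ∘ₗ P)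
  have hT : ∀ ξ, T ξ = e (P ξ) := fun ξ => rfl
  have hTD : ∀ ξ, T (ξ - D ξ) = T ξ := by
    intro ξ
    rw [hT, hT]
    congr 1
    ext
    simp [hP, hDD]
  have hTsurj : Function.Surjective T := by
    intro w
    refine ⟨(e.symm w : E), ?_⟩
    have : P (e.symm w : E) = e.symm w := by
      ext
      have h0 : D (e.symm w : E) = 0 := (e.symm w).2
      rw [hP, h0, sub_zero]
    rw [hT, this, e.apply_symm_apply]
  let φ := extChartAt 𝓘(ℝ, E) x
  let κ : M → E := fun y => φ y - φ (r y)
  let O : Set M := (chartAt E x).source ∩ r ⁻¹' (chartAt E x).source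
  have hO : IsOpen O :=
    (chartAt E x).open_source.inter ((chartAt E x).open_source.preimage hr.continuous)
  have hxO : x ∈ O := ⟨mem_chart_source E x, by
    change r x ∈ (chartAt E x).source
    rw [hx]
    exact mem_chart_source E x⟩
  have hκ : ContMDiffOn 𝓘(ℝ, E) 𝓘(ℝ, E) ∞ κ O := contMDiffOn_displacement hr x
  have hκd : HasMFDerivAt 𝓘(ℝ, E) 𝓘(ℝ, E) κ x (ContinuousLinearMap.id ℝ E - D) :=
    hasMFDerivAt_displacement hr hx
  let ψ : M → (Fin q → ℝ) := fun y => T (κ y)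
  have hψ : ContMDiffOn 𝓘(ℝ, E) 𝓘(ℝ, Fin q → ℝ) ∞ ψ O := T.contMDiff.comp_contMDiffOn hκ
  have hψd : HasMFDerivAt 𝓘(ℝ, E) 𝓘(ℝ, Fin q → ℝ) ψ x T := by
    refine (T.hasMFDerivAt.comp x hκd).congr_mfderiv ?_
    ext1 ξ
    exact hTD ξ
  -- `K` has derivative the identity, hence is injective near `x`; it is used to see that `ψ y = 0`
  -- forces `r y = y`
  let K : M → E := fun y => D (φ (r y)) + (κ y - D (κ y))
  have hKsm : ContMDiffAt 𝓘(ℝ, E) 𝓘(ℝ, E) ∞ K x := by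
    have h1 : ContMDiffOn 𝓘(ℝ, E) 𝓘(ℝ, E) ∞ (fun y => φ (r y)) O :=
      (contMDiffOn_extChartAt (I := 𝓘(ℝ, E)) (x := x)).comp hr.contMDiffOn fun y hy => hy.2
    have h2 : ContMDiffOn 𝓘(ℝ, E) 𝓘(ℝ, E) ∞ K O :=
      (D.contMDiff.comp_contMDiffOn h1).add (hκ.sub (D.contMDiff.comp_contMDiffOn hκ))
    exact h2.contMDiffAt (hO.mem_nhds hxO)
  have hKd : HasMFDerivAt 𝓘(ℝ, E) 𝓘(ℝ, E) K x (ContinuousLinearMap.id ℝ E) := by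
    have h1 : HasMFDerivAt 𝓘(ℝ, E) 𝓘(ℝ, E) (fun y => φ (r y)) x
        ((ContinuousLinearMap.id ℝ E).comp D) :=
      hasMFDerivAt_comp_fixed hr hx (hasMFDerivAt_extChartAt_self x)
    have h2 := (D.hasMFDerivAt.comp x h1).add (hκd.sub (D.hasMFDerivAt.comp x hκd))
    refine h2.congr_mfderiv ?_
    refine ContinuousLinearMap.ext fun ξ : E => ?_
    change D (D ξ) + ((ξ - D ξ) - D (ξ - D ξ)) = ξ
    rw [map_sub, hDD]
    abel
  have hsymm : ContMDiffAt 𝓘(ℝ, E) 𝓘(ℝ, E) ∞ φ.symm (φ x) :=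
    (contMDiffOn_extChartAt_symm x).contMDiffAt
      ((isOpen_extChartAt_target x).mem_nhds (mem_extChartAt_target x))
  have hφx : φ.symm (φ x) = x := extChartAt_to_inv x
  have hKs : HasStrictFDerivAt (K ∘ φ.symm)
      ((ContinuousLinearEquiv.refl ℝ E : E ≃L[ℝ] E) : E →L[ℝ] E) (φ x) := by
    have h1 : ContDiffAt ℝ ∞ (K ∘ φ.symm) (φ x) := by
      rw [← contMDiffAt_iff_contDiffAt]
      exact ContMDiffAt.comp_of_eq hKsm hsymm hφx
    refine h1.hasStrictFDerivAt' ?_ (by simp)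
    exact hasFDerivAt_comp_extChartAt_symm hKd
  have hinj : ∀ᶠ y in 𝓝 x, hKs.localInverse (K ∘ φ.symm) _ (φ x) (K y) = φ y := by
    have h1 := (continuousAt_extChartAt (I := 𝓘(ℝ, E)) x).eventually hKs.eventually_left_inverse
    filter_upwards [h1, hO.mem_nhds hxO] with y hy hyO
    have : φ.symm (φ y) = y := φ.left_inv (by simpa [φ] using hyO.1)
    rwa [Function.comp_apply, this] at hy
  have hrinj : ∀ᶠ y in 𝓝 x, hKs.localInverse (K ∘ φ.symm) _ (φ x) (K (r y)) = φ (r y) := by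
    have h1 := hr.continuous.continuousAt (x := x)
    rw [ContinuousAt, hx] at h1
    exact h1.eventually hinj
  have hsurj : ∀ᶠ y in 𝓝 x, Function.Surjective (mfderiv 𝓘(ℝ, E) 𝓘(ℝ, Fin q → ℝ) ψ y) := by
    have h1 : ContDiffAt ℝ ∞ (ψ ∘ φ.symm) (φ x) := by
      rw [← contMDiffAt_iff_contDiffAt]
      exact ContMDiffAt.comp_of_eq (hψ.contMDiffAt (hO.mem_nhds hxO)) hsymm hφx
    have h2 : ContinuousAt (fderiv ℝ (ψ ∘ φ.symm)) (φ x) :=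
      (h1.fderiv_right (m := 0) (by simp)).continuousAt
    have h3 : fderiv ℝ (ψ ∘ φ.symm) (φ x) = T :=
      (hasFDerivAt_comp_extChartAt_symm hψd).fderiv
    have h4 := eventually_surjective_of_continuousAt h2 (by rw [h3]; exact hTsurj)
    have h5 : ∀ᶠ z in 𝓝 (φ x), DifferentiableAt ℝ (ψ ∘ φ.symm) z :=
      ((h1.of_le (by simp : (1 : WithTop ℕ∞) ≤ ∞)).eventually (by simp)).mono
        fun z hz => hz.differentiableAt (by simp)
    have h6 := (continuousAt_extChartAt (I := 𝓘(ℝ, E)) x).eventually (h4.and h5)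
    filter_upwards [h6, hO.eventually_mem hxO] with y hy hyO
    have hev : ψ =ᶠ[𝓝 y] fun z => (ψ ∘ φ.symm) (φ z) := by
      filter_upwards [hO.mem_nhds hyO] with z hz
      have : φ.symm (φ z) = z := φ.left_inv (by simpa [φ] using hz.1)
      rw [Function.comp_apply, this]
    have hcomp := hy.2.hasFDerivAt.hasMFDerivAt.comp y
      (mdifferentiableAt_extChartAt (I := 𝓘(ℝ, E)) hyO.1).hasMFDerivAt
    rw [hev.mfderiv_eq]
    have h7 := hcomp.mfderiv
    intro w
    obtain ⟨z, hz⟩ := hy.1 w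
    obtain ⟨ξ, hξ⟩ := (isInvertible_mfderiv_extChartAt (I := 𝓘(ℝ, E))
      (by simpa using hyO.1 : y ∈ (extChartAt 𝓘(ℝ, E) x).source)).bijective.surjective z
    refine ⟨ξ, ?_⟩
    refine (congrArg (fun B : E →L[ℝ] (Fin q → ℝ) => B ξ) h7).trans ?_
    refine Eq.trans ?_ hz
    exact congrArg (fderiv ℝ (ψ ∘ φ.symm) (φ y)) hξ
  obtain ⟨U, hU, hUo, hxU⟩ := mem_nhds_iff.1
    (((hinj.and hrinj).and (hsurj.and (hO.eventually_mem hxO))) : _ ∈ 𝓝 x)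
  refine ⟨U, ψ, hUo, hxU, hψ.mono fun y hy => (hU hy).2.2, fun y hy => ⟨fun h => ?_, fun h => ?_⟩,
    fun y hy => (hU hy.1).2.1⟩
  · have h : r y = y := h
    simp [ψ, κ, h]
  · obtain ⟨⟨h1, h2⟩, -, hyO⟩ := hU hy
    have h3 : κ y - D (κ y) = 0 := by
      have : P (κ y) = 0 := e.map_eq_zero_iff.1 h
      rw [← hP, this]
      rfl
    have h4 : K y = K (r y) := by
      simp only [K, κ, hrr, sub_self, map_zero]
      exact congrArg (D (φ (r y)) + ·) h3
    rw [h4, h2] at h1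
    exact (extChartAt 𝓘(ℝ, E) x).injOn (by simpa using hyO.2) (by simpa using hyO.1) h1

end Retraction

/-! ### The section `v` of `F` determined by the Hamiltonians -/

/-- Cramer's rule: the solution of a linear system depends smoothly on the system. -/
theorem contMDiffOn_solution {E : Type*} [NormedAddCommGroup E] [NormedSpace ℝ E]
    {M : Type*} [TopologicalSpace M] [ChartedSpace E M] {l : ℕ} {U : Set M}
    {C : M → Matrix (Fin l) (Fin l) ℝ} {a h : M → Fin l → ℝ}
    (hC : ∀ i j, ContMDiffOn 𝓘(ℝ, E) 𝓘(ℝ, ℝ) ∞ (fun y => C y i j) U)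
    (hh : ∀ i, ContMDiffOn 𝓘(ℝ, E) 𝓘(ℝ, ℝ) ∞ (fun y => h y i) U)
    (hdet : ∀ y ∈ U, (C y).det ≠ 0) (hsol : ∀ y ∈ U, (C y).mulVec (a y) = h y) (i : Fin l) :
    ContMDiffOn 𝓘(ℝ, E) 𝓘(ℝ, ℝ) ∞ (fun y => a y i) U := by
  have hpoly : ∀ B : M → Matrix (Fin l) (Fin l) ℝ,
      (∀ i j, ContMDiffOn 𝓘(ℝ, E) 𝓘(ℝ, ℝ) ∞ (fun y => B y i j) U) →
      ContMDiffOn 𝓘(ℝ, E) 𝓘(ℝ, ℝ) ∞ (fun y => (B y).det) U := by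
    intro B hB
    have h1 : ContMDiffOn 𝓘(ℝ, E) 𝓘(ℝ, Fin l → Fin l → ℝ) ∞
        (fun y => (fun i j => B y i j : Fin l → Fin l → ℝ)) U :=
      contMDiffOn_pi_space.2 fun i => contMDiffOn_pi_space.2 fun j => hB i j
    have h2 : ContDiff ℝ ∞ (fun B : Fin l → Fin l → ℝ => (Matrix.of B).det) := by
      simp only [Matrix.det_apply, Matrix.of_apply]
      fun_prop
    exact h2.contMDiff.comp_contMDiffOn h1
  have h1 := (hpoly (fun y => (C y).updateCol i (h y)) fun j k => by
    by_cases hk : k = i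
    · subst hk
      simpa using hh j
    · simpa [Matrix.updateCol_ne hk] using hC j k)
  have h2 := hpoly C hC
  have h3 : ContMDiffOn 𝓘(ℝ, E) 𝓘(ℝ, ℝ) ∞ (fun y => ((C y).det)⁻¹) U := fun y hy =>
    (contDiffAt_inv ℝ (hdet y hy)).contMDiffAt.comp_contMDiffWithinAt y (h2 y hy)
  refine (h3.smul h1).congr fun y hy => ?_
  have h4 : (C y).det • a y = (C y).cramer (h y) := by
    rw [← hsol y hy, Matrix.cramer_eq_adjugate_mulVec, Matrix.mulVec_mulVec,
      Matrix.adjugate_mul, Matrix.smul_mulVec, Matrix.one_mulVec]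
  have h5 := congrFun h4 i
  rw [Matrix.cramer_apply] at h5
  change a y i = ((C y).det)⁻¹ * ((C y).updateCol i (h y)).det
  rw [← h5]
  simp [hdet y hy]

namespace WeaklyHamiltonianAction

variable {E : Type} [NormedAddCommGroup E] [NormedSpace ℝ E]
  {M : Type*} [TopologicalSpace M] [ChartedSpace E M]
  {π : PoissonStructure 𝓘(ℝ, E) M} {𝔤 : Type*} [NormedAddCommGroup 𝔤] [NormedSpace ℝ 𝔤]
  (A : WeaklyHamiltonianAction π 𝔤)

/-- The bilinear form `c(x)` on `𝔤`. -/
noncomputable def cocycleForm (x : M) : 𝔤 →ₗ[ℝ] 𝔤 →ₗ[ℝ] ℝ :=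
  LinearMap.mk₂ ℝ (fun u v => A.cocycle u v x)
    (fun u u' v => by
      simp only [cocycle_apply, map_add]
      rw [ContMDiffMap.coe_add, ← ContMDiffMap.coe_add, differential_add]
      rfl)
    (fun c u v => by
      simp only [cocycle_apply, map_smul]
      rw [ContMDiffMap.coe_smul, ← ContMDiffMap.coe_smul, differential_smul]
      rfl)
    (fun u v v' => by simp only [cocycle_apply, fundamental_add, map_add])
    (fun c u v => by simp only [cocycle_apply, fundamental_smul, map_smul])

@[simp] theorem cocycleForm_apply (x : M) (u v : 𝔤) :
    A.cocycleForm x u v = A.cocycle u v x := rfl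

/-- The values of the Hamiltonians at a point, as a linear functional on `𝔤`. -/
noncomputable def momentum (x : M) : 𝔤 →ₗ[ℝ] ℝ where
  toFun u := A.ρ u x
  map_add' u v := by rw [map_add]; rfl
  map_smul' c u := by rw [map_smul]; rfl

@[simp] theorem momentum_apply (x : M) (u : 𝔤) : A.momentum x u = A.ρ u x := rfl

section Smooth

variable [FiniteDimensional ℝ 𝔤] {U : Set M} {σ τ : M → 𝔤}

theorem contMDiffOn_rho (hσ : ContMDiffOn 𝓘(ℝ, E) 𝓘(ℝ, 𝔤) ∞ σ U) :
    ContMDiffOn 𝓘(ℝ, E) 𝓘(ℝ, ℝ) ∞ (fun y => A.ρ (σ y) y) U := by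
  let b := Module.finBasis ℝ 𝔤
  have h1 : (fun y => A.ρ (σ y) y) = fun y => ∑ i, b.equivFunL (σ y) i * A.ρ (b i) y := by
    funext y
    have h := congrArg (A.momentum y) (b.sum_equivFun (σ y))
    rw [map_sum] at h
    simp only [map_smul, momentum_apply, smul_eq_mul] at h
    exact h.symm
  rw [h1]
  have h2 : ContMDiffOn 𝓘(ℝ, E) 𝓘(ℝ, Fin (Module.finrank ℝ 𝔤) → ℝ) ∞
      (fun y => b.equivFunL (σ y)) U :=
    (b.equivFunL : 𝔤 →L[ℝ] (Fin (Module.finrank ℝ 𝔤) → ℝ)).contMDiff.comp_contMDiffOn hσ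
  exact contMDiffOn_finsetSum fun i _ =>
    (contMDiffOn_pi_space.1 h2 i).mul (A.ρ (b i)).contMDiff.contMDiffOn

theorem contMDiffOn_cocycle (hσ : ContMDiffOn 𝓘(ℝ, E) 𝓘(ℝ, 𝔤) ∞ σ U)
    (hτ : ContMDiffOn 𝓘(ℝ, E) 𝓘(ℝ, 𝔤) ∞ τ U) :
    ContMDiffOn 𝓘(ℝ, E) 𝓘(ℝ, ℝ) ∞ (fun y => A.cocycle (σ y) (τ y) y) U := by
  let b := Module.finBasis ℝ 𝔤
  have h1 : (fun y => A.cocycle (σ y) (τ y) y) = fun y => ∑ i, ∑ j,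
      (b.equivFunL (σ y) i * b.equivFunL (τ y) j) * A.cocycle (b i) (b j) y := by
    funext y
    have h := congrArg₂ (fun u v => A.cocycleForm y u v) (b.sum_equivFun (σ y))
      (b.sum_equivFun (τ y))
    simp only [map_sum, map_smul, LinearMap.sum_apply, LinearMap.smul_apply, cocycleForm_apply,
      smul_eq_mul, Finset.mul_sum] at h
    rw [← h, Finset.sum_comm]
    refine Finset.sum_congr rfl fun i _ => Finset.sum_congr rfl fun j _ => ?_
    change _ = b.equivFun (σ y) i * b.equivFun (τ y) j * _
    ring
  rw [h1]
  have h2 : ∀ {θ : M → 𝔤}, ContMDiffOn 𝓘(ℝ, E) 𝓘(ℝ, 𝔤) ∞ θ U → ContMDiffOn 𝓘(ℝ, E)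
      𝓘(ℝ, Fin (Module.finrank ℝ 𝔤) → ℝ) ∞ (fun y => b.equivFunL (θ y)) U := fun hθ =>
    (b.equivFunL : 𝔤 →L[ℝ] (Fin (Module.finrank ℝ 𝔤) → ℝ)).contMDiff.comp_contMDiffOn hθ
  exact contMDiffOn_finsetSum fun i _ => contMDiffOn_finsetSum fun j _ =>
    ((contMDiffOn_pi_space.1 (h2 hσ) i).mul (contMDiffOn_pi_space.1 (h2 hτ) j)).mul
      (A.cocycle (b i) (b j)).contMDiff.contMDiffOn

end Smooth

variable {F : M → Submodule ℝ 𝔤} {l : ℕ}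

theorem finrank_fibre (hF : IsSubbundleOverLeafSpace π l F) (x : M) :
    Module.finrank ℝ (F x) = l := by
  obtain ⟨U, s, -, hx, -, hs⟩ := hF.exists_frame x
  obtain ⟨hli, hspan⟩ := hs x hx
  rw [← hspan, finrank_span_eq_card hli, Fintype.card_fin]

variable (hc : A.IsSymplecticOn F)

include hc in
theorem eq_of_cocycle_eq {x : M} {v w : 𝔤} (hv : v ∈ F x) (hw : w ∈ F x)
    (h : ∀ u ∈ F x, A.cocycle u v x = A.cocycle u w x) : v = w := by
  refine sub_eq_zero.1 (hc x _ ((F x).sub_mem hv hw) fun u hu => ?_)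
  rw [cocycle_skew, ← cocycleForm_apply, map_sub, cocycleForm_apply, cocycleForm_apply, h u hu,
    sub_self, neg_zero]

include hc in
theorem exists_splittingVector [FiniteDimensional ℝ 𝔤] (x : M) :
    ∃ v ∈ F x, ∀ u ∈ F x, A.ρ u x + A.cocycle u v x = 0 := by
  let B : F x →ₗ[ℝ] Module.Dual ℝ (F x) :=
    ((A.cocycleForm x).flip.domRestrict₁₂ (F x) (F x))
  have hB : ∀ v u : F x, B v u = A.cocycle u v x := fun v u => rfl
  have hinj : Function.Injective B := fun v w h => Subtype.ext
    (A.eq_of_cocycle_eq hc v.2 w.2 fun u hu => LinearMap.congr_fun h ⟨u, hu⟩)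
  have hsurj : Function.Surjective B :=
    (LinearMap.injective_iff_surjective_of_finrank_eq_finrank
      Subspace.dual_finrank_eq.symm).1 hinj
  obtain ⟨v, hv⟩ := hsurj (-((A.momentum x).domRestrict (F x)))
  refine ⟨v, v.2, fun u hu => ?_⟩
  have h1 := LinearMap.congr_fun hv ⟨u, hu⟩
  rw [hB] at h1
  rw [h1]
  exact add_neg_cancel _

/-- The vector `v(x) ∈ F_x` with `H_u(x) + c(u, v(x))(x) = 0` for all `u ∈ F_x`: the time-one flow
of `X_{v(x)}` moves `x` to the common zero locus of the Hamiltonians of `F_x`. -/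
noncomputable def splittingVector [FiniteDimensional ℝ 𝔤] (hc : A.IsSymplecticOn F) (x : M) : 𝔤 :=
  Classical.choose (A.exists_splittingVector hc x)

section SplittingVector

variable [FiniteDimensional ℝ 𝔤]

theorem splittingVector_mem (x : M) : A.splittingVector hc x ∈ F x :=
  (Classical.choose_spec (A.exists_splittingVector hc x)).1

theorem rho_add_cocycle_splittingVector {x : M} {u : 𝔤} (hu : u ∈ F x) :
    A.ρ u x + A.cocycle u (A.splittingVector hc x) x = 0 :=
  (Classical.choose_spec (A.exists_splittingVector hc x)).2 u hu

theorem eq_splittingVector {x : M} {v : 𝔤} (hv : v ∈ F x)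
    (h : ∀ u ∈ F x, A.ρ u x + A.cocycle u v x = 0) : v = A.splittingVector hc x :=
  A.eq_of_cocycle_eq hc hv (A.splittingVector_mem hc x) fun u hu => by
    have h1 := h u hu
    have h2 := A.rho_add_cocycle_splittingVector hc hu
    linarith

theorem mem_zeroLocus_iff {x : M} : x ∈ A.zeroLocus F ↔ A.splittingVector hc x = 0 := by
  constructor
  · intro h
    refine (A.eq_splittingVector hc (F x).zero_mem fun u hu => ?_).symm
    rw [← cocycleForm_apply, map_zero, add_zero]
    exact h u hu
  · intro h u hu
    have := A.rho_add_cocycle_splittingVector hc hu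
    rwa [h, ← cocycleForm_apply, map_zero, add_zero] at this

include hc in
/-- Sections of `F` whose pairings with the local frames are smooth have smooth coordinates in local
frames, as the matrix of `c` in a local frame is invertible. -/
theorem exists_smooth_coordinates {τ : M → 𝔤}
    (hτF : ∀ y, τ y ∈ F y) {U : Set M} {s : Fin l → M → 𝔤}
    (hs : ∀ i, ContMDiffOn 𝓘(ℝ, E) 𝓘(ℝ, 𝔤) ∞ (s i) U)
    (hsF : ∀ y ∈ U, LinearIndependent ℝ (fun i => s i y) ∧
      Submodule.span ℝ (Set.range fun i => s i y) = F y)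
    (hτ : ∀ i, ContMDiffOn 𝓘(ℝ, E) 𝓘(ℝ, ℝ) ∞ (fun y => A.cocycle (s i y) (τ y) y) U) :
    ∃ a : Fin l → M → ℝ, (∀ i, ContMDiffOn 𝓘(ℝ, E) 𝓘(ℝ, ℝ) ∞ (a i) U) ∧
      ∀ y ∈ U, ∑ i, a i y • s i y = τ y := by
  have hex : ∀ y, ∃ a : Fin l → ℝ, y ∈ U → ∑ i, a i • s i y = τ y := by
    intro y
    by_cases hy : y ∈ U
    · have h1 := hτF y
      rw [← (hsF y hy).2] at h1
      obtain ⟨a, ha⟩ := (Submodule.mem_span_range_iff_exists_fun ℝ).1 h1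
      exact ⟨a, fun _ => ha⟩
    · exact ⟨0, fun h => absurd h hy⟩
  choose a ha using hex
  refine ⟨fun i y => a y i, fun i => ?_, ha⟩
  refine contMDiffOn_solution (C := fun y => Matrix.of fun i j => A.cocycle (s i y) (s j y) y)
    (a := a) (h := fun y i => A.cocycle (s i y) (τ y) y)
    (fun i j => A.contMDiffOn_cocycle (hs i) (hs j)) hτ (fun y hy => ?_) (fun y hy => ?_) i
  · intro hdet
    obtain ⟨w, hw0, hw⟩ := Matrix.exists_mulVec_eq_zero_iff.2 hdet
    have hmem : ∀ w : Fin l → ℝ, ∑ j, w j • s j y ∈ F y := fun w => by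
      rw [← (hsF y hy).2]
      exact Submodule.sum_mem _ fun j _ =>
        Submodule.smul_mem _ _ (Submodule.subset_span ⟨j, rfl⟩)
    have h0 : ∑ j, w j • s j y = 0 := by
      refine A.eq_of_cocycle_eq hc (hmem w) (F y).zero_mem fun u hu => ?_
      rw [← (hsF y hy).2] at hu
      obtain ⟨z, rfl⟩ := (Submodule.mem_span_range_iff_exists_fun ℝ).1 hu
      have h2 : ∀ i, ∑ j, w j * A.cocycle (s i y) (s j y) y = 0 := fun i => by
        have := congrFun hw i
        simpa [Matrix.mulVec, dotProduct, mul_comm] using this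
      rw [← cocycleForm_apply, ← cocycleForm_apply, map_zero]
      simp only [map_sum, map_smul, LinearMap.sum_apply, LinearMap.smul_apply, cocycleForm_apply,
        smul_eq_mul, Finset.mul_sum]
      rw [Finset.sum_comm]
      refine Finset.sum_eq_zero fun i _ => ?_
      have h3 := congrArg (z i * ·) (h2 i)
      simp only [Finset.mul_sum, mul_zero] at h3
      refine Eq.trans (Finset.sum_congr rfl fun j _ => ?_) h3
      ring
    exact hw0 (funext fun j => Fintype.linearIndependent_iff.1 (hsF y hy).1 w h0 j)
  · funext i
    have h1 := congrArg (A.cocycleForm y (s i y)) (ha y hy)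
    simp only [map_sum, map_smul, cocycleForm_apply, smul_eq_mul] at h1
    simpa [Matrix.mulVec, dotProduct, mul_comm] using h1

theorem contMDiff_splittingVector (hF : IsSubbundleOverLeafSpace π l F) :
    ContMDiff 𝓘(ℝ, E) 𝓘(ℝ, 𝔤) ∞ (A.splittingVector hc) := by
  intro x
  obtain ⟨U, s, hU, hx, hs, hsF⟩ := hF.exists_frame x
  have hmem : ∀ i, ∀ y ∈ U, s i y ∈ F y := fun i y hy => by
    rw [← (hsF y hy).2]
    exact Submodule.subset_span ⟨i, rfl⟩
  obtain ⟨a, ha, hsum⟩ := A.exists_smooth_coordinates hc (A.splittingVector_mem hc) hs hsF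
    (fun i => ((A.contMDiffOn_rho (hs i)).neg).congr fun y hy => by
      have := A.rho_add_cocycle_splittingVector hc (hmem i y hy)
      linarith)
  have h1 : ContMDiffOn 𝓘(ℝ, E) 𝓘(ℝ, 𝔤) ∞ (fun y => ∑ i, a i y • s i y) U :=
    contMDiffOn_finsetSum fun i _ => (ha i).smul (hs i)
  exact (h1.congr fun y hy => (hsum y hy).symm).contMDiffAt (hU.mem_nhds hx)

/-- The derivative of a section of `F` at a zero takes values in the fibre. -/
theorem mfderiv_section_mem [IsManifold 𝓘(ℝ, E) ∞ M] (hF : IsSubbundleOverLeafSpace π l F)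
    (hc : A.IsSymplecticOn F) {τ : M → 𝔤}
    (hτ : ContMDiff 𝓘(ℝ, E) 𝓘(ℝ, 𝔤) ∞ τ) (hτF : ∀ y, τ y ∈ F y) {x : M} (hx : τ x = 0)
    (ξ : TangentSpace 𝓘(ℝ, E) x) : (mfderiv 𝓘(ℝ, E) 𝓘(ℝ, 𝔤) τ x ξ : 𝔤) ∈ F x := by
  obtain ⟨U, s, hU, hxU, hs, hsF⟩ := hF.exists_frame x
  obtain ⟨a, ha, hsum⟩ := A.exists_smooth_coordinates hc hτF hs hsF
    (fun i => A.contMDiffOn_cocycle (hs i) hτ.contMDiffOn)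
  have ha0 : ∀ i, a i x = 0 :=
    Fintype.linearIndependent_iff.1 (hsF x hxU).1 (fun i => a i x) ((hsum x hxU).trans hx)
  have hat : ∀ i, MDifferentiableAt 𝓘(ℝ, E) 𝓘(ℝ, ℝ) (a i) x := fun i =>
    ((ha i).contMDiffAt (hU.mem_nhds hxU)).mdifferentiableAt (by simp)
  have hst : ∀ i, MDifferentiableAt 𝓘(ℝ, E) 𝓘(ℝ, 𝔤) (s i) x := fun i =>
    ((hs i).contMDiffAt (hU.mem_nhds hxU)).mdifferentiableAt (by simp)
  let ξ' : E := ξ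
  let dτ : E →L[ℝ] 𝔤 := mfderiv 𝓘(ℝ, E) 𝓘(ℝ, 𝔤) τ x
  let da : Fin l → E →L[ℝ] ℝ := fun i => mfderiv 𝓘(ℝ, E) 𝓘(ℝ, ℝ) (a i) x
  let ds : Fin l → E →L[ℝ] 𝔤 := fun i => mfderiv 𝓘(ℝ, E) 𝓘(ℝ, 𝔤) (s i) x
  have hda : ∀ i, HasFDerivAt (a i ∘ (extChartAt 𝓘(ℝ, E) x).symm) (da i) (extChartAt 𝓘(ℝ, E) x x) :=
    fun i => hasFDerivAt_comp_extChartAt_symm (hat i).hasMFDerivAt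
  have hds : ∀ i, HasFDerivAt (s i ∘ (extChartAt 𝓘(ℝ, E) x).symm) (ds i) (extChartAt 𝓘(ℝ, E) x x) :=
    fun i => hasFDerivAt_comp_extChartAt_symm (hst i).hasMFDerivAt
  have h1 := HasFDerivAt.fun_sum (u := Finset.univ) fun i _ => (hda i).smul (hds i)
  have h2 : HasFDerivAt (τ ∘ (extChartAt 𝓘(ℝ, E) x).symm)
      dτ (extChartAt 𝓘(ℝ, E) x x) :=
    hasFDerivAt_comp_extChartAt_symm ((hτ x).mdifferentiableAt (by simp)).hasMFDerivAt
  have hcont : ContinuousAt (extChartAt 𝓘(ℝ, E) x).symm (extChartAt 𝓘(ℝ, E) x x) :=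
    continuousAt_extChartAt_symm x
  have hev : τ ∘ (extChartAt 𝓘(ℝ, E) x).symm =ᶠ[𝓝 (extChartAt 𝓘(ℝ, E) x x)]
      fun z => ∑ i, (a i ∘ (extChartAt 𝓘(ℝ, E) x).symm) z •
        (s i ∘ (extChartAt 𝓘(ℝ, E) x).symm) z := by
    filter_upwards [hcont.eventually_mem (by
      rw [extChartAt_to_inv]; exact hU.mem_nhds hxU)] with z hz using (hsum _ hz).symm
  have h3 := h2.unique (h1.congr_of_eventuallyEq hev)
  have h4 : dτ ξ' = ∑ i, da i ξ' • s i x := by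
    rw [h3]
    simp only [Function.comp_apply, extChartAt_to_inv, ha0, zero_smul, zero_add, sum_apply]
    rfl
  change dτ ξ' ∈ F x
  rw [h4, ← (hsF x hxU).2]
  exact Submodule.sum_mem _ fun i _ => Submodule.smul_mem _ _ (Submodule.subset_span ⟨i, rfl⟩)

end SplittingVector

end WeaklyHamiltonianAction

/-! ### Sections of `F` along the leaves -/

/-- The derivative of a vector-valued function on `M`, as an operator on the model space, which is
by definition the tangent space at each point. -/
noncomputable def derivAt (E : Type*) [NormedAddCommGroup E] [NormedSpace ℝ E]
    {M : Type*} [TopologicalSpace M] [ChartedSpace E M] {V : Type*} [NormedAddCommGroup V]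
    [NormedSpace ℝ V] (f : M → V) (x : M) : E →L[ℝ] V := mfderiv 𝓘(ℝ, E) 𝓘(ℝ, V) f x

theorem hasMFDerivAt_derivAt {E : Type*} [NormedAddCommGroup E] [NormedSpace ℝ E]
    {M : Type*} [TopologicalSpace M] [ChartedSpace E M] {V : Type*} [NormedAddCommGroup V]
    [NormedSpace ℝ V] {f : M → V} (hf : ContMDiff 𝓘(ℝ, E) 𝓘(ℝ, V) ∞ f) (x : M) :
    HasMFDerivAt 𝓘(ℝ, E) 𝓘(ℝ, V) f x (derivAt E f x : E →L[ℝ] V) :=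
  ((hf x).mdifferentiableAt (by simp)).hasMFDerivAt

theorem exists_projection {V : Type*} [NormedAddCommGroup V] [NormedSpace ℝ V]
    [FiniteDimensional ℝ V] (W : Submodule ℝ V) :
    ∃ P : V →L[ℝ] V, (∀ v, P v ∈ W) ∧ ∀ v ∈ W, P v = v := by
  obtain ⟨p, hp⟩ := W.subtype.exists_leftInverse_of_injective (Submodule.ker_subtype W)
  refine ⟨LinearMap.toContinuousLinearMap (W.subtype ∘ₗ p), fun v => (p v).2, fun v hv => ?_⟩
  exact congrArg Subtype.val (LinearMap.congr_fun hp ⟨v, hv⟩)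

namespace WeaklyHamiltonianAction

variable {E : Type} [NormedAddCommGroup E] [NormedSpace ℝ E] [FiniteDimensional ℝ E]
  {M : Type*} [TopologicalSpace M] [T2Space M] [ChartedSpace E M] [IsManifold 𝓘(ℝ, E) ∞ M]
  {π : PoissonStructure 𝓘(ℝ, E) M} {𝔤 : Type*} [NormedAddCommGroup 𝔤] [NormedSpace ℝ 𝔤]
  [FiniteDimensional ℝ 𝔤] (A : WeaklyHamiltonianAction π 𝔤)
  {F : M → Submodule ℝ 𝔤} {l : ℕ} (hF : IsSubbundleOverLeafSpace π l F)
  (hc : A.IsSymplecticOn F)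

/-- The fundamental vectors at `x`, as elements of the model space: `fundamentalₗ x` with the
codomain `T_x M` replaced by its definition. -/
noncomputable def fundamentalMap (x : M) : 𝔤 →ₗ[ℝ] E := A.fundamentalₗ x

include hF

/-- The derivative of a section of `F` along the leaf takes values in the fibre, as `F` is constant
along the leaf. -/
theorem derivAt_sharp_mem {τ : M → 𝔤} (hτ : ContMDiff 𝓘(ℝ, E) 𝓘(ℝ, 𝔤) ∞ τ)
    (hτF : ∀ y, τ y ∈ F y) (x : M) (α : Cotangent 𝓘(ℝ, E) x) :
    derivAt E τ x (π.sharp x α : E) ∈ F x := by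
  obtain ⟨P, hP, hPid⟩ := exists_projection (F x)
  let R : 𝔤 →L[ℝ] 𝔤 := ContinuousLinearMap.id ℝ 𝔤 - P
  have h1 : HasMFDerivAt 𝓘(ℝ, E) 𝓘(ℝ, 𝔤) (fun y => R (τ y)) x (R.comp (derivAt E τ x)) :=
    R.hasMFDerivAt.comp x (hasMFDerivAt_derivAt hτ x)
  have h2 := mfderiv_sharp_eq_zero_of_leaf (π := π) h1.mdifferentiableAt (fun y hy => by
    have e1 : R (τ x) = 0 := sub_eq_zero.2 (hPid _ (hτF x)).symm
    have e2 : R (τ y) = 0 := sub_eq_zero.2 (hPid _ (hF.eq_of_sameLeaf x y hy ▸ hτF y)).symm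
    rw [e1, e2]) α
  rw [h1.mfderiv] at h2
  have h3 : derivAt E τ x (π.sharp x α : E) = P (derivAt E τ x (π.sharp x α : E)) :=
    sub_eq_zero.1 h2
  rw [h3]
  exact hP _

omit hF in
theorem derivAt_sharp_of_const {τ : M → 𝔤} (hτ : ContMDiff 𝓘(ℝ, E) 𝓘(ℝ, 𝔤) ∞ τ)
    (hτc : ∀ x y, π.SameLeaf x y → τ x = τ y) (x : M) (α : Cotangent 𝓘(ℝ, E) x) :
    derivAt E τ x (π.sharp x α : E) = 0 :=
  mfderiv_sharp_eq_zero_of_leaf ((hτ x).mdifferentiableAt (by simp))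
    (fun y hy => (hτc x y hy).symm) α

/-- The equation defining the splitting vector, differentiated along the leaf. -/
theorem differential_rho_sharp {x : M} {u : 𝔤} (hu : u ∈ F x) (α : Cotangent 𝓘(ℝ, E) x) :
    differential 𝓘(ℝ, E) (A.ρ u) x (π.sharp x α) +
      A.cocycle u (derivAt E (A.splittingVector hc) x (π.sharp x α : E)) x = 0 := by
  let L : 𝔤 →L[ℝ] ℝ := LinearMap.toContinuousLinearMap (A.cocycleForm x u)
  have hL : ∀ v, L v = A.cocycle u v x := fun v => rfl
  have h0 : HasMFDerivAt 𝓘(ℝ, E) 𝓘(ℝ, ℝ) (fun y => L (A.splittingVector hc y)) x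
      (L.comp (derivAt E (A.splittingVector hc) x)) :=
    L.hasMFDerivAt.comp x (hasMFDerivAt_derivAt (A.contMDiff_splittingVector hc hF) x)
  have h1 : HasMFDerivAt 𝓘(ℝ, E) 𝓘(ℝ, ℝ) (fun y => A.ρ u y + L (A.splittingVector hc y)) x
      ((derivAt E (A.ρ u) x : E →L[ℝ] ℝ) + L.comp (derivAt E (A.splittingVector hc) x)) :=
    (hasMFDerivAt_derivAt (A.ρ u).contMDiff x).add h0
  have h2 := mfderiv_sharp_eq_zero_of_leaf (π := π) h1.mdifferentiableAt (fun y hy => by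
    have e1 := A.rho_add_cocycle_splittingVector hc hu
    have e2 := A.rho_add_cocycle_splittingVector hc (hF.eq_of_sameLeaf x y hy ▸ hu)
    rw [← A.cocycle_eq_of_sameLeaf _ _ hy] at e2
    rw [hL, hL, e1, e2]) α
  rw [h1.mfderiv] at h2
  exact h2

theorem derivAt_splittingVector_fundamental {x : M} {w : 𝔤} (hw : w ∈ F x) :
    derivAt E (A.splittingVector hc) x (A.fundamentalMap x w) = -w := by
  have h1 := derivAt_sharp_mem hF (A.contMDiff_splittingVector hc hF)
    (A.splittingVector_mem hc) x (differential 𝓘(ℝ, E) (A.ρ w) x)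
  refine A.eq_of_cocycle_eq hc h1 ((F x).neg_mem hw) fun u hu => ?_
  have h2 := A.differential_rho_sharp hF hc hu (differential 𝓘(ℝ, E) (A.ρ w) x)
  have h3 : A.cocycle u w x + A.cocycle u (derivAt E (A.splittingVector hc) x
      (A.fundamentalMap x w)) x = 0 := h2
  rw [← A.cocycleForm_apply x u (-w), map_neg, cocycleForm_apply]
  linarith

theorem mem_fibre_act_iff {y : M} {v w : 𝔤} : v ∈ F (A.act w y) ↔ v ∈ F y := by
  rw [hF.eq_of_sameLeaf y _ (A.sameLeaf_act w y)]

/-- Along the orbits of `F_y`, the splitting vector changes by translation. -/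
theorem splittingVector_act {y : M} {w : 𝔤} (hw : w ∈ F y) :
    A.splittingVector hc (A.act w y) = A.splittingVector hc y - w := by
  refine (A.eq_splittingVector hc ?_ fun u hu => ?_).symm
  · rw [mem_fibre_act_iff A hF]
    exact (F y).sub_mem (A.splittingVector_mem hc y) hw
  · rw [mem_fibre_act_iff A hF] at hu
    rw [rho_act, ← A.cocycle_eq_of_sameLeaf _ _ (A.sameLeaf_act w y)]
    have h1 := A.rho_add_cocycle_splittingVector hc hu
    rw [← A.cocycleForm_apply y u (_ - w), map_sub, cocycleForm_apply, cocycleForm_apply]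
    linarith

include hc in
theorem fundamental_injOn {x : M} {w : 𝔤} (hw : w ∈ F x) (h : A.fundamentalMap x w = 0) :
    w = 0 := by
  have := A.derivAt_splittingVector_fundamental hF hc hw
  rw [h] at this
  simpa using ((derivAt E (A.splittingVector hc) x).map_zero.symm.trans this)

include hc in
theorem finrank_map_fundamental (x : M) :
    Module.finrank ℝ ((F x).map (A.fundamentalMap x)) = l := by
  rw [← finrank_fibre hF x]
  have hinj : Function.Injective ((A.fundamentalMap x).domRestrict (F x)) := by
    rw [← LinearMap.ker_eq_bot, LinearMap.ker_eq_bot']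
    intro w hw
    exact Subtype.ext (A.fundamental_injOn hF hc w.2 hw)
  rw [← LinearMap.finrank_range_of_inj hinj, LinearMap.range_domRestrict]

omit hF in
/-- The derivative of `y ↦ φ_{τ(y)}(y)` at a zero of `τ`: the first variable
contributes `X_{dτ(ξ)}`, and the second one `ξ`, as `φ_0` is the identity. -/
theorem fixedDeriv_act_section {τ : M → 𝔤} (hτ : ContMDiff 𝓘(ℝ, E) 𝓘(ℝ, 𝔤) ∞ τ) {x : M}
    (hx : τ x = 0) (ξ : E) :
    fixedDeriv E (fun y => A.act (τ y) y) x ξ = ξ + A.fundamentalMap x (derivAt E τ x ξ) := by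
  have h1 : HasMFDerivAt (𝓘(ℝ, 𝔤).prod 𝓘(ℝ, E)) 𝓘(ℝ, E) (fun p : 𝔤 × M => A.act p.1 p.2) (τ x, x)
      (mfderiv (𝓘(ℝ, 𝔤).prod 𝓘(ℝ, E)) 𝓘(ℝ, E) (fun p : 𝔤 × M => A.act p.1 p.2) (τ x, x)) :=
    ((A.contMDiff_act (τ x, x)).mdifferentiableAt (by simp)).hasMFDerivAt
  have h2 := (hasMFDerivAt_derivAt hτ x).prodMk (hasMFDerivAt_id (I := 𝓘(ℝ, E)) x)
  have h3 := (HasMFDerivAt.comp (I' := 𝓘(ℝ, 𝔤).prod 𝓘(ℝ, E))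
    (g := fun p : 𝔤 × M => A.act p.1 p.2) (f := fun y => (τ y, y)) x h1 h2).mfderiv
  refine (congrArg (fun B : E →L[ℝ] E => B ξ) h3).trans ?_
  have h4 := mfderiv_prod_eq_add_apply (v := (derivAt E τ x ξ, ξ)) h1.mdifferentiableAt
  refine h4.trans ?_
  have h5 := A.mfderiv_act_left (τ x) (derivAt E τ x ξ) x
  have h6 : (fun z => A.act (τ x) z) = id := by
    funext z
    rw [hx, act_zero, id]
  have h7 : HasMFDerivAt 𝓘(ℝ, E) 𝓘(ℝ, E) (fun z => A.act (τ x) z) x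
      (ContinuousLinearMap.id ℝ E) := by
    rw [h6]
    exact hasMFDerivAt_id x
  let X : E := A.fundamental (derivAt E τ x ξ) (A.act (τ x) x)
  have h8 : X = A.fundamentalMap x (derivAt E τ x ξ) := by
    have : A.act (τ x) x = x := by rw [hx, act_zero]
    exact congrArg (fun y => A.fundamentalMap y (derivAt E τ x ξ)) this
  have h9 : (mfderiv 𝓘(ℝ, E) 𝓘(ℝ, E) (fun z => A.act (τ x) z) x ξ : E) = ξ :=
    congrArg (fun B : E →L[ℝ] E => B ξ) h7.mfderiv
  refine (congrArg₂ (fun a b : E => a + b) (h5.trans h8) h9).trans (add_comm _ _)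

end WeaklyHamiltonianAction

namespace WeaklyHamiltonianAction

variable {E : Type} [NormedAddCommGroup E] [NormedSpace ℝ E] [FiniteDimensional ℝ E]
  {M : Type*} [TopologicalSpace M] [T2Space M] [ChartedSpace E M] [IsManifold 𝓘(ℝ, E) ∞ M]
  {π : PoissonStructure 𝓘(ℝ, E) M} {𝔤 : Type*} [NormedAddCommGroup 𝔤] [NormedSpace ℝ 𝔤]
  [FiniteDimensional ℝ 𝔤] (A : WeaklyHamiltonianAction π 𝔤)
  {F : M → Submodule ℝ 𝔤} {l : ℕ} (hF : IsSubbundleOverLeafSpace π l F)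
  (hc : A.IsSymplecticOn F)

/-! ### The Poisson–Dirac submanifolds `v = σ` -/

section Level

variable {σ : M → 𝔤} (hσ : ContMDiff 𝓘(ℝ, E) 𝓘(ℝ, 𝔤) ∞ σ) (hσF : ∀ y, σ y ∈ F y)
  (hσc : ∀ x y, π.SameLeaf x y → σ x = σ y)

/-- The retraction `y ↦ φ¹_{v(y) - σ(y)}(y)` onto the level set `v = σ`. -/
noncomputable def levelRetraction (σ : M → 𝔤) (y : M) : M :=
  A.act (A.splittingVector hc y - σ y) y

include hF hσ in
theorem contMDiff_levelRetraction :
    ContMDiff 𝓘(ℝ, E) 𝓘(ℝ, E) ∞ (A.levelRetraction hc σ) := by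
  have h : ContMDiff 𝓘(ℝ, E) 𝓘(ℝ, 𝔤) ∞ (fun y => A.splittingVector hc y - σ y) :=
    (A.contMDiff_splittingVector hc hF).sub hσ
  exact A.contMDiff_act.comp (h.prodMk contMDiff_id)

include hF hσF hσc in
theorem splittingVector_levelRetraction (y : M) :
    A.splittingVector hc (A.levelRetraction hc σ y) = σ (A.levelRetraction hc σ y) := by
  have h : A.splittingVector hc y - σ y ∈ F y :=
    (F y).sub_mem (A.splittingVector_mem hc y) (hσF y)
  rw [levelRetraction, A.splittingVector_act hF hc h, ← hσc y _ (A.sameLeaf_act _ y),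
    sub_sub_cancel]

include hF hσF hσc in
theorem levelRetraction_eq_self_iff {y : M} :
    A.levelRetraction hc σ y = y ↔ A.splittingVector hc y = σ y := by
  refine ⟨fun h => ?_, fun h => ?_⟩
  · have := A.splittingVector_levelRetraction hF hc hσF hσc y
    rwa [h] at this
  · rw [levelRetraction, h, sub_self, act_zero]

include hF hσF hσc in
theorem levelRetraction_idem (y : M) :
    A.levelRetraction hc σ (A.levelRetraction hc σ y) = A.levelRetraction hc σ y :=
  (A.levelRetraction_eq_self_iff hF hc hσF hσc).2
    (A.splittingVector_levelRetraction hF hc hσF hσc y)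

include hF hσ hσF in
/-- Along the level set `v = σ`, the derivative of the retraction differs from the identity by
fundamental vectors of the fibre of `F`. -/
theorem fixedDeriv_levelRetraction {x : M} (hx : A.splittingVector hc x = σ x) (ξ : E) :
    derivAt E (fun y => A.splittingVector hc y - σ y) x ξ ∈ F x ∧
      fixedDeriv E (A.levelRetraction hc σ) x ξ =
        ξ + A.fundamentalMap x (derivAt E (fun y => A.splittingVector hc y - σ y) x ξ) := by
  have h : ContMDiff 𝓘(ℝ, E) 𝓘(ℝ, 𝔤) ∞ (fun y => A.splittingVector hc y - σ y) :=
    (A.contMDiff_splittingVector hc hF).sub hσ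
  exact ⟨A.mfderiv_section_mem hF hc h
    (fun y => (F y).sub_mem (A.splittingVector_mem hc y) (hσF y)) (sub_eq_zero.2 hx) ξ,
    A.fixedDeriv_act_section h (sub_eq_zero.2 hx) ξ⟩

include hF hσ hσc in
theorem derivAt_level_sharp (x : M) (α : Cotangent 𝓘(ℝ, E) x) :
    derivAt E (fun y => A.splittingVector hc y - σ y) x (π.sharp x α : E) =
      derivAt E (A.splittingVector hc) x (π.sharp x α : E) := by
  have h1 : derivAt E (fun y => A.splittingVector hc y - σ y) x =
      derivAt E (A.splittingVector hc) x - derivAt E σ x :=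
    ((hasMFDerivAt_derivAt (A.contMDiff_splittingVector hc hF) x).sub
      (hasMFDerivAt_derivAt hσ x)).mfderiv
  rw [h1]
  refine (congrArg (fun b => derivAt E (A.splittingVector hc) x (π.sharp x α : E) - b)
    (derivAt_sharp_of_const hσ hσc x α)).trans (sub_zero _)

include hF hσ hσF hσc in
theorem ker_fixedDeriv_levelRetraction {x : M} (hx : A.splittingVector hc x = σ x) :
    LinearMap.ker (fixedDeriv E (A.levelRetraction hc σ) x : E →ₗ[ℝ] E) =
      (F x).map (A.fundamentalMap x) := by
  ext ξ
  obtain ⟨h1, h2⟩ := A.fixedDeriv_levelRetraction hF hc hσ hσF hx ξ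
  rw [LinearMap.mem_ker, ContinuousLinearMap.coe_coe, Submodule.mem_map]
  constructor
  · intro h
    rw [h2] at h
    refine ⟨_, (F x).neg_mem h1, ?_⟩
    rw [map_neg]
    exact (eq_neg_of_add_eq_zero_left h).symm
  · rintro ⟨w, hw, rfl⟩
    have h3 := A.derivAt_level_sharp hF hc hσ hσc x (differential 𝓘(ℝ, E) (A.ρ w) x)
    have h4 : derivAt E (fun y => A.splittingVector hc y - σ y) x (A.fundamentalMap x w) = -w :=
      h3.trans (A.derivAt_splittingVector_fundamental hF hc hw)
    rw [h2, h4, map_neg, add_neg_cancel]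

include hF hσ hσF hσc in
theorem isEmbeddedSubmanifold_level :
    IsEmbeddedSubmanifold 𝓘(ℝ, E) l {y | A.levelRetraction hc σ y = y} :=
  isEmbeddedSubmanifold_fixed (A.contMDiff_levelRetraction hF hc hσ)
    (A.levelRetraction_idem hF hc hσF hσc) fun x hx => by
      rw [A.ker_fixedDeriv_levelRetraction hF hc hσ hσF hσc
        ((A.levelRetraction_eq_self_iff hF hc hσF hσc).1 hx), A.finrank_map_fundamental hF hc]

include hF hσ hσF hσc in
/-- A covector `α` with `π^♯ α` tangent to `v = σ` is invariant under the derivative of the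
retraction: it kills the fundamental vectors of the fibre, as `v` is constant in the direction of
`π^♯ α`. -/
theorem covector_levelRetraction {x : M} (hx : A.splittingVector hc x = σ x)
    {α : Cotangent 𝓘(ℝ, E) x}
    (hα : π.sharp x α ∈ tangentSubspace 𝓘(ℝ, E) {y | A.levelRetraction hc σ y = y} x) (ξ : E) :
    α (fixedDeriv E (A.levelRetraction hc σ) x ξ : E) = α ξ := by
  have hr := A.contMDiff_levelRetraction hF hc hσ
  have hrr := A.levelRetraction_idem hF hc hσF hσc
  have hfix := (A.levelRetraction_eq_self_iff hF hc hσF hσc).2 hx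
  rw [mem_tangentSubspace_fixed_iff hr hrr hfix] at hα
  obtain ⟨h1, h2⟩ := A.fixedDeriv_levelRetraction hF hc hσ hσF hx (π.sharp x α : E)
  rw [h2] at hα
  have h3 := A.fundamental_injOn hF hc h1 (add_eq_left.1 hα)
  rw [A.derivAt_level_sharp hF hc hσ hσc] at h3
  have hkill : ∀ w ∈ F x, α (A.fundamental w x) = 0 := by
    intro w hw
    have h4 := A.differential_rho_sharp hF hc hw α
    rw [h3, ← cocycleForm_apply, map_zero, add_zero] at h4
    have h5 := π.skew x α (differential 𝓘(ℝ, E) (A.ρ w) x)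
    rw [h4, neg_zero] at h5
    exact h5
  obtain ⟨h6, h7⟩ := A.fixedDeriv_levelRetraction hF hc hσ hσF hx ξ
  let α' : E →L[ℝ] ℝ := α
  change α' _ = α' ξ
  rw [h7, map_add]
  exact (congrArg (fun b => α' ξ + b) (hkill _ h6)).trans (add_zero _)

include hF hσ hσF hσc in
/-- If `σ` is a smooth section of `F` that is constant along the leaves, the level set `v = σ` is a
Poisson–Dirac submanifold; its induced bracket is `{f ∘ r, g ∘ r}` for the retraction `r`. -/
theorem isPoissonDirac_level : π.IsPoissonDirac {y | A.splittingVector hc y = σ y} := by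
  have hr := A.contMDiff_levelRetraction hF hc hσ
  have hrr := A.levelRetraction_idem hF hc hσF hσc
  have hS : {y | A.splittingVector hc y = σ y} = {y | A.levelRetraction hc σ y = y} :=
    Set.ext fun y => (A.levelRetraction_eq_self_iff hF hc hσF hσc).symm
  have hmem : ∀ x, A.levelRetraction hc σ x = x → ∀ ξ : E,
      (fixedDeriv E (A.levelRetraction hc σ) x ξ : E) ∈
        tangentSubspace 𝓘(ℝ, E) {y | A.levelRetraction hc σ y = y} x := fun x hx ξ =>
    (mem_tangentSubspace_fixed_iff hr hrr hx _).2 (fixedDeriv_idem hr hrr hx ξ)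
  rw [hS]
  refine ⟨⟨l, A.isEmbeddedSubmanifold_level hF hc hσ hσF hσc⟩, fun x hx α hα hαS => ?_,
    fun f g => ?_⟩
  · have hx' := (A.levelRetraction_eq_self_iff hF hc hσF hσc).1 hx
    have h0 : α = 0 := ContinuousLinearMap.ext fun ξ =>
      (A.covector_levelRetraction hF hc hσ hσF hσc hx' hαS ξ).symm.trans (hα _ (hmem x hx ξ))
    rw [h0, map_zero]
  · let fr : C^∞⟮𝓘(ℝ, E), M; ℝ⟯ := ⟨fun y => f (A.levelRetraction hc σ y), f.contMDiff.comp hr⟩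
    let gr : C^∞⟮𝓘(ℝ, E), M; ℝ⟯ := ⟨fun y => g (A.levelRetraction hc σ y), g.contMDiff.comp hr⟩
    refine ⟨π.bracket fr gr, (π.bracket fr gr).contMDiff.contMDiffOn,
      fun x hx α β hα hβ hαS hβS => ?_⟩
    have hx' := (A.levelRetraction_eq_self_iff hF hc hσF hσc).1 hx
    have key : ∀ (f fr : C^∞⟮𝓘(ℝ, E), M; ℝ⟯), (∀ y, fr y = f (A.levelRetraction hc σ y)) →
        ∀ α : Cotangent 𝓘(ℝ, E) x,
        (∀ v ∈ tangentSubspace 𝓘(ℝ, E) {y | A.levelRetraction hc σ y = y} x,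
          α v = differential 𝓘(ℝ, E) f x v) →
        π.sharp x α ∈ tangentSubspace 𝓘(ℝ, E) {y | A.levelRetraction hc σ y = y} x →
        differential 𝓘(ℝ, E) fr x = α := by
      intro f fr hfr α hα hαS
      have h1 : (fr : M → ℝ) = fun y => f (A.levelRetraction hc σ y) := funext hfr
      have h2 := (hasMFDerivAt_comp_fixed hr hx (hasMFDerivAt_derivAt f.contMDiff x)).mfderiv
      refine ContinuousLinearMap.ext fun ξ => ?_
      rw [h1]
      refine (congrArg (fun B : E →L[ℝ] ℝ => B ξ) h2).trans ?_
      exact (hα _ (hmem x hx ξ)).symm.trans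
        (A.covector_levelRetraction hF hc hσ hσF hσc hx' hαS ξ)
    change differential 𝓘(ℝ, E) fr x (π.sharp x (differential 𝓘(ℝ, E) gr x)) = _
    rw [key f fr (fun _ => rfl) α hα hαS, key g gr (fun _ => rfl) β hβ hβS]

end Level

end WeaklyHamiltonianAction

namespace WeaklyHamiltonianAction

variable {E : Type} [NormedAddCommGroup E] [NormedSpace ℝ E] [FiniteDimensional ℝ E]
  {M : Type*} [TopologicalSpace M] [T2Space M] [ChartedSpace E M] [IsManifold 𝓘(ℝ, E) ∞ M]
  {π : PoissonStructure 𝓘(ℝ, E) M} {𝔤 : Type*} [NormedAddCommGroup 𝔤] [NormedSpace ℝ 𝔤]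
  [FiniteDimensional ℝ 𝔤] (A : WeaklyHamiltonianAction π 𝔤)
  {F : M → Submodule ℝ 𝔤} {l : ℕ} (hF : IsSubbundleOverLeafSpace π l F)
  (hc : A.IsSymplecticOn F)

/-! ### The symplectic fibres `L_x` -/

/-- The set `L_x` of points that are moved to `x` by the time-one flow of `X_v`. -/
def splittingFibre (hc : A.IsSymplecticOn F) (x : M) : Set M :=
  {y | A.act (A.splittingVector hc y) y = x}

theorem sameLeaf_of_mem_splittingFibre {x y : M} (hy : y ∈ A.splittingFibre hc x) :
    π.SameLeaf y x :=
  (show A.act (A.splittingVector hc y) y = x from hy) ▸ A.sameLeaf_act _ y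

include hF in
theorem fibre_eq_of_mem_splittingFibre {x y : M} (hy : y ∈ A.splittingFibre hc x) : F y = F x :=
  hF.eq_of_sameLeaf _ _ (A.sameLeaf_of_mem_splittingFibre hc hy)

theorem act_neg_splittingVector {x y : M} (hy : y ∈ A.splittingFibre hc x) :
    A.act (-A.splittingVector hc y) x = y := by
  rw [← (show A.act (A.splittingVector hc y) y = x from hy), act_neg_act]

include hF in
theorem splittingVector_act_neg {x : M} (hx : x ∈ A.zeroLocus F) {w : 𝔤} (hw : w ∈ F x) :
    A.splittingVector hc (A.act (-w) x) = w := by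
  rw [A.splittingVector_act hF hc ((F x).neg_mem hw), (A.mem_zeroLocus_iff hc).1 hx, zero_sub,
    neg_neg]

include hF in
theorem act_neg_mem_splittingFibre {x : M} (hx : x ∈ A.zeroLocus F) {w : 𝔤} (hw : w ∈ F x) :
    A.act (-w) x ∈ A.splittingFibre hc x := by
  change A.act (A.splittingVector hc (A.act (-w) x)) (A.act (-w) x) = x
  rw [A.splittingVector_act_neg hF hc hx hw, act_act_neg]

section Retraction

variable {x : M} (hx : x ∈ A.zeroLocus F) {P : 𝔤 →L[ℝ] 𝔤} (hP : ∀ v, P v ∈ F x)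
  (hPid : ∀ v ∈ F x, P v = v)

/-- The retraction `y ↦ φ¹_{-P v(y)}(x)` onto `L_x`, for a projection `P` of `𝔤` onto `F_x`. -/
noncomputable def fibreRetraction (hc : A.IsSymplecticOn F) (x : M) (P : 𝔤 →L[ℝ] 𝔤) (y : M) : M :=
  A.act (-(P (A.splittingVector hc y))) x

include hF in
theorem contMDiff_fibreRetraction :
    ContMDiff 𝓘(ℝ, E) 𝓘(ℝ, E) ∞ (A.fibreRetraction hc x P) := by
  have h : ContMDiff 𝓘(ℝ, E) 𝓘(ℝ, 𝔤) ∞ (fun y => -(P (A.splittingVector hc y))) :=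
    (P.contMDiff.comp (A.contMDiff_splittingVector hc hF)).neg
  exact (A.contMDiff_act_left x).comp h

include hF hx hP hPid in
theorem fibreRetraction_eq_self_iff {y : M} :
    A.fibreRetraction hc x P y = y ↔ y ∈ A.splittingFibre hc x := by
  refine ⟨fun h => ?_, fun h => ?_⟩
  · rw [← h]
    exact A.act_neg_mem_splittingFibre hF hc hx (hP _)
  · rw [fibreRetraction, hPid, A.act_neg_splittingVector hc h]
    rw [← A.fibre_eq_of_mem_splittingFibre hF hc h]
    exact A.splittingVector_mem hc y

include hF hx hP hPid in
theorem fibreRetraction_idem (y : M) :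
    A.fibreRetraction hc x P (A.fibreRetraction hc x P y) = A.fibreRetraction hc x P y :=
  (A.fibreRetraction_eq_self_iff hF hc hx hP hPid).2
    (A.act_neg_mem_splittingFibre hF hc hx (hP _))

include hF hx hP hPid in
theorem fixedDeriv_fibreRetraction {y : M} (hy : y ∈ A.splittingFibre hc x) (ξ : E) :
    fixedDeriv E (A.fibreRetraction hc x P) y ξ =
      A.fundamentalMap y (-(P (derivAt E (A.splittingVector hc) y ξ))) := by
  have h0 : HasMFDerivAt 𝓘(ℝ, E) 𝓘(ℝ, 𝔤) (fun y => (-P) (A.splittingVector hc y)) y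
      ((-P).comp (derivAt E (A.splittingVector hc) y)) :=
    (-P).hasMFDerivAt.comp y (hasMFDerivAt_derivAt (A.contMDiff_splittingVector hc hF) y)
  have h1 := ((A.contMDiff_act_left x (-(P (A.splittingVector hc y)))).mdifferentiableAt
    (by simp)).hasMFDerivAt
  have h2 := (HasMFDerivAt.comp (I' := 𝓘(ℝ, 𝔤)) (g := fun u => A.act u x)
    (f := fun y => (-P) (A.splittingVector hc y)) y h1 h0).mfderiv
  refine (congrArg (fun B : E →L[ℝ] E => B ξ) h2).trans ?_
  refine (A.mfderiv_act_left _ _ x).trans ?_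
  exact congrArg (fun z => A.fundamentalMap z (-(P (derivAt E (A.splittingVector hc) y ξ))))
    ((A.fibreRetraction_eq_self_iff hF hc hx hP hPid).2 hy)

include hF hx hP hPid in
theorem fixedDeriv_fibreRetraction_fundamental {y : M} (hy : y ∈ A.splittingFibre hc x) {w : 𝔤}
    (hw : w ∈ F y) : fixedDeriv E (A.fibreRetraction hc x P) y (A.fundamentalMap y w) =
      A.fundamentalMap y w := by
  rw [A.fixedDeriv_fibreRetraction hF hc hx hP hPid hy,
    A.derivAt_splittingVector_fundamental hF hc hw, map_neg P, neg_neg, hPid]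
  rwa [← A.fibre_eq_of_mem_splittingFibre hF hc hy]

include hF hx hP hPid in
theorem range_fixedDeriv_fibreRetraction {y : M} (hy : y ∈ A.splittingFibre hc x) :
    LinearMap.range (fixedDeriv E (A.fibreRetraction hc x P) y : E →ₗ[ℝ] E) =
      (F y).map (A.fundamentalMap y) := by
  ext ξ
  rw [LinearMap.mem_range, Submodule.mem_map]
  constructor
  · rintro ⟨ξ, rfl⟩
    refine ⟨_, ?_, (A.fixedDeriv_fibreRetraction hF hc hx hP hPid hy ξ).symm⟩
    rw [A.fibre_eq_of_mem_splittingFibre hF hc hy]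
    exact (F x).neg_mem (hP _)
  · rintro ⟨w, hw, rfl⟩
    exact ⟨_, A.fixedDeriv_fibreRetraction_fundamental hF hc hx hP hPid hy hw⟩

end Retraction

include hF in
theorem isEmbeddedSubmanifold_splittingFibre {x : M} (hx : x ∈ A.zeroLocus F) :
    IsEmbeddedSubmanifold 𝓘(ℝ, E) (Module.finrank ℝ E - l) (A.splittingFibre hc x) := by
  obtain ⟨P, hP, hPid⟩ := exists_projection (F x)
  have hS : A.splittingFibre hc x = {y | A.fibreRetraction hc x P y = y} :=
    Set.ext fun y => (A.fibreRetraction_eq_self_iff hF hc hx hP hPid).symm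
  rw [hS]
  refine isEmbeddedSubmanifold_fixed (A.contMDiff_fibreRetraction hF hc)
    (A.fibreRetraction_idem hF hc hx hP hPid) fun y hy => ?_
  have hy' := (A.fibreRetraction_eq_self_iff hF hc hx hP hPid).1 hy
  have h := LinearMap.finrank_range_add_finrank_ker
    (fixedDeriv E (A.fibreRetraction hc x P) y : E →ₗ[ℝ] E)
  rw [A.range_fixedDeriv_fibreRetraction hF hc hx hP hPid hy',
    A.finrank_map_fundamental hF hc] at h
  omega

include hF in
/-- The tangent space of `L_x` consists of the fundamental vectors of the fibre of `F`. -/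
theorem mem_tangentSubspace_splittingFibre_iff {x : M} (hx : x ∈ A.zeroLocus F) {y : M}
    (hy : y ∈ A.splittingFibre hc x) (ξ : TangentSpace 𝓘(ℝ, E) y) :
    ξ ∈ tangentSubspace 𝓘(ℝ, E) (A.splittingFibre hc x) y ↔
      ∃ w ∈ F y, A.fundamental w y = ξ := by
  obtain ⟨P, hP, hPid⟩ := exists_projection (F x)
  have hS : A.splittingFibre hc x = {y | A.fibreRetraction hc x P y = y} :=
    Set.ext fun y => (A.fibreRetraction_eq_self_iff hF hc hx hP hPid).symm
  have hfix := (A.fibreRetraction_eq_self_iff hF hc hx hP hPid).2 hy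
  rw [hS, mem_tangentSubspace_fixed_iff (A.contMDiff_fibreRetraction hF hc)
    (A.fibreRetraction_idem hF hc hx hP hPid) hfix]
  constructor
  · intro h
    have h1 : (ξ : E) ∈
        LinearMap.range (fixedDeriv E (A.fibreRetraction hc x P) y : E →ₗ[ℝ] E) := ⟨_, h⟩
    rw [A.range_fixedDeriv_fibreRetraction hF hc hx hP hPid hy] at h1
    exact h1
  · rintro ⟨w, hw, rfl⟩
    exact A.fixedDeriv_fibreRetraction_fundamental hF hc hx hP hPid hy hw

/-- The leaf form on fundamental vectors is the cocycle. -/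
theorem leafForm_fundamental {y : M} {a b : 𝔤} {v w : π.leafTangent y}
    (hv : A.fundamental a y = v) (hw : A.fundamental b y = w) :
    π.leafForm y v w = A.cocycle a b y := by
  obtain ⟨v, hv'⟩ := v
  obtain ⟨w, hw'⟩ := w
  subst hv hw
  exact π.leafForm_sharp y (differential 𝓘(ℝ, E) (A.ρ a) y) (differential 𝓘(ℝ, E) (A.ρ b) y)

include hF in
theorem isSymplecticSubmanifoldOfLeaf_splittingFibre {x : M} (hx : x ∈ A.zeroLocus F) :
    π.IsSymplecticSubmanifoldOfLeaf x (A.splittingFibre hc x) where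
  submanifold := ⟨_, A.isEmbeddedSubmanifold_splittingFibre hF hc hx⟩
  subset_leaf y hy := (A.sameLeaf_of_mem_splittingFibre hc hy).symm
  tangent y hy ξ hξ := by
    obtain ⟨w, -, rfl⟩ := (A.mem_tangentSubspace_splittingFibre_iff hF hc hx hy ξ).1 hξ
    exact LinearMap.mem_range_self _ _
  nondegenerate y hy v hv h := by
    obtain ⟨a, ha, hav⟩ := (A.mem_tangentSubspace_splittingFibre_iff hF hc hx hy _).1 hv
    have h0 : a = 0 := hc y a ha fun b hb => by
      rw [← A.leafForm_fundamental (w := ⟨A.fundamental b y, LinearMap.mem_range_self _ _⟩) hav rfl]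
      exact h _ ((A.mem_tangentSubspace_splittingFibre_iff hF hc hx hy _).2 ⟨b, hb, rfl⟩)
    refine Subtype.ext (hav.symm.trans ?_)
    rw [h0]
    exact (A.fundamentalₗ y).map_zero

include hF in
theorem isDiffeomorphismBetween_splittingFibre {x : M} (hx : x ∈ A.zeroLocus F) :
    IsDiffeomorphismBetween 𝓘(ℝ, E) 𝓘(ℝ, 𝔤) (A.splittingVector hc) (A.splittingFibre hc x)
      (F x : Set 𝔤) := by
  refine ⟨(A.contMDiff_splittingVector hc hF).contMDiffOn, ⟨fun y hy => ?_, fun y hy z hz h => ?_,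
    fun w hw => ⟨A.act (-w) x, A.act_neg_mem_splittingFibre hF hc hx hw,
      A.splittingVector_act_neg hF hc hx hw⟩⟩, fun w => A.act (-w) x, ?_,
    fun y hy => A.act_neg_splittingVector hc hy⟩
  · rw [← A.fibre_eq_of_mem_splittingFibre hF hc hy]
    exact A.splittingVector_mem hc y
  · rw [← A.act_neg_splittingVector hc hy, h, A.act_neg_splittingVector hc hz]
  · exact ((A.contMDiff_act_left x).comp contDiff_neg.contMDiff).contMDiffOn

include hF in
theorem cocycle_mfderiv_splittingVector {x : M} (hx : x ∈ A.zeroLocus F) {y : M}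
    (hy : y ∈ A.splittingFibre hc x) (v w : π.leafTangent y)
    (hv : (v : TangentSpace 𝓘(ℝ, E) y) ∈ tangentSubspace 𝓘(ℝ, E) (A.splittingFibre hc x) y)
    (hw : (w : TangentSpace 𝓘(ℝ, E) y) ∈ tangentSubspace 𝓘(ℝ, E) (A.splittingFibre hc x) y) :
    A.cocycle (mfderiv 𝓘(ℝ, E) 𝓘(ℝ, 𝔤) (A.splittingVector hc) y v)
      (mfderiv 𝓘(ℝ, E) 𝓘(ℝ, 𝔤) (A.splittingVector hc) y w) x = π.leafForm y v w := by
  obtain ⟨a, ha, hav⟩ := (A.mem_tangentSubspace_splittingFibre_iff hF hc hx hy _).1 hv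
  obtain ⟨b, hb, hbw⟩ := (A.mem_tangentSubspace_splittingFibre_iff hF hc hx hy _).1 hw
  have h1 : ∀ {u : 𝔤} {ξ : TangentSpace 𝓘(ℝ, E) y}, u ∈ F y → A.fundamental u y = ξ →
      (mfderiv 𝓘(ℝ, E) 𝓘(ℝ, 𝔤) (A.splittingVector hc) y ξ : 𝔤) = -u := by
    rintro u ξ hu rfl
    exact A.derivAt_splittingVector_fundamental hF hc hu
  have h2 : A.cocycle (-a) (-b) x = A.cocycle a b x := by
    rw [← cocycleForm_apply, map_neg, map_neg, LinearMap.neg_apply, neg_neg, cocycleForm_apply]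
  rw [A.leafForm_fundamental hav hbw,
    A.cocycle_eq_of_sameLeaf a b (A.sameLeaf_of_mem_splittingFibre hc hy), ← h2]
  exact congrArg₂ (fun a b => A.cocycle a b x) (h1 ha hav) (h1 hb hbw)

end WeaklyHamiltonianAction

/-! ### Parity of the rank -/

/-- A vector space carrying a non-degenerate skew-symmetric form has even dimension: the matrix `C`
of the form satisfies `det C = det Cᵀ = (-1) ^ l * det C`. -/
theorem even_finrank_of_skew_nondegenerate {V : Type*} [AddCommGroup V] [Module ℝ V]
    [FiniteDimensional ℝ V] (B : LinearMap.BilinForm ℝ V) (hskew : ∀ u v, B u v = -B v u)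
    (hB : ∀ u, (∀ v, B u v = 0) → u = 0) : Even (Module.finrank ℝ V) := by
  let b := Module.finBasis ℝ V
  have hnd : B.Nondegenerate :=
    ⟨hB, fun u hu => hB u fun v => by rw [hskew, hu, neg_zero]⟩
  have hdet := (LinearMap.BilinForm.nondegenerate_iff_det_ne_zero b).1 hnd
  have hT : (LinearMap.BilinForm.toMatrix b B).transpose = -LinearMap.BilinForm.toMatrix b B := by
    ext i j
    simpa [LinearMap.BilinForm.toMatrix_apply] using hskew (b j) (b i)
  have h := Matrix.det_transpose (LinearMap.BilinForm.toMatrix b B)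
  rw [hT, Matrix.det_neg, Fintype.card_fin] at h
  exact (neg_one_pow_eq_one_iff_even (by norm_num)).1
    (mul_right_cancel₀ hdet (h.trans (one_mul _).symm))

namespace WeaklyHamiltonianAction

variable {E : Type} [NormedAddCommGroup E] [NormedSpace ℝ E] [FiniteDimensional ℝ E]
  {M : Type*} [TopologicalSpace M] [T2Space M] [ChartedSpace E M] [IsManifold 𝓘(ℝ, E) ∞ M]
  {π : PoissonStructure 𝓘(ℝ, E) M} {𝔤 : Type*} [NormedAddCommGroup 𝔤] [NormedSpace ℝ 𝔤]
  [FiniteDimensional ℝ 𝔤] (A : WeaklyHamiltonianAction π 𝔤)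
  {F : M → Submodule ℝ 𝔤} {l : ℕ} (hF : IsSubbundleOverLeafSpace π l F)
  (hc : A.IsSymplecticOn F)

include hF hc in
theorem even_rank (x : M) : Even l := by
  rw [← finrank_fibre hF x]
  refine even_finrank_of_skew_nondegenerate ((A.cocycleForm x).domRestrict₁₂ (F x) (F x))
    (fun u v => A.cocycle_skew u v x) fun u hu => ?_
  exact Subtype.ext (hc x u u.2 fun v hv => hu ⟨v, hv⟩)

/-! ### The splitting map -/

include hF in
theorem act_splittingVector_mem_zeroLocus (y : M) :
    A.act (A.splittingVector hc y) y ∈ A.zeroLocus F := by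
  rw [A.mem_zeroLocus_iff hc, A.splittingVector_act hF hc (A.splittingVector_mem hc y), sub_self]

/-- The map `Φ : y ↦ (v(y), φ¹_{v(y)}(y))`. -/
noncomputable def splittingMap (hc : A.IsSymplecticOn F) (y : M) : 𝔤 × M :=
  (A.splittingVector hc y, A.act (A.splittingVector hc y) y)

theorem act_neg_splittingMap (y : M) :
    A.act (-(A.splittingMap hc y).1) (A.splittingMap hc y).2 = y :=
  A.act_neg_act _ y

include hF in
theorem splittingMap_act_neg {x : M} (hx : x ∈ A.zeroLocus F) {w : 𝔤} (hw : w ∈ F x) :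
    A.splittingMap hc (A.act (-w) x) = (w, x) :=
  Prod.ext (A.splittingVector_act_neg hF hc hx hw) (A.act_neg_mem_splittingFibre hF hc hx hw)

include hF in
theorem contMDiff_splittingMap :
    ContMDiff 𝓘(ℝ, E) (𝓘(ℝ, 𝔤).prod 𝓘(ℝ, E)) ∞ (A.splittingMap hc) :=
  (A.contMDiff_splittingVector hc hF).prodMk
    (A.contMDiff_act.comp ((A.contMDiff_splittingVector hc hF).prodMk contMDiff_id))

include hF in
theorem isDiffeomorphismBetween_splittingMap :
    IsDiffeomorphismBetween 𝓘(ℝ, E) (𝓘(ℝ, 𝔤).prod 𝓘(ℝ, E)) (A.splittingMap hc) Set.univ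
      (restrictedBundle F (A.zeroLocus F)) := by
  refine ⟨(A.contMDiff_splittingMap hF hc).contMDiffOn, ⟨fun y _ => ?_, fun y _ z _ h => ?_, ?_⟩,
    fun p => A.act (-p.1) p.2, ?_, fun y _ => A.act_neg_splittingMap hc y⟩
  · exact ⟨A.act_splittingVector_mem_zeroLocus hF hc y,
      (mem_fibre_act_iff A hF).2 (A.splittingVector_mem hc y)⟩
  · rw [← A.act_neg_splittingMap hc y, h, A.act_neg_splittingMap hc z]
  · rintro ⟨w, x⟩ ⟨hx, hw⟩
    exact ⟨A.act (-w) x, Set.mem_univ _, A.splittingMap_act_neg hF hc hx hw⟩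
  · exact (A.contMDiff_act.comp
      ((contDiff_neg.contMDiff.comp contMDiff_fst).prodMk contMDiff_snd)).contMDiffOn

/-! ### Framings -/

section Framing

variable (b : FramingOverLeafSpace π l F)

/-- The `i`-th section of the frame determined by a framing. -/
noncomputable def frameSection (b : FramingOverLeafSpace π l F) (i : Fin l) (y : M) : 𝔤 :=
  (b.iso y).symm (EuclideanSpace.single i 1)

theorem iso_symm_eq_sum_frameSection (w : EuclideanSpace ℝ (Fin l)) (y : M) :
    ((b.iso y).symm w : 𝔤) = ∑ i, w i • frameSection b i y := by
  have h := congrArg (fun w => ((b.iso y).symm w : 𝔤))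
    ((EuclideanSpace.basisFun (Fin l) ℝ).sum_repr w)
  simp only [map_sum, map_smul, EuclideanSpace.basisFun_repr, EuclideanSpace.basisFun_apply] at h
  rw [← h]
  simp [frameSection]

theorem linearIndependent_frameSection (y : M) :
    LinearIndependent ℝ (fun i => frameSection b i y) ∧
      Submodule.span ℝ (Set.range fun i => frameSection b i y) = F y := by
  let B := (EuclideanSpace.basisFun (Fin l) ℝ).toBasis.map (b.iso y).symm
  have hB : (fun i => frameSection b i y) = (F y).subtype ∘ B := by
    funext i
    simp [B, frameSection]
  rw [hB]
  refine ⟨B.linearIndependent.map' _ (Submodule.ker_subtype _), ?_⟩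
  rw [Set.range_comp, ← Submodule.map_span, B.span_eq, Submodule.map_top, Submodule.range_subtype]

/-- The composite of the splitting map with a framing of `F`. As the framing is constant along the
leaves, `b_y` may be applied to `v(y)` in place of `b_x` for the second component `x` of `Φ y`. -/
noncomputable def framedSplittingMap (hc : A.IsSymplecticOn F) (b : FramingOverLeafSpace π l F)
    (y : M) : EuclideanSpace ℝ (Fin l) × M :=
  (b.iso y ⟨A.splittingVector hc y, A.splittingVector_mem hc y⟩, (A.splittingMap hc y).2)

theorem iso_symm_framedSplittingMap (y : M) :
    ((b.iso (A.splittingMap hc y).2).symm (A.framedSplittingMap hc b y).1 : 𝔤) =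
      (A.splittingMap hc y).1 := by
  refine (b.eq_of_sameLeaf y _ (A.sameLeaf_act (A.splittingVector hc y) y) _).symm.trans ?_
  rw [framedSplittingMap, LinearEquiv.symm_apply_apply]
  rfl

include hF in
theorem contMDiff_framedSplittingMap :
    ContMDiff 𝓘(ℝ, E) ((𝓡 l).prod 𝓘(ℝ, E)) ∞ (A.framedSplittingMap hc b) := by
  refine ContMDiff.prodMk ?_ (contMDiff_snd.comp (A.contMDiff_splittingMap hF hc))
  have hs : ∀ i, ContMDiffOn 𝓘(ℝ, E) 𝓘(ℝ, 𝔤) ∞ (frameSection b i) Set.univ := fun i =>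
    (b.smooth _).contMDiffOn
  obtain ⟨a, ha, hsum⟩ := A.exists_smooth_coordinates hc (A.splittingVector_mem hc) hs
    (fun y _ => linearIndependent_frameSection b y)
    (fun i => A.contMDiffOn_cocycle (hs i) (A.contMDiff_splittingVector hc hF).contMDiffOn)
  have ha' : ContMDiff 𝓘(ℝ, E) (𝓡 l) ∞
      (fun y => ∑ i, a i y • (EuclideanSpace.single i 1 : EuclideanSpace ℝ (Fin l))) :=
    contMDiffOn_univ.1 (contMDiffOn_finsetSum fun i _ => (ha i).smul contMDiffOn_const)
  refine ha'.congr fun y => (b.iso y).symm.injective (Subtype.ext ?_)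
  rw [LinearEquiv.symm_apply_apply]
  refine (hsum y (Set.mem_univ y)).symm.trans ?_
  simp [map_sum, frameSection]

include hF in
theorem isDiffeomorphismBetween_framedSplittingMap :
    IsDiffeomorphismBetween 𝓘(ℝ, E) ((𝓡 l).prod 𝓘(ℝ, E)) (A.framedSplittingMap hc b) Set.univ
      (Set.univ ×ˢ A.zeroLocus F) := by
  have hinv : ∀ y, A.act (-((b.iso (A.framedSplittingMap hc b y).2).symm
      (A.framedSplittingMap hc b y).1 : 𝔤)) (A.framedSplittingMap hc b y).2 = y := fun y => by
    change A.act (-((b.iso (A.splittingMap hc y).2).symm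
      (A.framedSplittingMap hc b y).1 : 𝔤)) (A.splittingMap hc y).2 = y
    rw [A.iso_symm_framedSplittingMap, A.act_neg_splittingMap]
  refine ⟨(A.contMDiff_framedSplittingMap hF hc b).contMDiffOn,
    ⟨fun y _ => ⟨Set.mem_univ _, A.act_splittingVector_mem_zeroLocus hF hc y⟩,
      fun y _ z _ h => ?_, ?_⟩,
    fun p => A.act (-((b.iso p.2).symm p.1 : 𝔤)) p.2, ?_, fun y _ => hinv y⟩
  · rw [← hinv y, h, hinv z]
  · rintro ⟨w, x⟩ ⟨-, hx⟩
    have h1 := A.splittingMap_act_neg hF hc hx ((b.iso x).symm w).2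
    have h2 : (A.framedSplittingMap hc b (A.act (-((b.iso x).symm w : 𝔤)) x)).2 = x :=
      congrArg Prod.snd h1
    refine ⟨_, Set.mem_univ _, Prod.ext ((b.iso x).symm.injective (Subtype.ext ?_)) h2⟩
    have h3 := A.iso_symm_framedSplittingMap hc b (A.act (-((b.iso x).symm w : 𝔤)) x)
    rw [h1] at h3
    exact h3
  · have h1 : ContMDiff ((𝓡 l).prod 𝓘(ℝ, E)) 𝓘(ℝ, 𝔤) ∞
        (fun p : EuclideanSpace ℝ (Fin l) × M => ∑ i, p.1 i • frameSection b i p.2) :=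
      contMDiffOn_univ.1 (contMDiffOn_finsetSum fun i _ => ContMDiff.contMDiffOn
        (((EuclideanSpace.proj i : EuclideanSpace ℝ (Fin l) →L[ℝ] ℝ).contMDiff.comp
          contMDiff_fst).smul ((b.smooth _).comp contMDiff_snd)))
    have h2 : ContMDiff ((𝓡 l).prod 𝓘(ℝ, E)) 𝓘(ℝ, 𝔤) ∞
        (fun p : EuclideanSpace ℝ (Fin l) × M => ((b.iso p.2).symm p.1 : 𝔤)) :=
      h1.congr fun p => iso_symm_eq_sum_frameSection b p.1 p.2
    exact (A.contMDiff_act.comp (h2.neg.prodMk contMDiff_snd)).contMDiffOn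

include hF in
/-- The preimage of `{u} × N` is the level set `v = σ` of the section `σ` with constant coordinates
`u` in the framing. -/
theorem framedSplittingMap_preimage (u : EuclideanSpace ℝ (Fin l)) :
    A.framedSplittingMap hc b ⁻¹' ({u} ×ˢ A.zeroLocus F) =
      {y | A.splittingVector hc y = ((b.iso y).symm u : 𝔤)} := by
  ext y
  have h : (A.framedSplittingMap hc b y).2 ∈ A.zeroLocus F :=
    A.act_splittingVector_mem_zeroLocus hF hc y
  rw [Set.mem_preimage, Set.mem_prod, and_iff_left h, Set.mem_singleton_iff, Set.mem_ofPred_eq,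
    framedSplittingMap, ← LinearEquiv.eq_symm_apply, Subtype.ext_iff]

end Framing

end WeaklyHamiltonianAction

end PoissonSplitting

open PoissonSplitting in
theorem mainTheorem1 {n : ℕ} {M : Type*} [TopologicalSpace M] [T2Space M]
    [SecondCountableTopology M] [ConnectedSpace M] [ChartedSpace (EuclideanSpace ℝ (Fin n)) M]
    [IsManifold (𝓡 n) ∞ M] (π : PoissonStructure (𝓡 n) M)
    {𝔤 : Type*} [NormedAddCommGroup 𝔤] [NormedSpace ℝ 𝔤] [FiniteDimensional ℝ 𝔤]
    (A : WeaklyHamiltonianAction π 𝔤) (l : ℕ) (F : M → Submodule ℝ 𝔤)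
    (hF : IsSubbundleOverLeafSpace π l F) (hc : A.IsSymplecticOn F) :
    (∃ d, l = 2 * d) ∧ π.IsPoissonDirac (A.zeroLocus F) ∧
    ∃ Φ : M → 𝔤 × M,
      -- `Φ y = (v, φ_v^1 y)`, where `φ_v` is the flow of `X_v`
      (∀ y, ∃ γ : ℝ → M, IsMIntegralCurve γ (A.fundamental (Φ y).1) ∧
        γ 0 = y ∧ γ 1 = (Φ y).2) ∧
      IsDiffeomorphismBetween (𝓡 n) (𝓘(ℝ, 𝔤).prod (𝓡 n)) Φ Set.univ
        (restrictedBundle F (A.zeroLocus F)) ∧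
      (∀ x ∈ A.zeroLocus F,
        π.IsSymplecticSubmanifoldOfLeaf x {y | (Φ y).2 = x} ∧
        IsDiffeomorphismBetween (𝓡 n) 𝓘(ℝ, 𝔤) (fun y => (Φ y).1) {y | (Φ y).2 = x}
          (F x : Set 𝔤) ∧
        ∀ y, (Φ y).2 = x → ∀ v w : π.leafTangent y,
          (v : TangentSpace (𝓡 n) y) ∈ tangentSubspace (𝓡 n) {y | (Φ y).2 = x} y →
          (w : TangentSpace (𝓡 n) y) ∈ tangentSubspace (𝓡 n) {y | (Φ y).2 = x} y →
          A.cocycle (mfderiv (𝓡 n) 𝓘(ℝ, 𝔤) (fun y => (Φ y).1) y v)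
            (mfderiv (𝓡 n) 𝓘(ℝ, 𝔤) (fun y => (Φ y).1) y w) x = π.leafForm y v w) ∧
      ∀ b : FramingOverLeafSpace π l F,
        ∃ Ψ : M → EuclideanSpace ℝ (Fin l) × M,
          (∀ y, (Ψ y).2 = (Φ y).2 ∧ ((b.iso (Φ y).2).symm (Ψ y).1 : 𝔤) = (Φ y).1) ∧
          IsDiffeomorphismBetween (𝓡 n) ((𝓡 l).prod (𝓡 n)) Ψ Set.univ
            (Set.univ ×ˢ A.zeroLocus F) ∧
          ∀ u : EuclideanSpace ℝ (Fin l),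
            π.IsPoissonDirac (Ψ ⁻¹' ({u} ×ˢ A.zeroLocus F)) := by
  have hN : A.zeroLocus F = {y | A.splittingVector hc y = (fun _ => (0 : 𝔤)) y} :=
    Set.ext fun y => A.mem_zeroLocus_iff hc
  refine ⟨?_, ?_, A.splittingMap hc, fun y => ?_, A.isDiffeomorphismBetween_splittingMap hF hc,
    fun x hx => ⟨A.isSymplecticSubmanifoldOfLeaf_splittingFibre hF hc hx,
      A.isDiffeomorphismBetween_splittingFibre hF hc hx,
      fun y hy v w hv hw => A.cocycle_mfderiv_splittingVector hF hc hx hy v w hv hw⟩,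
    fun b => ⟨A.framedSplittingMap hc b, fun y => ⟨rfl, A.iso_symm_framedSplittingMap hc b y⟩,
      A.isDiffeomorphismBetween_framedSplittingMap hF hc b, fun u => ?_⟩⟩
  · obtain ⟨x⟩ := (inferInstance : Nonempty M)
    obtain ⟨d, hd⟩ := A.even_rank hF hc x
    exact ⟨d, hd.trans (two_mul d).symm⟩
  · rw [hN]
    exact A.isPoissonDirac_level hF hc contMDiff_const (fun y => (F y).zero_mem) fun _ _ _ => rfl
  · refine ⟨_, A.isMIntegralCurve_act (A.splittingVector hc y) y, ?_, ?_⟩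
    · rw [zero_smul, WeaklyHamiltonianAction.act_zero]
    · rw [one_smul]
      rfl
  · rw [A.framedSplittingMap_preimage hF hc b]
    exact A.isPoissonDirac_level hF hc (b.smooth u) (fun y => ((b.iso y).symm u).2)
      fun x y h => b.eq_of_sameLeaf x y h u
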